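/- **Setting.** Let $V$ be a finite-dimensional real vector space with a finite free family $(\alpha_i)_{i\in I}$ in $V^*$ and a family $(\alpha_i^\vee)_{i\in I}$ in $V$ such that $\alpha_i(\alpha_i^\vee)=2$. Put $r_i(v)=v-\alpha_i(v)\alpha_i^\vee$, $W^v=\langle r_i\rangle$, $\Phi=\{w\alpha_i\}$. Assume that $(W^v,(r_i)_{i\in I})$ is a Coxeter system, that $\Phi=\Phi^+\sqcup\Phi^-$ with $\Phi^+=\Phi\cap\bigoplus_i\mathbb R_{\ge0}\alpha_i=-\Phi^-$, that $w\alpha_i\in\Phi^+\iff\ell(wr_i)>\ell(w)$, and that $\Phi\cap\mathbb R_{>0}\alpha=\{\alpha\}$ for $\alpha\in\Phi$. Let $\Delta_{im}\subset V^*\setminus\{0\}$ be a set, disjoint from $\mathbb R\Phi$, with $\Delta_{im}=\Delta_{im}^+\cup-\Delta_{im}^+$, where $\Delta_{im}^+=\Delta_{im}\cap\bigoplus_i\mathbb R_{\ge0}\alpha_i$ is $W^v$-stable (the moderately imaginary case); put $\Delta=\Phi\cup\Delta_{im}$. The vectorial facets are the $\pm wF^v(J)$, $F^v(J)=\{v:\alpha_i(v)=0\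 (i\in J),\ \alpha_i(v)>0\ (i\notin J)\}$, for $J\subset I$, $w\in W^v$; such a facet is spherical if $\langle r_i:i\in J\rangle$ is finite, a chamber if $J=\emptyset$, a panel if $|J|=1$. The Tits cone $\mathcal T$ is the union of the $wF^v(J)$. Let $\mathbb A$ be an affine space under $V$ with a set $\mathcal M$ of hyperplanes (walls), each of direction $\ker\alpha$ for some $\alpha\in\Phi$, infinitely many for each $\alpha\in\Phi$, and stable under the group $W$ generated by the reflections $r_M$, $M\in\mathcal M$ (if $M$ has direction $\ker(w\alpha_i)$, $r_M$ fixes $M$ pointwise and has linear part $wr_iw^{-1}$). For $\alpha\in\Delta$, an admissible half-space of $\alpha$ is $\mathbb A$, or a half-space $\{\alpha\ge c\}$ (closed) or $\{\alpha>c\}$ (open) which, if $\alpha\in\Phi$, is bounded by a wall. A closed half-space $\{\alpha\ge c\}$ with $\alpha\in\Phi$, bounded by a wall $M$, is a half-apartment, and $M$ is its wall. Filters of subsets are used as generalized subsets ($F\subset F'$ means $F'\subseteq F$ as families of sets; a set contains a filter if it is an element of it; a map fixes a filter if it fixes pointwise one of its elements). The enclosure $cl(F)$ is the filter of sets containing an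 element of $F$ of the form $\bigcap_{\alpha\in\Delta}D_\alpha$ with one closed admissible half-space (or $\mathbb A$) for each $\alpha$. The facet $F(x,F^v)$ is the filter of sets containing an intersection of admissible half-spaces, one for each $\alpha\in\Delta$, open or closed, which contains a neighbourhood of $x$ in $x+F^v$. It is a chamber if $F^v$ can be taken to be a vectorial chamber, and a panel if it can be written with $F^v$ a vectorial panel and $x$ on a wall of direction $\operatorname{span}F^v$. A facet $F'$ dominates $F$ if $F\subset\overline{F'}$. A chimney is $\mathfrak r=cl(F+F^v)$ ($F$ a facet, $F^v$ a vectorial facet); it is splayed if $F^v$ is spherical, solid if the direction of its support has a finite pointwise stabilizer in $W^v$; its germ is the filter of sets containing some $cl(F+\xi+F^v)$, $\xi\in\overline{F^v}$. An affine hovel of type $\mathbb A$ is a set $\mathcal I$ covered by a set $\mathcal A$ of subsets (apartments) such that: (MA1) each $A\in\mathcal A$ carries a set of bijections $\mathbb A\to A$ forming one orbit $f_0\circ W$ (so that all the notions above make sense in $A$; an isomorphism $A\to A'$ is a bijection carrying these bijections to those of $A'$); (MA2) if $F$ is a point, the germ at $x$ of an interval $]x,y]$ with $x\neq y$ and $y-x\in\pm\mathcal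 T$, a half-line with direction in a spherical vectorial facet, or a solid chimney, of an apartment $A$, and $A'$ is an apartment containing $F$, then $A\cap A'$ contains $cl_A(F)$ and some isomorphism $A\to A'$ fixes $cl_A(F)$; (MA3) if $\mathfrak R$ is the germ of a splayed chimney and $F$ a facet or the germ of a solid chimney, some apartment contains $\mathfrak R$ and $F$; (MA4) if two apartments $A,A'$ contain $\mathfrak R$ and $F$ as in (MA3), then $A\cap A'$ contains $cl_A(\mathfrak R\cup F)$ and some isomorphism $A\to A'$ fixes it. The facets, chambers, panels, half-apartments and walls of $\mathcal I$ are those of its apartments, and a chamber dominates a panel in $\mathcal I$ if it does so in some apartment containing both. The hovel is thick if every panel is dominated by at least three chambers. **Statement.** Let $\mathcal I$ be an affine hovel. 1. Let $D$ be a half-apartment of $\mathcal I$ with wall $M=\partial D$, let $F$ be a panel contained in $M$ and $C$ a chamber of $\mathcal I$ dominating $F$. Then there is an apartment of $\mathcal I$ containing $D$ and $C$. 2. Let $D$ and $D_1$ be two half-apartments of $\mathcal I$ with the same wall $M=\partial D=\partial D_1$ and with $D\cap D_1=M$. Then $D\cup D_1$ is an apartment of $\mathcal I$. 3. If $\mathcal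 I$ is thick, every half-apartment of $\mathcal I$ is the intersection of two apartments of $\mathcal I$. -/

import Mathlib

open Set Filter Topology Module

namespace AffineHovel

/-! ### Vectorial Weyl group and roots -/

/-- A finite free family of simple roots and a family of simple coroots in a real vector space. -/
structure SimpleRootData (I V : Type*) [AddCommGroup V] [Module ℝ V] where
  root : I → Dual ℝ V
  coroot : I → V
  linearIndependent_root : LinearIndependent ℝ root
  root_coroot_two : ∀ i, root i (coroot i) = 2

namespace SimpleRootData

variable {I V : Type*} [AddCommGroup V] [Module ℝ V] (d : SimpleRootData I V)

/-- The simple reflection `v ↦ v - αᵢ(v) αᵢ^∨`. -/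
noncomputable def refl (i : I) : V ≃ₗ[ℝ] V := Module.reflection (d.root_coroot_two i)

/-- The vectorial Weyl group `W^v`. -/
def weyl : Subgroup (V ≃ₗ[ℝ] V) := Subgroup.closure (Set.range d.refl)

/-- A simple reflection, as an element of `W^v`. -/
noncomputable def reflMem (i : I) : d.weyl := ⟨d.refl i, Subgroup.subset_closure ⟨i, rfl⟩⟩

/-- The action of `GL(V)` on the dual space: `(w f)(v) = f (w⁻¹ v)`. -/
def act (w : V ≃ₗ[ℝ] V) (f : Dual ℝ V) : Dual ℝ V := f ∘ₗ (w⁻¹ : V ≃ₗ[ℝ] V).toLinearMap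

/-- The set `Φ` of real roots. -/
def realRoots : Set (Dual ℝ V) := {β | ∃ w ∈ d.weyl, ∃ i, β = act w (d.root i)}

/-- The cone of linear combinations of the simple roots with nonnegative coefficients. -/
def posCone [Fintype I] : Set (Dual ℝ V) :=
  {f | ∃ c : I → ℝ, (∀ i, 0 ≤ c i) ∧ f = ∑ i, c i • d.root i}

/-- The facet `F^v(J)` of the closed fundamental chamber. -/
def stdFacet (J : Set I) : Set V :=
  {v | (∀ i ∈ J, d.root i v = 0) ∧ ∀ i ∉ J, 0 < d.root i v}

/-- `S` is a vectorial facet of type `J`, positive (`w F^v(J)`) or negative (`- w F^v(J)`). -/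
def IsVFacetOfType (J : Set I) (S : Set V) : Prop :=
  ∃ w ∈ d.weyl, S = w '' d.stdFacet J ∨ S = (fun v => -(w v)) '' d.stdFacet J

/-- Vectorial facets, of either sign. -/
def IsVFacet (S : Set V) : Prop := ∃ J, d.IsVFacetOfType J S

/-- Spherical vectorial facets: those whose type `J` generates a finite group. -/
def IsSphericalVFacet (S : Set V) : Prop :=
  ∃ J : Set I, (Subgroup.closure (d.refl '' J) : Set (V ≃ₗ[ℝ] V)).Finite ∧ d.IsVFacetOfType J S

/-- Vectorial chambers. -/
def IsVChamber (S : Set V) : Prop := d.IsVFacetOfType ∅ S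

/-- Vectorial panels. -/
def IsVPanel (S : Set V) : Prop := ∃ i, d.IsVFacetOfType {i} S

/-- The (positive) Tits cone. -/
def titsCone : Set V := {v | ∃ w ∈ d.weyl, ∃ J, v ∈ w '' d.stdFacet J}

end SimpleRootData

/-- The vectorial data of an affine apartment: simple roots and coroots whose reflections generate
a Coxeter group `W^v` with the usual properties of the real roots, together with a moderately
imaginary set of imaginary roots. -/
structure VectorialData (I V : Type*) [Fintype I] [AddCommGroup V] [Module ℝ V]
    extends SimpleRootData I V where
  /-- the Coxeter matrix of `W^v` -/
  matrix : CoxeterMatrix I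
  /-- `W^v` is a Coxeter group with the simple reflections as its system of generators -/
  cox : CoxeterSystem matrix toSimpleRootData.weyl
  cox_simple : ∀ i, cox.simple i = toSimpleRootData.reflMem i
  /-- every real root is positive or negative -/
  root_pos_or_neg : ∀ β ∈ toSimpleRootData.realRoots,
    β ∈ toSimpleRootData.posCone ∨ -β ∈ toSimpleRootData.posCone
  /-- `w(αᵢ)` is positive if and only if `ℓ(w rᵢ) > ℓ(w)` -/
  root_pos_iff : ∀ (w : toSimpleRootData.weyl) (i : I),
    SimpleRootData.act (w : V ≃ₗ[ℝ] V) (root i) ∈ toSimpleRootData.posCone ↔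
      cox.length w < cox.length (w * cox.simple i)
  /-- `Φ ∩ ℝ⁺ β = {β}` -/
  root_reduced : ∀ β ∈ toSimpleRootData.realRoots, ∀ c : ℝ, 0 < c →
    c • β ∈ toSimpleRootData.realRoots → c = 1
  /-- the set of imaginary roots -/
  imRoots : Set (Dual ℝ V)
  imRoots_ne_zero : ∀ δ ∈ imRoots, δ ≠ 0
  imRoots_ne_smul : ∀ δ ∈ imRoots, ∀ β ∈ toSimpleRootData.realRoots, ∀ c : ℝ, δ ≠ c • β
  imRoots_neg : ∀ δ ∈ imRoots, -δ ∈ imRoots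
  imRoots_pos_or_neg : ∀ δ ∈ imRoots,
    δ ∈ toSimpleRootData.posCone ∨ -δ ∈ toSimpleRootData.posCone
  imRoots_act : ∀ δ ∈ imRoots, δ ∈ toSimpleRootData.posCone → ∀ w ∈ toSimpleRootData.weyl,
    SimpleRootData.act w δ ∈ imRoots ∧ SimpleRootData.act w δ ∈ toSimpleRootData.posCone

/-! ### The model apartment -/

section Affine

variable {V P : Type*} [NormedAddCommGroup V] [NormedSpace ℝ V] [MetricSpace P]
  [NormedAddTorsor V P]

/-- The hyperplane of direction `ker β` through `p` (for `β ≠ 0`). -/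
def wall (β : Dual ℝ V) (p : P) : Set P := {x | β (x -ᵥ p) = 0}

/-- The closed half-space where `β ≥ β(p)`. -/
def half (β : Dual ℝ V) (p : P) : Set P := {x | 0 ≤ β (x -ᵥ p)}

/-- The open half-space where `β > β(p)`. -/
def openHalf (β : Dual ℝ V) (p : P) : Set P := {x | 0 < β (x -ᵥ p)}

/-- The reflections `r_M` for `M` in a given set of walls: if `M` has direction `ker (w αᵢ)`, the
linear part of `r_M` is `w rᵢ w⁻¹`, and `r_M` fixes the points of `M`. -/
def wallReflections {I : Type*} (d : SimpleRootData I V) (walls : Set (Set P)) :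
    Set (P ≃ᵃ[ℝ] P) :=
  {s | ∃ w ∈ d.weyl, ∃ i, ∃ p : P, wall (SimpleRootData.act w (d.root i)) p ∈ walls ∧
    s.linear = w * d.refl i * w⁻¹ ∧ s p = p}

/-- The model apartment: an affine space `P` under `V` with a set of (real) walls.
The norm of `V` is only used through the topology, which does not depend on it. -/
structure Model (I V P : Type*) [Fintype I] [NormedAddCommGroup V] [NormedSpace ℝ V]
    [MetricSpace P] [NormedAddTorsor V P] extends VectorialData I V where
  walls : Set (Set P)
  exists_root_of_wall : ∀ M ∈ walls, ∃ β ∈ toSimpleRootData.realRoots, ∃ p : P, M = wall β p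
  infinite_walls : ∀ β ∈ toSimpleRootData.realRoots,
    {M ∈ walls | ∃ p : P, M = wall β p}.Infinite
  image_wall : ∀ s ∈ wallReflections toSimpleRootData walls, ∀ M ∈ walls, s '' M ∈ walls

/-- The germ at `x` of the set `Ω`. -/
def germ (x : P) (Ω : Set P) : Filter P := 𝓝[Ω] x

/-- The closure of a filter: the filter generated by the closures of its elements. -/
def adherence (F : Filter P) : Filter P := F.lift' closure

/-- The smallest affine subspace containing (i.e. belonging to) the filter. -/
def support (F : Filter P) : AffineSubspace ℝ P := sInf {E | (E : Set P) ∈ F}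

/-- The sum `F + S` of a filter of subsets of `P` and of a set of vectors. -/
def addSet (F : Filter P) (S : Set V) : Filter P := Filter.map₂ (fun x v => v +ᵥ x) F (𝓟 S)

theorem half_total (β : Dual ℝ V) (p q : P) :
    half β p ⊆ openHalf β q ∨ half β q ⊆ half β p := by
  by_cases h : 0 < β (p -ᵥ q)
  · left
    intro x hx
    have e : β (x -ᵥ q) = β (x -ᵥ p) + β (p -ᵥ q) := by rw [← map_add, vsub_add_vsub_cancel]
    simp only [half, openHalf, mem_ofPred_eq] at *
    linarith
  · right
    intro x hx
    have e : β (x -ᵥ p) = β (x -ᵥ q) - β (p -ᵥ q) := by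
      rw [← map_sub, vsub_sub_vsub_cancel_right]
    simp only [half, mem_ofPred_eq] at *
    linarith

theorem openHalf_total (β : Dual ℝ V) (p q : P) :
    openHalf β p ⊆ openHalf β q ∨ openHalf β q ⊆ openHalf β p := by
  by_cases h : 0 ≤ β (p -ᵥ q)
  · left
    intro x hx
    have e : β (x -ᵥ q) = β (x -ᵥ p) + β (p -ᵥ q) := by rw [← map_add, vsub_add_vsub_cancel]
    simp only [openHalf, mem_ofPred_eq] at *
    linarith
  · right
    intro x hx
    have e : β (x -ᵥ p) = β (x -ᵥ q) - β (p -ᵥ q) := by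
      rw [← map_sub, vsub_sub_vsub_cancel_right]
    simp only [openHalf, mem_ofPred_eq] at *
    linarith

theorem openHalf_subset_half (β : Dual ℝ V) (p : P) : openHalf β p ⊆ half β p := by
  intro x hx
  simp only [openHalf, half, mem_ofPred_eq] at *
  exact hx.le

end Affine

namespace Model

variable {I V P : Type*} [Fintype I] [NormedAddCommGroup V] [NormedSpace ℝ V]
  [MetricSpace P] [NormedAddTorsor V P] (𝔸 : Model I V P)

/-- The affine Weyl group `W`. -/
def affineWeyl : Subgroup (P ≃ᵃ[ℝ] P) :=
  Subgroup.closure (wallReflections 𝔸.toSimpleRootData 𝔸.walls)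

/-- All roots, real and imaginary. -/
def allRoots : Set (Dual ℝ V) := 𝔸.realRoots ∪ 𝔸.imRoots

/-- The hyperplane `wall β p` is a real wall or an imaginary wall. All hyperplanes whose direction
is the kernel of an imaginary root are imaginary walls. -/
def IsTrueAt (β : Dual ℝ V) (p : P) : Prop := β ∈ 𝔸.realRoots → wall β p ∈ 𝔸.walls

/-- The sets `D(β, k)` with `k ∈ Γ_β ∪ {∞}`. -/
def IsClosedPart (β : Dual ℝ V) (S : Set P) : Prop :=
  S = univ ∨ ∃ p, 𝔸.IsTrueAt β p ∧ S = half β p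

/-- The sets `D(β, k)` or `D°(β, k)` with `k ∈ Γ_β ∪ {∞}`. -/
def IsPart (β : Dual ℝ V) (S : Set P) : Prop :=
  S = univ ∨ ∃ p, 𝔸.IsTrueAt β p ∧ (S = half β p ∨ S = openHalf β p)

/-- The intersections `⋂_β D(β, k_β)`, with a single `k_β` for each root `β`. -/
def IsEnclosed (T : Set P) : Prop :=
  ∃ D : Dual ℝ V → Set P, (∀ β ∈ 𝔸.allRoots, 𝔸.IsClosedPart β (D β)) ∧ T = ⋂ β ∈ 𝔸.allRoots, D β

/-- The intersections of half-spaces `D(β, k_β)` or `D°(β, k_β)`, one for each root `β`. -/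
def IsSemiEnclosed (T : Set P) : Prop :=
  ∃ D : Dual ℝ V → Set P, (∀ β ∈ 𝔸.allRoots, 𝔸.IsPart β (D β)) ∧ T = ⋂ β ∈ 𝔸.allRoots, D β

variable {𝔸}

theorem IsClosedPart.inter {β : Dual ℝ V} {S T : Set P} (hS : 𝔸.IsClosedPart β S)
    (hT : 𝔸.IsClosedPart β T) : 𝔸.IsClosedPart β (S ∩ T) := by
  have key : S ⊆ T ∨ T ⊆ S := by
    rcases hS with rfl | ⟨p, -, rfl⟩
    · exact Or.inr (subset_univ _)
    rcases hT with rfl | ⟨q, -, rfl⟩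
    · exact Or.inl (subset_univ _)
    exact (half_total β p q).imp_left fun h => h.trans (openHalf_subset_half β q)
  rcases key with h | h
  · rwa [inter_eq_left.2 h]
  · rwa [inter_eq_right.2 h]

theorem IsPart.inter {β : Dual ℝ V} {S T : Set P} (hS : 𝔸.IsPart β S)
    (hT : 𝔸.IsPart β T) : 𝔸.IsPart β (S ∩ T) := by
  have key : S ⊆ T ∨ T ⊆ S := by
    rcases hS with rfl | ⟨p, -, hS⟩
    · exact Or.inr (subset_univ _)
    rcases hT with rfl | ⟨q, -, hT⟩
    · exact Or.inl (subset_univ _)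
    rcases hS with rfl | rfl <;> rcases hT with rfl | rfl
    · exact (half_total β p q).imp_left fun h => h.trans (openHalf_subset_half β q)
    · exact (half_total β p q).imp_right fun h => (openHalf_subset_half β q).trans h
    · exact ((half_total β q p).imp_right fun h => (openHalf_subset_half β p).trans h).symm
    · exact openHalf_total β p q
  rcases key with h | h
  · rwa [inter_eq_left.2 h]
  · rwa [inter_eq_right.2 h]

theorem IsEnclosed.inter {S T : Set P} (hS : 𝔸.IsEnclosed S) (hT : 𝔸.IsEnclosed T) :
    𝔸.IsEnclosed (S ∩ T) := by
  obtain ⟨D, hD, rfl⟩ := hS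
  obtain ⟨E, hE, rfl⟩ := hT
  exact ⟨fun β => D β ∩ E β, fun β hβ => (hD β hβ).inter (hE β hβ), by
    simp only [iInter_inter_distrib]⟩

theorem IsSemiEnclosed.inter {S T : Set P} (hS : 𝔸.IsSemiEnclosed S)
    (hT : 𝔸.IsSemiEnclosed T) : 𝔸.IsSemiEnclosed (S ∩ T) := by
  obtain ⟨D, hD, rfl⟩ := hS
  obtain ⟨E, hE, rfl⟩ := hT
  exact ⟨fun β => D β ∩ E β, fun β hβ => (hD β hβ).inter (hE β hβ), by
    simp only [iInter_inter_distrib]⟩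

theorem isEnclosed_univ : 𝔸.IsEnclosed (univ : Set P) :=
  ⟨fun _ => univ, fun _ _ => Or.inl rfl, by simp⟩

theorem isSemiEnclosed_univ : 𝔸.IsSemiEnclosed (univ : Set P) :=
  ⟨fun _ => univ, fun _ _ => Or.inl rfl, by simp⟩

variable (𝔸)

/-- The enclosure `cl(F)` of a filter: the sets containing an element of `F` of the form
`⋂_β D(β, k_β)`. -/
def cl (F : Filter P) : Filter P where
  sets := {S | ∃ T, 𝔸.IsEnclosed T ∧ T ∈ F ∧ T ⊆ S}
  univ_sets := ⟨univ, isEnclosed_univ, univ_mem, subset_univ _⟩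
  sets_of_superset := fun ⟨T, h1, h2, h3⟩ h => ⟨T, h1, h2, h3.trans h⟩
  inter_sets := fun ⟨T, h1, h2, h3⟩ ⟨T', h1', h2', h3'⟩ =>
    ⟨T ∩ T', h1.inter h1', inter_mem h2 h2', inter_subset_inter h3 h3'⟩

/-- The local facet `F^ℓ(x, F^v)`. -/
def localFacet (x : P) (S : Set V) : Filter P := germ x ((fun v => v +ᵥ x) '' S)

/-- The facet `F(x, F^v)`. -/
def facet (x : P) (S : Set V) : Filter P where
  sets := {U | ∃ T, 𝔸.IsSemiEnclosed T ∧ T ∈ localFacet x S ∧ T ⊆ U}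
  univ_sets := ⟨univ, isSemiEnclosed_univ, univ_mem, subset_univ _⟩
  sets_of_superset := fun ⟨T, h1, h2, h3⟩ h => ⟨T, h1, h2, h3.trans h⟩
  inter_sets := fun ⟨T, h1, h2, h3⟩ ⟨T', h1', h2', h3'⟩ =>
    ⟨T ∩ T', h1.inter h1', inter_mem h2 h2', inter_subset_inter h3 h3'⟩

/-- Facets of the model apartment. -/
def IsFacet (F : Filter P) : Prop := ∃ x S, 𝔸.IsVFacet S ∧ F = 𝔸.facet x S

/-- Chambers of the model apartment. -/
def IsChamber (F : Filter P) : Prop := ∃ x S, 𝔸.IsVChamber S ∧ F = 𝔸.facet x S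

/-- Panels of the model apartment: facets `F(x, F^v)` with `F^v` a vectorial panel and `x` on a
wall whose direction is the support of `F^v`. -/
def IsPanel (F : Filter P) : Prop :=
  ∃ (x : P) (S : Set V), 𝔸.IsVPanel S ∧
    (∃ β ∈ 𝔸.realRoots, wall β x ∈ 𝔸.walls ∧ Submodule.span ℝ S = LinearMap.ker β) ∧
    F = 𝔸.facet x S

/-- The chimney `cl(F + F^v)`. -/
def chimney (F : Filter P) (S : Set V) : Filter P := 𝔸.cl (addSet F S)

/-- The germ of the chimney `cl(F + F^v)`: the sets containing one of the shortened chimneys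
`cl(F + ξ + F^v)`, for `ξ` in the closure of `F^v` (they form a directed family). -/
def chimneyGerm (F : Filter P) (S : Set V) : Filter P :=
  ⨅ ξ ∈ closure S, 𝔸.chimney (F.map fun x => ξ +ᵥ x) S

/-- A chimney is solid if the direction of its support has a finite pointwise stabilizer
in `W^v`. -/
def IsSolid (r : Filter P) : Prop :=
  {w : V ≃ₗ[ℝ] V | w ∈ 𝔸.weyl ∧ ∀ v ∈ (support r).direction, w v = v}.Finite

/-- Solid chimneys. -/
def IsSolidChimney (r : Filter P) : Prop :=
  ∃ F S, 𝔸.IsFacet F ∧ 𝔸.IsVFacet S ∧ 𝔸.IsSolid (𝔸.chimney F S) ∧ r = 𝔸.chimney F S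

/-- Germs of solid chimneys. -/
def IsSolidChimneyGerm (R : Filter P) : Prop :=
  ∃ F S, 𝔸.IsFacet F ∧ 𝔸.IsVFacet S ∧ 𝔸.IsSolid (𝔸.chimney F S) ∧ R = 𝔸.chimneyGerm F S

/-- Germs of splayed chimneys (those of spherical direction). -/
def IsSplayedChimneyGerm (R : Filter P) : Prop :=
  ∃ F S, 𝔸.IsFacet F ∧ 𝔸.IsSphericalVFacet S ∧ R = 𝔸.chimneyGerm F S

/-- Germs `]x, y)` at `x` of preordered intervals `]x, y]`. -/
def IsPreorderedIntervalGerm (F : Filter P) : Prop :=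
  ∃ x y : P, x ≠ y ∧ (y -ᵥ x ∈ 𝔸.titsCone ∨ x -ᵥ y ∈ 𝔸.titsCone) ∧
    F = germ x (AffineMap.lineMap x y '' Set.Ioc (0 : ℝ) 1)

/-- Generic half-lines. -/
def IsGenericRay (F : Filter P) : Prop :=
  ∃ (x : P) (v : V), v ≠ 0 ∧ (∃ S, 𝔸.IsSphericalVFacet S ∧ v ∈ S) ∧
    F = 𝓟 ((fun t : ℝ => t • v +ᵥ x) '' Set.Ici 0)

end Model

/-! ### Affine hovels -/

section Hovel

variable {I V P X : Type*} [Fintype I] [NormedAddCommGroup V] [NormedSpace ℝ V]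
  [MetricSpace P] [NormedAddTorsor V P]

/-- A set covered by a set of subsets (apartments), each with a structure of apartment of type `𝔸`:
a set of bijections from the model, which is an orbit of `W`. -/
structure ApartmentSystem (𝔸 : Model I V P) (X : Type*) where
  apartments : Set (Set X)
  isom : Set X → Set (P → X)
  sUnion_apartments : ⋃₀ apartments = univ
  isom_nonempty : ∀ A ∈ apartments, (isom A).Nonempty
  isom_bijOn : ∀ A ∈ apartments, ∀ f ∈ isom A, BijOn f univ A
  isom_iff : ∀ A ∈ apartments, ∀ f₀ ∈ isom A, ∀ f : P → X,
    f ∈ isom A ↔ ∃ w ∈ 𝔸.affineWeyl, f = f₀ ∘ w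

namespace ApartmentSystem

variable {𝔸 : Model I V P} (𝓘 : ApartmentSystem 𝔸 X)

/-- `f` is a chart of the apartment `A`. -/
def IsChart (A : Set X) (f : P → X) : Prop := A ∈ 𝓘.apartments ∧ f ∈ 𝓘.isom A

/-- The restriction of `φ` to `A` is an isomorphism of apartments from `A` onto `A'`. -/
def IsIso (A A' : Set X) (φ : X → X) : Prop :=
  BijOn φ A A' ∧ ∃ f ∈ 𝓘.isom A, φ ∘ f ∈ 𝓘.isom A'

/-- The enclosure of a filter `G` of subsets of `X`, computed in the apartment with chart `f`. -/
def clIn (𝔸 : Model I V P) (f : P → X) (G : Filter X) : Filter X := (𝔸.cl (G.comap f)).map f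

/-- `A ∩ A'` contains the filter `G`, and some isomorphism from `A` onto `A'` fixes `G`, i.e. fixes
pointwise an element of `G`. -/
def IsoFixing (A A' : Set X) (G : Filter X) : Prop :=
  A ∩ A' ∈ G ∧ ∃ φ, 𝓘.IsIso A A' φ ∧ ∃ S ∈ G, ∀ x ∈ S, φ x = x

/-- `G` corresponds, in some apartment, to a filter of the model with the property `p`. -/
def Has (p : Filter P → Prop) (G : Filter X) : Prop :=
  ∃ A f, 𝓘.IsChart A f ∧ ∃ F, p F ∧ G = F.map f

end ApartmentSystem

/-- Affine hovels of type `𝔸`. A subset `A` contains a filter `G` when `A ∈ G`. -/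
structure Hovel (𝔸 : Model I V P) (X : Type*) extends ApartmentSystem 𝔸 X where
  ma2 : ∀ A f, toApartmentSystem.IsChart A f → ∀ A' ∈ apartments, ∀ F : Filter P,
    ((∃ x, F = pure x) ∨ 𝔸.IsPreorderedIntervalGerm F ∨ 𝔸.IsGenericRay F ∨
      𝔸.IsSolidChimney F) →
    A' ∈ F.map f → toApartmentSystem.IsoFixing A A' (ApartmentSystem.clIn 𝔸 f (F.map f))
  ma3 : ∀ R F : Filter X, toApartmentSystem.Has 𝔸.IsSplayedChimneyGerm R →
    (toApartmentSystem.Has 𝔸.IsFacet F ∨ toApartmentSystem.Has 𝔸.IsSolidChimneyGerm F) →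
    ∃ A ∈ apartments, A ∈ R ∧ A ∈ F
  ma4 : ∀ R F : Filter X, toApartmentSystem.Has 𝔸.IsSplayedChimneyGerm R →
    (toApartmentSystem.Has 𝔸.IsFacet F ∨ toApartmentSystem.Has 𝔸.IsSolidChimneyGerm F) →
    ∀ A f, toApartmentSystem.IsChart A f → ∀ A' ∈ apartments,
    A ∈ R → A ∈ F → A' ∈ R → A' ∈ F →
    toApartmentSystem.IsoFixing A A' (ApartmentSystem.clIn 𝔸 f (R ⊔ F))

namespace Hovel

variable {𝔸 : Model I V P} (𝓘 : Hovel 𝔸 X)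

/-- `D` is a half-apartment of the hovel and `M` is its wall. -/
def IsHalfApartment (D M : Set X) : Prop :=
  ∃ A f, 𝓘.IsChart A f ∧ ∃ β ∈ 𝔸.realRoots, ∃ p : P, wall β p ∈ 𝔸.walls ∧
    D = f '' half β p ∧ M = f '' wall β p

/-- Chambers of the hovel. -/
def IsChamber (C : Filter X) : Prop := 𝓘.Has 𝔸.IsChamber C

/-- Panels of the hovel. -/
def IsPanel (F : Filter X) : Prop := 𝓘.Has 𝔸.IsPanel F

/-- The facet `C` dominates the facet `F`: in some apartment containing both, `F` is contained in
the closure of `C`. -/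
def Dominates (C F : Filter X) : Prop :=
  ∃ A f, 𝓘.IsChart A f ∧ ∃ C₀ F₀, 𝔸.IsFacet C₀ ∧ 𝔸.IsFacet F₀ ∧
    C = C₀.map f ∧ F = F₀.map f ∧ F₀ ≤ adherence C₀

/-- The hovel is thick: every panel is dominated by at least three chambers. -/
def IsThick : Prop :=
  ∀ F, 𝓘.IsPanel F → 3 ≤ {C | 𝓘.IsChamber C ∧ 𝓘.Dominates C F}.encard

end Hovel

end Hovel

end AffineHovel

/-! The proof works with charts: MA2 and MA4 become the existence of a chart of `A'` that agrees
with a given chart of `A` on an enclosed set. Everything then rests on what model cones enclose. A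
cone on a panel direction `S ⊂ ker β` together with an opposite chamber cone encloses a half-space
(`IsPanelDir.half_subset`); cones on `S` and `-S` enclose a strip (`IsPanelDir.strip_subset`); a
panel and the chimney germ of direction `S` generated by an adjacent chamber enclose that chamber
(`IsPanelDir.mem_facet_of_mem_chimneyGerm`). Panel directions are spherical and their chimneys
solid, so MA3 and MA4 apply to these germs.

Statement 1. MA3 first places `C` in an apartment with the panel, where `C` is one of the two
adjacent model chambers. A second apartment is taken through the chimney germ that `C` generates in
the direction `S` and the germ of a chamber cone of `D` opposite to the wall. Adherence yields the
panel germ, which together with the chamber germ encloses `D`; then the panel and the first germ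
enclose `C` (`exists_chart_of_dominates`).

Statement 3. By thickness some chamber `C` on the panel is not in the apartment `A` of `D`.
Statement 1 gives `A'` through `D` and `C`. A common point outside `D` would force a strip beyond
the wall into `A ∩ A'`, and `C` would be one of the two chambers of `A`.

Statement 2. Charts `f` of `D` and `f₁` of `D₁` agree on the wall. One glues `f₁` with the part of
`f` below level `c`. Statement 1 pushes `c` strictly further; since walls may be dense, no induction
on walls is possible, and a supremum argument shows that the levels are unbounded. A single
apartment joining opposite chamber germs of `D` and `D₁` then carries all the gluings, and its
charts are rigid.

A separate difficulty is that a facet is a filter defined by one half-space for each of infinitely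
many roots. That the model has only two chambers on a panel relies on `facet_eq_of_le`, whose proof
needs finiteness results for roots with discrete walls. -/

namespace AffineHovel

namespace Model

open SimpleRootData

/-! ### The vectorial Weyl group, its roots, and the stabilizer of a panel. -/

section Vectorial

variable {I V P : Type*} [Fintype I] [NormedAddCommGroup V] [NormedSpace ℝ V]
  [MetricSpace P] [NormedAddTorsor V P] {𝔸 : Model I V P}

theorem refl_apply (i : I) (v : V) :
    𝔸.refl i v = v - 𝔸.root i v • 𝔸.coroot i := by
  simp [SimpleRootData.refl, Module.reflection_apply]

theorem act_apply (w : V ≃ₗ[ℝ] V) (α : Dual ℝ V) (v : V) :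
    SimpleRootData.act w α v = α (w⁻¹ v) := rfl

theorem act_mul (u w : V ≃ₗ[ℝ] V) (α : Dual ℝ V) :
    SimpleRootData.act (u * w) α = SimpleRootData.act u (SimpleRootData.act w α) := by
  ext v; simp [act_apply, mul_inv_rev]

theorem act_one (α : Dual ℝ V) : SimpleRootData.act (1 : V ≃ₗ[ℝ] V) α = α := by
  ext v; simp [act_apply]

theorem refl_mem (i : I) : 𝔸.refl i ∈ 𝔸.weyl := Subgroup.subset_closure ⟨i, rfl⟩

theorem refl_refl (i : I) (v : V) : 𝔸.refl i (𝔸.refl i v) = v := by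
  rw [refl_apply, refl_apply]
  simp only [map_sub, map_smul, 𝔸.root_coroot_two, smul_eq_mul]
  module

theorem refl_mul_self (i : I) : 𝔸.refl i * 𝔸.refl i = 1 := by
  ext v; exact refl_refl i v

theorem refl_inv (i : I) : (𝔸.refl i)⁻¹ = 𝔸.refl i :=
  inv_eq_of_mul_eq_one_right (refl_mul_self i)

theorem root_refl_self (i : I) (v : V) : 𝔸.root i (𝔸.refl i v) = - 𝔸.root i v := by
  rw [refl_apply]; simp [𝔸.root_coroot_two]; ring

theorem root_mem_realRoots (i : I) : 𝔸.root i ∈ 𝔸.realRoots :=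
  ⟨1, one_mem _, i, (act_one _).symm⟩

theorem act_mem_realRoots {w : V ≃ₗ[ℝ] V} (hw : w ∈ 𝔸.weyl) {α : Dual ℝ V}
    (hα : α ∈ 𝔸.realRoots) : SimpleRootData.act w α ∈ 𝔸.realRoots := by
  obtain ⟨u, hu, i, rfl⟩ := hα
  exact ⟨w * u, mul_mem hw hu, i, (act_mul _ _ _).symm⟩

theorem neg_mem_realRoots {α : Dual ℝ V} (hα : α ∈ 𝔸.realRoots) : -α ∈ 𝔸.realRoots := by
  obtain ⟨u, hu, i, rfl⟩ := hα
  refine ⟨u * 𝔸.refl i, mul_mem hu (refl_mem i), i, ?_⟩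
  ext v
  rw [act_mul]
  simp [act_apply, refl_inv, root_refl_self]

theorem root_ne_zero (i : I) : 𝔸.root i ≠ 0 := 𝔸.linearIndependent_root.ne_zero i

theorem ne_zero_of_mem_realRoots {α : Dual ℝ V} (hα : α ∈ 𝔸.realRoots) : α ≠ 0 := by
  obtain ⟨u, hu, i, rfl⟩ := hα
  intro h
  apply root_ne_zero (𝔸 := 𝔸) i
  ext v
  simpa [act_apply] using LinearMap.congr_fun h (u v)

theorem ne_zero_of_mem_allRoots {α : Dual ℝ V} (hα : α ∈ 𝔸.allRoots) : α ≠ 0 :=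
  hα.elim ne_zero_of_mem_realRoots (𝔸.imRoots_ne_zero α)

theorem neg_mem_allRoots {α : Dual ℝ V} (hα : α ∈ 𝔸.allRoots) : -α ∈ 𝔸.allRoots :=
  hα.imp neg_mem_realRoots (𝔸.imRoots_neg α)

theorem act_mem_imRoots {w : V ≃ₗ[ℝ] V} (hw : w ∈ 𝔸.weyl) {α : Dual ℝ V}
    (hα : α ∈ 𝔸.imRoots) : SimpleRootData.act w α ∈ 𝔸.imRoots := by
  rcases 𝔸.imRoots_pos_or_neg α hα with h | h
  · exact (𝔸.imRoots_act α hα h w hw).1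
  · have := 𝔸.imRoots_neg _ (𝔸.imRoots_act _ (𝔸.imRoots_neg α hα) h w hw).1
    convert this using 1
    ext v; simp [act_apply]

theorem act_mem_allRoots {w : V ≃ₗ[ℝ] V} (hw : w ∈ 𝔸.weyl) {α : Dual ℝ V}
    (hα : α ∈ 𝔸.allRoots) : SimpleRootData.act w α ∈ 𝔸.allRoots :=
  hα.imp (act_mem_realRoots hw) (act_mem_imRoots hw)

theorem pos_or_neg {α : Dual ℝ V} (hα : α ∈ 𝔸.allRoots) : α ∈ 𝔸.posCone ∨ -α ∈ 𝔸.posCone :=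
  hα.elim (𝔸.root_pos_or_neg α) (𝔸.imRoots_pos_or_neg α)

/-! ### Signed elements of the Weyl group and vectorial facets -/

variable (𝔸) in
/-- `σ = ± w` for some `w` in the vectorial Weyl group. -/
def IsSigned (σ : V ≃ₗ[ℝ] V) : Prop :=
  ∃ w ∈ 𝔸.weyl, (∀ v, σ v = w v) ∨ (∀ v, σ v = - w v)

theorem isSigned_of_mem {w : V ≃ₗ[ℝ] V} (hw : w ∈ 𝔸.weyl) : 𝔸.IsSigned w :=
  ⟨w, hw, Or.inl fun _ => rfl⟩

theorem IsSigned.symm {σ : V ≃ₗ[ℝ] V} (h : 𝔸.IsSigned σ) : 𝔸.IsSigned σ.symm := by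
  obtain ⟨w, hw, h | h⟩ := h
  · refine ⟨w⁻¹, inv_mem hw, Or.inl fun v => ?_⟩
    rw [LinearEquiv.symm_apply_eq, h]; simp
  · refine ⟨w⁻¹, inv_mem hw, Or.inr fun v => ?_⟩
    rw [LinearEquiv.symm_apply_eq, h]; simp

theorem IsSigned.mul_left {σ u : V ≃ₗ[ℝ] V} (h : 𝔸.IsSigned σ) (hu : u ∈ 𝔸.weyl) :
    𝔸.IsSigned (u * σ) := by
  obtain ⟨w, hw, h | h⟩ := h
  · exact ⟨u * w, mul_mem hu hw, Or.inl fun v => by simp [h]⟩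
  · exact ⟨u * w, mul_mem hu hw, Or.inr fun v => by simp [h]⟩

theorem IsSigned.mul_right {σ u : V ≃ₗ[ℝ] V} (h : 𝔸.IsSigned σ) (hu : u ∈ 𝔸.weyl) :
    𝔸.IsSigned (σ * u) := by
  obtain ⟨w, hw, h | h⟩ := h
  · exact ⟨w * u, mul_mem hw hu, Or.inl fun v => by simp [h]⟩
  · exact ⟨w * u, mul_mem hw hu, Or.inr fun v => by simp [h]⟩

theorem IsSigned.neg {σ : V ≃ₗ[ℝ] V} (h : 𝔸.IsSigned σ) :
    𝔸.IsSigned ((LinearEquiv.neg ℝ).trans σ) := by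
  obtain ⟨w, hw, h | h⟩ := h
  · exact ⟨w, hw, Or.inr fun v => by simp [h]⟩
  · exact ⟨w, hw, Or.inl fun v => by simp [h]⟩

theorem IsSigned.conj_mem {σ u : V ≃ₗ[ℝ] V} (h : 𝔸.IsSigned σ) (hu : u ∈ 𝔸.weyl) :
    σ * u * σ⁻¹ ∈ 𝔸.weyl := by
  have hs : ∀ v, σ⁻¹ v = σ.symm v := fun _ => rfl
  obtain ⟨w, hw, h | h⟩ := h
  · have : σ = w := by ext v; exact h v
    rw [this]; exact mul_mem (mul_mem hw hu) (inv_mem hw)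
  · have h2 : σ * u * σ⁻¹ = w * u * w⁻¹ := by
      ext v
      have : σ.symm v = - w⁻¹ v := by rw [LinearEquiv.symm_apply_eq, h]; simp
      simp only [LinearEquiv.mul_apply, hs, this, h, map_neg, neg_neg]
    rw [h2]; exact mul_mem (mul_mem hw hu) (inv_mem hw)

theorem comp_symm_mem_allRoots {σ : V ≃ₗ[ℝ] V} (h : 𝔸.IsSigned σ) {α : Dual ℝ V}
    (hα : α ∈ 𝔸.allRoots) : α ∘ₗ σ.symm.toLinearMap ∈ 𝔸.allRoots := by
  obtain ⟨w, hw, h | h⟩ := h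
  · have : σ = w := by ext v; exact h v
    rw [this]; exact act_mem_allRoots hw hα
  · convert neg_mem_allRoots (act_mem_allRoots hw hα) using 1
    ext v
    have : σ.symm v = - w⁻¹ v := by rw [LinearEquiv.symm_apply_eq, h]; simp
    simp [act_apply, this]

/-- Presenting facets as preimages under `± w` treats both signs at once and reduces computations to
`stdFacet`. -/
theorem isVFacetOfType_iff {J : Set I} {S : Set V} :
    𝔸.IsVFacetOfType J S ↔ ∃ σ, 𝔸.IsSigned σ ∧ S = σ ⁻¹' 𝔸.stdFacet J := by
  constructor
  · rintro ⟨w, hw, rfl | rfl⟩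
    · refine ⟨w.symm, (isSigned_of_mem hw).symm, ?_⟩
      exact LinearEquiv.image_eq_preimage_symm w _
    · refine ⟨(LinearEquiv.neg ℝ).trans w.symm, (isSigned_of_mem hw).symm.neg, ?_⟩
      ext v
      simp only [mem_image, mem_preimage, LinearEquiv.trans_apply, LinearEquiv.neg_apply]
      constructor
      · rintro ⟨u, hu, rfl⟩; simpa using hu
      · intro h; exact ⟨_, h, by simp⟩
  · rintro ⟨σ, ⟨w, hw, h | h⟩, rfl⟩
    · refine ⟨w⁻¹, inv_mem hw, Or.inl ?_⟩
      have : σ = w := by ext v; exact h v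
      rw [this]
      exact (LinearEquiv.image_eq_preimage_symm w.symm _).symm
    · refine ⟨w⁻¹, inv_mem hw, Or.inr ?_⟩
      ext v
      simp only [mem_image, mem_preimage, h]
      constructor
      · intro h; exact ⟨_, h, by simp⟩
      · rintro ⟨u, hu, rfl⟩; simpa using hu

theorem _root_.AffineHovel.SimpleRootData.IsVFacetOfType.neg
    {J : Set I} {S : Set V} (h : 𝔸.IsVFacetOfType J S) :
    𝔸.IsVFacetOfType J (Neg.neg ⁻¹' S) := by
  obtain ⟨σ, hσ, rfl⟩ := isVFacetOfType_iff.1 h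
  exact isVFacetOfType_iff.2 ⟨_, hσ.neg, rfl⟩

theorem _root_.AffineHovel.SimpleRootData.IsVFacetOfType.image
    {J : Set I} {S : Set V} (h : 𝔸.IsVFacetOfType J S)
    {w : V ≃ₗ[ℝ] V} (hw : w ∈ 𝔸.weyl) : 𝔸.IsVFacetOfType J (w '' S) := by
  obtain ⟨σ, hσ, rfl⟩ := isVFacetOfType_iff.1 h
  refine isVFacetOfType_iff.2 ⟨_, hσ.mul_right (inv_mem hw), ?_⟩
  rw [LinearEquiv.image_eq_preimage_symm]
  rfl

/-! ### The standard facets -/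

theorem nonneg_of_mem_posCone {γ : Dual ℝ V} (hγ : γ ∈ 𝔸.posCone) {v : V}
    (hv : ∀ i, 0 ≤ 𝔸.root i v) : 0 ≤ γ v := by
  obtain ⟨c, hc, rfl⟩ := hγ
  simp only [LinearMap.sum_apply, LinearMap.smul_apply, smul_eq_mul]
  exact Finset.sum_nonneg fun i _ => mul_nonneg (hc i) (hv i)

theorem stdFacet_nonneg {J : Set I} {v : V} (hv : v ∈ 𝔸.stdFacet J) (i : I) :
    0 ≤ 𝔸.root i v := by
  by_cases hi : i ∈ J
  · exact (hv.1 i hi).ge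
  · exact (hv.2 i hi).le

theorem pos_of_mem_posCone {γ : Dual ℝ V} (hγ : γ ∈ 𝔸.posCone) (h0 : γ ≠ 0) {v : V}
    (hv : v ∈ 𝔸.stdFacet ∅) : 0 < γ v := by
  obtain ⟨c, hc, rfl⟩ := hγ
  have hv' : ∀ i, 0 < 𝔸.root i v := fun i => hv.2 i (by simp)
  simp only [LinearMap.sum_apply, LinearMap.smul_apply, smul_eq_mul]
  by_contra hle
  have h1 : ∑ i, c i * 𝔸.root i v = 0 :=
    le_antisymm (not_lt.1 hle) (Finset.sum_nonneg fun i _ => mul_nonneg (hc i) (hv' i).le)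
  rw [Finset.sum_eq_zero_iff_of_nonneg fun i _ => mul_nonneg (hc i) (hv' i).le] at h1
  apply h0
  refine Finset.sum_eq_zero fun i hi => ?_
  rcases mul_eq_zero.1 (h1 i hi) with h | h
  · simp [h]
  · exact absurd h (hv' i).ne'

/-- A nonnegative combination that involves some other simple root is strictly positive on the panel
of type `{i}`. -/
theorem eq_smul_or_pos_of_mem_posCone {γ : Dual ℝ V} (hγ : γ ∈ 𝔸.posCone) (i : I) :
    (∃ c : ℝ, 0 ≤ c ∧ γ = c • 𝔸.root i) ∨ ∀ v ∈ 𝔸.stdFacet {i}, 0 < γ v := by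
  obtain ⟨c, hc, rfl⟩ := hγ
  by_cases h : ∃ j, j ≠ i ∧ 0 < c j
  · right
    obtain ⟨j, hji, hj⟩ := h
    intro v hv
    simp only [LinearMap.sum_apply, LinearMap.smul_apply, smul_eq_mul]
    refine Finset.sum_pos' (fun k _ => mul_nonneg (hc k) (stdFacet_nonneg hv k))
      ⟨j, Finset.mem_univ _, mul_pos hj (hv.2 j (by simpa using hji))⟩
  · left
    push Not at h
    refine ⟨c i, hc i, ?_⟩
    refine Finset.sum_eq_single i (fun j _ hj => ?_) (by simp)
    rw [le_antisymm (h j hj) (hc j), zero_smul]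

/-- A linear form vanishing on the range of `v ↦ (αᵢ(v))ᵢ` is a linear relation between the simple
roots. The lemma supplies points of all facets and a dual family of the simple roots. -/
theorem exists_root_apply_eq (c : I → ℝ) : ∃ v : V, ∀ i, 𝔸.root i v = c i := by
  classical
  let f : V →ₗ[ℝ] (I → ℝ) := LinearMap.pi 𝔸.root
  have hf : LinearMap.range f = ⊤ := by
    by_contra hne
    obtain ⟨φ, hφ, hle⟩ := Submodule.exists_le_ker_of_lt_top _ (lt_top_iff_ne_top.2 hne)
    apply hφ
    have key : ∑ i, φ (Pi.single i 1) • 𝔸.root i = 0 := by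
      ext v
      have h1 : φ (f v) = 0 := hle ⟨v, rfl⟩
      have h2 : f v = ∑ i, 𝔸.root i v • (Pi.single i (1 : ℝ) : I → ℝ) := by
        exact pi_eq_sum_univ' (f v)
      rw [h2, map_sum] at h1
      simp only [map_smul, smul_eq_mul] at h1
      simp only [LinearMap.sum_apply, LinearMap.smul_apply, smul_eq_mul, LinearMap.zero_apply]
      rw [← h1]
      exact Finset.sum_congr rfl fun i _ => mul_comm _ _
    have h3 := Fintype.linearIndependent_iff.1 𝔸.linearIndependent_root _ key
    refine LinearMap.pi_ext' fun i => ?_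
    ext
    simpa using h3 i
  obtain ⟨v, hv⟩ := LinearMap.range_eq_top.1 hf c
  exact ⟨v, fun i => congrFun hv i⟩

theorem stdFacet_nonempty (J : Set I) : (𝔸.stdFacet J).Nonempty := by
  classical
  obtain ⟨v, hv⟩ := exists_root_apply_eq (𝔸 := 𝔸) fun i => if i ∈ J then 0 else 1
  exact ⟨v, fun i hi => by simp [hv, hi], fun i hi => by simp [hv, hi]⟩

theorem stdFacet_smul {J : Set I} {v : V} (hv : v ∈ 𝔸.stdFacet J) {t : ℝ} (ht : 0 < t) :
    t • v ∈ 𝔸.stdFacet J :=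
  ⟨fun i hi => by simp [hv.1 i hi], fun i hi => by simpa using mul_pos ht (hv.2 i hi)⟩

theorem refl_eq_of_mem_stdFacet {i : I} {v : V} (hv : v ∈ 𝔸.stdFacet {i}) :
    𝔸.refl i v = v := by
  rw [refl_apply, hv.1 i rfl]; simp

/-- An element of the Weyl group that keeps all simple roots positive is trivial. -/
theorem eq_one_of_act_root_pos {u : V ≃ₗ[ℝ] V} (hu : u ∈ 𝔸.weyl)
    (h : ∀ j, SimpleRootData.act u (𝔸.root j) ∈ 𝔸.posCone) : u = 1 := by
  by_contra hne
  have h1 : (⟨u, hu⟩ : 𝔸.weyl) ≠ 1 := fun h => hne (congrArg Subtype.val h)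
  obtain ⟨j, hj⟩ := 𝔸.cox.exists_rightDescent_of_ne_one h1
  have h2 := (𝔸.root_pos_iff ⟨u, hu⟩ j).1 (h j)
  exact absurd hj (not_lt.2 h2.le)

theorem not_neg_mem_posCone {γ : Dual ℝ V} {v : V} (hv : ∀ i, 0 ≤ 𝔸.root i v)
    (hpos : 0 < γ v) : -γ ∉ 𝔸.posCone := fun h => by
  have := nonneg_of_mem_posCone h hv
  simp only [LinearMap.neg_apply] at this
  linarith

/-- The pointwise stabilizer of a panel of the fundamental chamber. -/
theorem eq_one_or_refl_of_fix {u : V ≃ₗ[ℝ] V} (hu : u ∈ 𝔸.weyl) (i : I)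
    (hfix : ∀ v ∈ 𝔸.stdFacet {i}, u v = v) : u = 1 ∨ u = 𝔸.refl i := by
  obtain ⟨s, hs⟩ := stdFacet_nonempty (𝔸 := 𝔸) {i}
  -- Since `u` fixes `s`, the root `u αⱼ` takes at `s` the positive value `αⱼ(s)`, so it cannot be
  -- negative.
  have key : ∀ u ∈ 𝔸.weyl, (∀ v ∈ 𝔸.stdFacet {i}, u v = v) → ∀ j ≠ i,
      SimpleRootData.act u (𝔸.root j) ∈ 𝔸.posCone := by
    intro u hu hfix j hj
    have h1 := pos_or_neg (𝔸 := 𝔸) (Or.inl (act_mem_realRoots hu (root_mem_realRoots j)))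
    refine h1.resolve_right (not_neg_mem_posCone (stdFacet_nonneg hs) ?_)
    have : u⁻¹ s = s := by
      conv_lhs => rw [← hfix s hs]
      simp
    rw [act_apply, this]
    exact hs.2 j (by simpa using hj)
  rcases 𝔸.root_pos_or_neg _ (act_mem_realRoots hu (root_mem_realRoots i)) with h | h
  · left
    refine eq_one_of_act_root_pos hu fun j => ?_
    by_cases hj : j = i
    · rwa [hj]
    · exact key u hu hfix j hj
  · right
    have hmem : u * 𝔸.refl i ∈ 𝔸.weyl := mul_mem hu (refl_mem i)
    -- Composing with `rᵢ` changes the sign of the image of `αᵢ` and keeps the panel fixed, which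
    -- leads back to the first case.
    have h1 : u * 𝔸.refl i = 1 := by
      refine eq_one_of_act_root_pos hmem fun j => ?_
      by_cases hj : j = i
      · subst hj
        convert h using 1
        ext v
        rw [act_mul]
        simp [act_apply, refl_inv, root_refl_self]
      · refine key _ hmem (fun v hv => ?_) j hj
        rw [LinearEquiv.mul_apply, refl_eq_of_mem_stdFacet hv, hfix v hv]
    rw [← refl_inv]
    exact eq_inv_of_mul_eq_one_left h1

end Vectorial

end Model

end AffineHovel

namespace AffineHovel

namespace Model

open SimpleRootData

/-! ### Signs of roots on vectorial facets; panels. -/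

section Facets

variable {I V P : Type*} [Fintype I] [NormedAddCommGroup V] [NormedSpace ℝ V]
  [MetricSpace P] [NormedAddTorsor V P] {𝔸 : Model I V P}

theorem _root_.AffineHovel.SimpleRootData.IsVFacet.nonempty
    {S : Set V} (hS : 𝔸.IsVFacet S) : S.Nonempty := by
  obtain ⟨J, hJ⟩ := hS
  obtain ⟨σ, -, rfl⟩ := isVFacetOfType_iff.1 hJ
  obtain ⟨v, hv⟩ := stdFacet_nonempty (𝔸 := 𝔸) J
  exact ⟨σ.symm v, by simpa using hv⟩

theorem _root_.AffineHovel.SimpleRootData.IsVFacet.smul_mem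
    {S : Set V} (hS : 𝔸.IsVFacet S) {v : V} (hv : v ∈ S) {t : ℝ}
    (ht : 0 < t) : t • v ∈ S := by
  obtain ⟨J, hJ⟩ := hS
  obtain ⟨σ, -, rfl⟩ := isVFacetOfType_iff.1 hJ
  simpa using stdFacet_smul hv ht

theorem _root_.AffineHovel.SimpleRootData.IsVFacet.neg
    {S : Set V} (hS : 𝔸.IsVFacet S) : 𝔸.IsVFacet (Neg.neg ⁻¹' S) :=
  hS.imp fun _ h => IsVFacetOfType.neg h

/-- A root has a constant weak sign on a vectorial facet. -/
theorem _root_.AffineHovel.SimpleRootData.IsVFacet.sign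
    {S : Set V} (hS : 𝔸.IsVFacet S) {α : Dual ℝ V} (hα : α ∈ 𝔸.allRoots) :
    (∀ s ∈ S, 0 ≤ α s) ∨ ∀ s ∈ S, α s ≤ 0 := by
  obtain ⟨J, hJ⟩ := hS
  obtain ⟨σ, hσ, rfl⟩ := isVFacetOfType_iff.1 hJ
  have e : ∀ v, α v = (α ∘ₗ σ.symm.toLinearMap) (σ v) := fun v => by simp
  refine (pos_or_neg (comp_symm_mem_allRoots hσ hα)).imp (fun h s hs => ?_) (fun h s hs => ?_)
  · rw [e]; exact nonneg_of_mem_posCone h (stdFacet_nonneg hs)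
  · rw [e]
    have := nonneg_of_mem_posCone h (stdFacet_nonneg hs)
    rw [LinearMap.neg_apply] at this
    linarith

theorem _root_.AffineHovel.SimpleRootData.IsVChamber.isVFacet
    {Q : Set V} (hQ : 𝔸.IsVChamber Q) : 𝔸.IsVFacet Q := ⟨∅, hQ⟩

theorem _root_.AffineHovel.SimpleRootData.IsVPanel.isVFacet
    {S : Set V} (hS : 𝔸.IsVPanel S) : 𝔸.IsVFacet S :=
  hS.elim fun i h => ⟨{i}, h⟩

/-- A root has a constant strict sign on a vectorial chamber. -/
theorem _root_.AffineHovel.SimpleRootData.IsVChamber.sign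
    {Q : Set V} (hQ : 𝔸.IsVChamber Q) {α : Dual ℝ V}
    (hα : α ∈ 𝔸.allRoots) : (∀ s ∈ Q, 0 < α s) ∨ ∀ s ∈ Q, α s < 0 := by
  obtain ⟨σ, hσ, rfl⟩ := isVFacetOfType_iff.1 hQ
  have e : ∀ v, α v = (α ∘ₗ σ.symm.toLinearMap) (σ v) := fun v => by simp
  have hm := comp_symm_mem_allRoots hσ hα
  refine (pos_or_neg hm).imp (fun h s hs => ?_) (fun h s hs => ?_)
  · rw [e]; exact pos_of_mem_posCone h (ne_zero_of_mem_allRoots hm) hs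
  · rw [e]
    have := pos_of_mem_posCone h (neg_ne_zero.2 (ne_zero_of_mem_allRoots hm)) hs
    rw [LinearMap.neg_apply] at this
    linarith

theorem _root_.AffineHovel.SimpleRootData.IsVChamber.isSpherical
    {Q : Set V} (hQ : 𝔸.IsVChamber Q) : 𝔸.IsSphericalVFacet Q :=
  ⟨∅, by simp, hQ⟩

theorem _root_.AffineHovel.SimpleRootData.IsVPanel.isSpherical
    {S : Set V} (hS : 𝔸.IsVPanel S) : 𝔸.IsSphericalVFacet S := by
  obtain ⟨i, hi⟩ := hS
  refine ⟨{i}, ?_, hi⟩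
  refine (Set.toFinite {1, 𝔸.refl i}).subset fun u hu => ?_
  rw [SetLike.mem_coe, image_singleton, Subgroup.mem_closure_singleton] at hu
  obtain ⟨n, rfl⟩ := hu
  rcases Int.even_or_odd' n with ⟨k, rfl | rfl⟩
  · left
    rw [zpow_mul, zpow_ofNat, pow_two, refl_mul_self, one_zpow]
  · right
    rw [zpow_add, zpow_mul, zpow_ofNat, pow_two, refl_mul_self, one_zpow, one_mul, zpow_one]
    rfl

theorem isVFacet_stdFacet (J : Set I) : 𝔸.IsVFacet (𝔸.stdFacet J) :=
  ⟨J, 1, one_mem _, Or.inl (by simp)⟩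

theorem root_eq_zero_of_mem_stdFacet_univ {α : Dual ℝ V} (hα : α ∈ 𝔸.allRoots) {v : V}
    (hv : v ∈ 𝔸.stdFacet univ) : α v = 0 := by
  have key : ∀ γ ∈ 𝔸.posCone, γ v = 0 := by
    rintro _ ⟨c, -, rfl⟩
    simp [hv.1 _ (mem_univ _)]
  rcases pos_or_neg hα with h | h
  · exact key _ h
  · simpa using key _ h

variable (𝔸) in
/-- `S` is a vectorial panel contained in the kernel of the real root `β`. -/
structure IsPanelDir (S : Set V) (β : Dual ℝ V) : Prop where
  panel : 𝔸.IsVPanel S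
  real : β ∈ 𝔸.realRoots
  vanish : ∀ s ∈ S, β s = 0

variable (𝔸) in
/-- `Q` is the vectorial chamber adjacent to the panel `S` on the positive side of `β`. -/
structure IsSide (S : Set V) (β : Dual ℝ V) (Q : Set V) : Prop where
  chamber : 𝔸.IsVChamber Q
  pos : ∀ q ∈ Q, 0 < β q
  pos_of_pos : ∀ α ∈ 𝔸.allRoots, (∀ s ∈ S, 0 < α s) → ∀ q ∈ Q, 0 < α q
  add_mem : ∀ s ∈ S, ∀ q ∈ Q, s + q ∈ Q
  eventually_mem : ∀ s ∈ S, ∀ᶠ v in 𝓝 s, 0 < β v → v ∈ Q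

namespace IsPanelDir

variable {S : Set V} {β : Dual ℝ V}

theorem isVFacet (h : 𝔸.IsPanelDir S β) : 𝔸.IsVFacet S := IsVPanel.isVFacet h.panel

theorem neg_root (h : 𝔸.IsPanelDir S β) : 𝔸.IsPanelDir S (-β) :=
  ⟨h.panel, neg_mem_realRoots h.real, fun s hs => by simp [h.vanish s hs]⟩

theorem neg_dir (h : 𝔸.IsPanelDir S β) : 𝔸.IsPanelDir (Neg.neg ⁻¹' S) β :=
  ⟨h.panel.imp fun _ h => IsVFacetOfType.neg h, h.real, fun s hs => by
    simpa using h.vanish _ hs⟩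

/-- A root without strict sign on the panel is a multiple of the simple root. Reducedness makes the
factor `± 1` for real roots, and imaginary roots are never multiples of real ones. -/
theorem trichotomy_of_signed {σ : V ≃ₗ[ℝ] V} (hσ : 𝔸.IsSigned σ) (i : I) {α : Dual ℝ V}
    (hα : α ∈ 𝔸.allRoots) :
    α = 𝔸.root i ∘ₗ σ.toLinearMap ∨ α = -(𝔸.root i ∘ₗ σ.toLinearMap) ∨
      (∀ s, σ s ∈ 𝔸.stdFacet {i} → 0 < α s) ∨ ∀ s, σ s ∈ 𝔸.stdFacet {i} → α s < 0 := by
  have e : ∀ v, α v = (α ∘ₗ σ.symm.toLinearMap) (σ v) := fun v => by simp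
  have hm := comp_symm_mem_allRoots hσ hα
  set γ := α ∘ₗ σ.symm.toLinearMap with hγ
  have key : ∀ γ ∈ 𝔸.allRoots, ∀ c : ℝ, 0 ≤ c → γ = c • 𝔸.root i → γ = 𝔸.root i := by
    intro γ hγ c hc h
    rcases hγ with hγ | hγ
    · have hc' : 0 < c := by
        refine lt_of_le_of_ne hc fun h0 => ne_zero_of_mem_realRoots hγ ?_
        rw [h, ← h0, zero_smul]
      rw [h, 𝔸.root_reduced _ (root_mem_realRoots i) c hc' (h ▸ hγ), one_smul]
    · exact absurd h (𝔸.imRoots_ne_smul γ hγ _ (root_mem_realRoots i) c)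
  rcases pos_or_neg hm with h | h
  · rcases eq_smul_or_pos_of_mem_posCone h i with ⟨c, hc, h1⟩ | h1
    · left
      have := key γ hm c hc h1
      ext v
      rw [e, this]; simp
    · right; right; left
      intro s hs; rw [e]; exact h1 _ hs
  · rcases eq_smul_or_pos_of_mem_posCone h i with ⟨c, hc, h1⟩ | h1
    · right; left
      have := key (-γ) (neg_mem_allRoots hm) c hc h1
      ext v
      rw [e, ← neg_neg γ, this]; simp
    · right; right; right
      intro s hs; rw [e]
      have := h1 _ hs
      rw [LinearMap.neg_apply] at this
      linarith

/-- A vectorial panel has a presentation in which `β` corresponds to a simple root. -/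
theorem exists_signed (h : 𝔸.IsPanelDir S β) : ∃ σ i, 𝔸.IsSigned σ ∧
    S = σ ⁻¹' 𝔸.stdFacet {i} ∧ β = 𝔸.root i ∘ₗ σ.toLinearMap := by
  obtain ⟨i, hi⟩ := h.panel
  obtain ⟨σ, hσ, rfl⟩ := isVFacetOfType_iff.1 hi
  obtain ⟨s, hs⟩ := h.isVFacet.nonempty
  rcases trichotomy_of_signed hσ i (Or.inl h.real) with h1 | h1 | h1 | h1
  · exact ⟨σ, i, hσ, rfl, h1⟩
  -- `rᵢ` fixes the standard panel pointwise and changes the sign of `αᵢ`.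
  · refine ⟨𝔸.refl i * σ, i, hσ.mul_left (refl_mem i), ?_, ?_⟩
    · ext v
      simp only [mem_preimage, LinearEquiv.mul_apply]
      constructor
      · intro hv; rwa [refl_eq_of_mem_stdFacet hv]
      · intro hv
        have := refl_eq_of_mem_stdFacet hv
        rw [refl_refl] at this
        rwa [this]
    · rw [h1]; ext v; simp [root_refl_self]
  · exact absurd (h.vanish s hs) (h1 s hs).ne'
  · exact absurd (h.vanish s hs) (h1 s hs).ne

theorem trichotomy (h : 𝔸.IsPanelDir S β) {α : Dual ℝ V} (hα : α ∈ 𝔸.allRoots) :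
    α = β ∨ α = -β ∨ (∀ s ∈ S, 0 < α s) ∨ ∀ s ∈ S, α s < 0 := by
  obtain ⟨σ, i, hσ, rfl, rfl⟩ := h.exists_signed
  exact trichotomy_of_signed hσ i hα

/-- The pointwise stabilizer of a panel has order two. -/
theorem exists_stabilizer (h : 𝔸.IsPanelDir S β) : ∃ r : V ≃ₗ[ℝ] V,
    (∀ v, β (r v) = - β v) ∧
      ∀ u ∈ 𝔸.weyl, (∀ s ∈ S, u s = s) → u = 1 ∨ u = r := by
  obtain ⟨σ, i, hσ, rfl, rfl⟩ := h.exists_signed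
  refine ⟨σ⁻¹ * 𝔸.refl i * σ, fun v => ?_, fun u hu hfix => ?_⟩
  · have : σ (σ⁻¹ (𝔸.refl i (σ v))) = 𝔸.refl i (σ v) := σ.apply_symm_apply _
    simp [root_refl_self]
  · have h1 : ∀ v ∈ 𝔸.stdFacet {i}, (σ * u * σ⁻¹) v = v := by
      intro v hv
      have e : σ (σ⁻¹ v) = v := σ.apply_symm_apply v
      have : u (σ⁻¹ v) = σ⁻¹ v := hfix _ (by rw [mem_preimage, e]; exact hv)
      rw [LinearEquiv.mul_apply, LinearEquiv.mul_apply, this, e]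
    rcases eq_one_or_refl_of_fix (hσ.conj_mem hu) i h1 with h2 | h2
    · left
      have : u = σ⁻¹ * (σ * u * σ⁻¹) * σ := by group
      rw [this, h2]; group
    · right
      rw [← h2]; group

end IsPanelDir

end Facets

/-! ### Topology of vectorial facets; the chambers adjacent to a panel. -/

section FacetTopology

variable {I V P : Type*} [Fintype I] [NormedAddCommGroup V] [NormedSpace ℝ V]
  [FiniteDimensional ℝ V] [MetricSpace P] [NormedAddTorsor V P] {𝔸 : Model I V P}

theorem continuous_dual (α : Dual ℝ V) : Continuous α := α.continuous_of_finiteDimensional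

theorem _root_.AffineHovel.SimpleRootData.IsVFacet.add_mem
    {S : Set V} (hS : 𝔸.IsVFacet S) {v u : V} (hv : v ∈ S)
    (hu : u ∈ closure S) : v + u ∈ S := by
  obtain ⟨J, hJ⟩ := hS
  obtain ⟨σ, hσ, rfl⟩ := isVFacetOfType_iff.1 hJ
  have hc : ∀ i, Continuous fun v => 𝔸.root i (σ v) := fun i =>
    continuous_dual (𝔸.root i ∘ₗ σ.toLinearMap)
  have h0 : ∀ i ∈ J, 𝔸.root i (σ u) = 0 := fun i hi =>
    closure_minimal (s := σ ⁻¹' 𝔸.stdFacet J) (t := {u | 𝔸.root i (σ u) = 0})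
      (fun x hx => hx.1 i hi) (isClosed_eq (hc i) continuous_const) hu
  have h1 : ∀ i, 0 ≤ 𝔸.root i (σ u) := fun i =>
    closure_minimal (s := σ ⁻¹' 𝔸.stdFacet J) (t := {u | 0 ≤ 𝔸.root i (σ u)})
      (fun x hx => stdFacet_nonneg hx i) (isClosed_le continuous_const (hc i)) hu
  refine ⟨fun i hi => ?_, fun i hi => ?_⟩
  · have h2 : 𝔸.root i (σ v) = 0 := hv.1 i hi
    simp [h2, h0 i hi]
  · have h2 : 0 < 𝔸.root i (σ v) := hv.2 i hi
    simp only [map_add]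
    linarith [h1 i]

theorem _root_.AffineHovel.SimpleRootData.IsVFacet.add_mem'
    {S : Set V} (hS : 𝔸.IsVFacet S) {v u : V} (hv : v ∈ S)
    (hu : u ∈ S) : v + u ∈ S := hS.add_mem hv (subset_closure hu)

theorem _root_.AffineHovel.SimpleRootData.IsVFacet.zero_mem_closure
    {S : Set V} (hS : 𝔸.IsVFacet S) : (0 : V) ∈ closure S := by
  obtain ⟨v, hv⟩ := hS.nonempty
  have h : Tendsto (fun t : ℝ => t • v) (𝓝[>] 0) (𝓝 0) := by
    have : Continuous fun t : ℝ => t • v := by fun_prop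
    simpa using (this.tendsto 0).mono_left nhdsWithin_le_nhds
  refine mem_closure_of_tendsto h ?_
  filter_upwards [self_mem_nhdsWithin] with t ht using hS.smul_mem hv ht

theorem _root_.AffineHovel.SimpleRootData.IsVFacet.closure_add_mem
    {S : Set V} (hS : 𝔸.IsVFacet S) {v u : V}
    (hv : v ∈ closure S) (hu : u ∈ closure S) : v + u ∈ closure S := by
  have h : MapsTo (fun x => x + u) S S := fun x hx => hS.add_mem hx hu
  have hc : Continuous fun x : V => x + u := by fun_prop
  exact (h.closure hc) hv

theorem _root_.AffineHovel.SimpleRootData.IsVFacet.eventually_sub_mem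
    {S : Set V} (hS : 𝔸.IsVFacet S) {v : V} (hv : v ∈ S) :
    ∀ᶠ u in 𝓝 (0 : V), u ∈ S → v - u ∈ S := by
  obtain ⟨J, hJ⟩ := hS
  obtain ⟨σ, hσ, rfl⟩ := isVFacetOfType_iff.1 hJ
  have hc : ∀ i, Continuous fun u => 𝔸.root i (σ (v - u)) := fun i =>
    (continuous_dual (𝔸.root i ∘ₗ σ.toLinearMap)).comp (continuous_const.sub continuous_id)
  have key : ∀ i, ∀ᶠ u in 𝓝 (0 : V), i ∉ J → 0 < 𝔸.root i (σ (v - u)) := by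
    intro i
    by_cases hi : i ∈ J
    · exact Eventually.of_forall fun u h => absurd hi h
    · have : 0 < 𝔸.root i (σ (v - 0)) := by rw [sub_zero]; exact hv.2 i hi
      filter_upwards [(hc i).continuousAt.eventually (lt_mem_nhds this)] with u hu _ using hu
  filter_upwards [eventually_all.2 key] with u hu huS
  refine ⟨fun i hi => ?_, fun i hi => hu i hi⟩
  have h1 : 𝔸.root i (σ v) = 0 := hv.1 i hi
  have h2 : 𝔸.root i (σ u) = 0 := huS.1 i hi
  simp [h1, h2]

theorem _root_.AffineHovel.SimpleRootData.IsVChamber.isOpen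
    {Q : Set V} (hQ : 𝔸.IsVChamber Q) : IsOpen Q := by
  obtain ⟨σ, hσ, rfl⟩ := isVFacetOfType_iff.1 hQ
  have : σ ⁻¹' 𝔸.stdFacet ∅ = ⋂ i, {v | 0 < 𝔸.root i (σ v)} := by
    ext v; simp [SimpleRootData.stdFacet]
  rw [this]
  exact isOpen_iInter_of_finite fun i =>
    isOpen_lt continuous_const (continuous_dual (𝔸.root i ∘ₗ σ.toLinearMap))

theorem _root_.AffineHovel.SimpleRootData.IsVChamber.eventually_sub_mem
    {Q : Set V} (hQ : 𝔸.IsVChamber Q) {v : V} (hv : v ∈ Q) :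
    ∀ᶠ u in 𝓝 (0 : V), v - u ∈ Q := by
  have hc : Continuous fun u : V => v - u := by fun_prop
  exact hc.continuousAt.eventually (hQ.isOpen.mem_nhds (by simpa using hv))

namespace IsPanelDir

variable {S : Set V} {β : Dual ℝ V}

theorem eventually_root_pos {σ : V ≃ₗ[ℝ] V} {i : I} {s : V} (hs : σ s ∈ 𝔸.stdFacet {i}) :
    ∀ᶠ v in 𝓝 s, ∀ j, j ≠ i → 0 < 𝔸.root j (σ v) := by
  refine eventually_all.2 fun j => ?_
  by_cases hj : j = i
  · exact Eventually.of_forall fun u h => absurd hj h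
  · have hc : Continuous fun v => 𝔸.root j (σ v) :=
      continuous_dual (𝔸.root j ∘ₗ σ.toLinearMap)
    filter_upwards [hc.continuousAt.eventually
      (lt_mem_nhds (show 0 < 𝔸.root j (σ s) from hs.2 j (by simpa using hj)))] with u hu _
      using hu

theorem exists_side (h : 𝔸.IsPanelDir S β) : ∃ Q, 𝔸.IsSide S β Q := by
  obtain ⟨σ, i, hσ, rfl, rfl⟩ := h.exists_signed
  refine ⟨σ ⁻¹' 𝔸.stdFacet ∅, isVFacetOfType_iff.2 ⟨σ, hσ, rfl⟩, ?_, ?_, ?_, ?_⟩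
  · intro q hq; exact hq.2 i (by simp)
  · intro α hα hpos q hq
    obtain ⟨s, hs⟩ := h.isVFacet.nonempty
    have e : ∀ v, α v = (α ∘ₗ σ.symm.toLinearMap) (σ v) := fun v => by simp
    have hm := comp_symm_mem_allRoots hσ hα
    have h1 := hpos s hs
    rw [e] at h1 ⊢
    exact pos_of_mem_posCone ((pos_or_neg hm).resolve_right
      (not_neg_mem_posCone (stdFacet_nonneg hs) h1)) (ne_zero_of_mem_allRoots hm) hq
  · intro s hs q hq
    refine ⟨fun i hi => absurd hi (by simp), fun j _ => ?_⟩
    have h1 : 0 ≤ 𝔸.root j (σ s) := stdFacet_nonneg hs j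
    have h2 : 0 < 𝔸.root j (σ q) := hq.2 j (by simp)
    simp only [map_add]
    linarith
  · intro s hs
    filter_upwards [eventually_root_pos hs] with v hv hpos
    refine ⟨fun i hi => absurd hi (by simp), fun j _ => ?_⟩
    by_cases hj : j = i
    · subst hj; exact hpos
    · exact hv j hj

theorem eventually_mem_of_vanish (h : 𝔸.IsPanelDir S β) {s : V} (hs : s ∈ S) :
    ∀ᶠ v in 𝓝 s, β v = 0 → v ∈ S := by
  obtain ⟨σ, i, hσ, rfl, rfl⟩ := h.exists_signed
  filter_upwards [eventually_root_pos hs] with v hv h0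
  refine ⟨fun j hj => ?_, fun j hj => hv j (by simpa using hj)⟩
  rw [mem_singleton_iff.1 hj]
  exact h0

/-- The roots that are positive on a panel are simultaneously positive near its points. -/
theorem eventually_pos (h : 𝔸.IsPanelDir S β) {s : V} (hs : s ∈ S) :
    ∀ᶠ v in 𝓝 s, ∀ α ∈ 𝔸.allRoots, (∀ s ∈ S, 0 < α s) → 0 < α v := by
  -- Infinitely many roots are involved. Uniformity holds because a neighbourhood of `s` is covered
  -- by `S` and the two adjacent chambers, and a root positive on `S` is positive on all three.
  obtain ⟨Q, hQ⟩ := h.exists_side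
  obtain ⟨Q', hQ'⟩ := h.neg_root.exists_side
  filter_upwards [hQ.eventually_mem s hs, hQ'.eventually_mem s hs,
    h.eventually_mem_of_vanish hs] with v h1 h2 h3 α hα hpos
  rcases lt_trichotomy (β v) 0 with h4 | h4 | h4
  · exact hQ'.pos_of_pos α hα hpos v (h2 (by simpa using h4))
  · exact hpos v (h3 h4)
  · exact hQ.pos_of_pos α hα hpos v (h1 h4)

theorem span_eq (h : 𝔸.IsPanelDir S β) : Submodule.span ℝ S = LinearMap.ker β := by
  apply le_antisymm
  · exact Submodule.span_le.2 fun s hs => h.vanish s hs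
  · intro v hv
    rw [LinearMap.mem_ker] at hv
    obtain ⟨s, hs⟩ := h.isVFacet.nonempty
    have hc : Continuous fun t : ℝ => s + t • v := by fun_prop
    have h1 : ∀ᶠ t : ℝ in 𝓝 0, s + t • v ∈ S := by
      have h0 : Tendsto (fun t : ℝ => s + t • v) (𝓝 0) (𝓝 s) := by simpa using hc.tendsto 0
      filter_upwards [h0.eventually (h.eventually_mem_of_vanish hs)] with t ht
      exact ht (by simp [h.vanish s hs, hv])
    have h2 : ∀ᶠ t : ℝ in 𝓝[>] 0, s + t • v ∈ S ∧ 0 < t :=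
      (h1.filter_mono nhdsWithin_le_nhds).and self_mem_nhdsWithin
    obtain ⟨t, ht, ht0⟩ := h2.exists
    have : v = t⁻¹ • ((s + t • v) - s) := by
      rw [add_sub_cancel_left, smul_smul, inv_mul_cancel₀ ht0.ne', one_smul]
    rw [this]
    exact Submodule.smul_mem _ _ (Submodule.sub_mem _ (Submodule.subset_span ht)
      (Submodule.subset_span hs))

end IsPanelDir

theorem exists_isPanelDir {β : Dual ℝ V} (hβ : β ∈ 𝔸.realRoots) : ∃ S, 𝔸.IsPanelDir S β := by
  obtain ⟨w, hw, i, rfl⟩ := hβ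
  refine ⟨(w⁻¹ : V ≃ₗ[ℝ] V) ⁻¹' 𝔸.stdFacet {i}, ⟨i, isVFacetOfType_iff.2
    ⟨w⁻¹, isSigned_of_mem (inv_mem hw), rfl⟩⟩, ⟨w, hw, i, rfl⟩, fun s hs => hs.1 i rfl⟩

end FacetTopology

end Model

end AffineHovel

namespace AffineHovel

/-! ### Hyperplanes and half-spaces under affine automorphisms. -/

section Walls

variable {V P : Type*} [NormedAddCommGroup V] [NormedSpace ℝ V] [MetricSpace P]
  [NormedAddTorsor V P]

theorem wall_eq_wall {β : Dual ℝ V} {p q : P} (h : β (p -ᵥ q) = 0) : wall β p = wall β q := by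
  ext z
  have e : β (z -ᵥ q) = β (z -ᵥ p) + β (p -ᵥ q) := by rw [← map_add, vsub_add_vsub_cancel]
  simp [wall, e, h]

theorem wall_neg (β : Dual ℝ V) (p : P) : wall (-β) p = wall β p := by
  ext z; simp [wall]

theorem affineEquiv_vsub (t : P ≃ᵃ[ℝ] P) (a b : P) : t a -ᵥ t b = t.linear (a -ᵥ b) :=
  (t.toAffineMap.linearMap_vsub a b).symm

theorem act_linear_apply (t : P ≃ᵃ[ℝ] P) (γ : Dual ℝ V) (z p : P) :
    SimpleRootData.act t.linear γ (t z -ᵥ t p) = γ (z -ᵥ p) := by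
  rw [affineEquiv_vsub, Model.act_apply]
  congr 1
  exact t.linear.symm_apply_apply _

theorem image_eq_of_forall (t : P ≃ᵃ[ℝ] P) {A B : Set P} (h : ∀ z, t z ∈ B ↔ z ∈ A) :
    t '' A = B := by
  ext z
  constructor
  · rintro ⟨y, hy, rfl⟩; exact (h y).2 hy
  · intro hz
    exact ⟨t.symm z, (h _).1 (by simpa using hz), by simp⟩

theorem image_wall (t : P ≃ᵃ[ℝ] P) (γ : Dual ℝ V) (p : P) :
    t '' wall γ p = wall (SimpleRootData.act t.linear γ) (t p) :=
  image_eq_of_forall t fun z => by simp only [wall, mem_ofPred_eq, act_linear_apply]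

theorem image_half (t : P ≃ᵃ[ℝ] P) (γ : Dual ℝ V) (p : P) :
    t '' half γ p = half (SimpleRootData.act t.linear γ) (t p) :=
  image_eq_of_forall t fun z => by simp only [half, mem_ofPred_eq, act_linear_apply]

theorem image_openHalf (t : P ≃ᵃ[ℝ] P) (γ : Dual ℝ V) (p : P) :
    t '' openHalf γ p = openHalf (SimpleRootData.act t.linear γ) (t p) :=
  image_eq_of_forall t fun z => by simp only [openHalf, mem_ofPred_eq, act_linear_apply]

end Walls

namespace Model

open SimpleRootData

/-! ### The affine Weyl group: translations, spacing of the walls, lattice of discrete roots. -/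

section AffineWeyl

variable {I V P : Type*} [Fintype I] [NormedAddCommGroup V] [NormedSpace ℝ V]
  [MetricSpace P] [NormedAddTorsor V P] {𝔸 : Model I V P}

theorem linear_mem_weyl {t : P ≃ᵃ[ℝ] P} (ht : t ∈ 𝔸.affineWeyl) : t.linear ∈ 𝔸.weyl := by
  have h : 𝔸.affineWeyl ≤ 𝔸.weyl.comap (AffineEquiv.linearHom (k := ℝ) (P₁ := P)) := by
    refine (Subgroup.closure_le _).2 ?_
    rintro s ⟨w, hw, i, p, -, hs, -⟩
    change s.linear ∈ 𝔸.weyl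
    rw [hs]
    exact mul_mem (mul_mem hw (refl_mem i)) (inv_mem hw)
  exact h ht

theorem image_mem_walls {t : P ≃ᵃ[ℝ] P} (ht : t ∈ 𝔸.affineWeyl) {M : Set P}
    (hM : M ∈ 𝔸.walls) : t '' M ∈ 𝔸.walls := by
  have hinv : ∀ s ∈ wallReflections 𝔸.toSimpleRootData 𝔸.walls,
      s⁻¹ ∈ wallReflections 𝔸.toSimpleRootData 𝔸.walls := by
    rintro s ⟨w, hw, i, p, hp, hs, hsp⟩
    refine ⟨w, hw, i, p, hp, ?_, ?_⟩
    · have : (s⁻¹).linear = s.linear⁻¹ := rfl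
      rw [this, hs]
      simp only [mul_inv_rev, inv_inv, refl_inv, mul_assoc]
    · conv_lhs => rw [← hsp]
      exact s.symm_apply_apply p
  -- An equivalence, unlike an implication, passes to inverses in the induction.
  have key : ∀ M, t '' M ∈ 𝔸.walls ↔ M ∈ 𝔸.walls := by
    refine Subgroup.closure_induction (p := fun (t : P ≃ᵃ[ℝ] P) _ => ∀ M : Set P, t '' M ∈ 𝔸.walls ↔ M ∈ 𝔸.walls)
      ?_ ?_ ?_ ?_ ht
    · intro s hs M
      refine ⟨fun h => ?_, 𝔸.image_wall s hs M⟩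
      have h1 := 𝔸.image_wall _ (hinv s hs) _ h
      rw [← image_comp] at h1
      convert h1
      have : (s⁻¹ : P ≃ᵃ[ℝ] P) ∘ s = id := by ext z; exact s.symm_apply_apply z
      rw [this, image_id]
    · intro M; simp
    · intro a b _ _ ha hb M
      rw [AffineEquiv.coe_mul, image_comp, ha, hb]
    · intro a _ ha M
      rw [← ha, ← image_comp]
      have : a ∘ (a⁻¹ : P ≃ᵃ[ℝ] P) = id := by ext z; exact a.apply_symm_apply z
      rw [this, image_id]
  exact (key M).2 hM

theorem wall_mem_image {t : P ≃ᵃ[ℝ] P} (ht : t ∈ 𝔸.affineWeyl) {γ : Dual ℝ V} {p : P}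
    (h : wall γ p ∈ 𝔸.walls) : wall (act t.linear γ) (t p) ∈ 𝔸.walls := by
  rw [← AffineHovel.image_wall]; exact image_mem_walls ht h

theorem exists_wall {γ : Dual ℝ V} (hγ : γ ∈ 𝔸.realRoots) : ∃ p : P, wall γ p ∈ 𝔸.walls := by
  obtain ⟨M, hM, p, rfl⟩ := (𝔸.infinite_walls γ hγ).nonempty
  exact ⟨p, hM⟩

/-- The affine map with linear part `L` that fixes `p`. -/
def affineAt (L : V ≃ₗ[ℝ] V) (p : P) : P ≃ᵃ[ℝ] P :=
  ((AffineEquiv.vaddConst ℝ p).symm.trans L.toAffineEquiv).trans (AffineEquiv.vaddConst ℝ p)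

theorem affineAt_apply (L : V ≃ₗ[ℝ] V) (p z : P) : affineAt L p z = L (z -ᵥ p) +ᵥ p := rfl

theorem affineAt_linear (L : V ≃ₗ[ℝ] V) (p : P) : (affineAt L p).linear = L := by
  ext v; rfl

theorem affineAt_mem {w : V ≃ₗ[ℝ] V} (hw : w ∈ 𝔸.weyl) {i : I} {p : P}
    (h : wall (act w (𝔸.root i)) p ∈ 𝔸.walls) :
    affineAt (w * 𝔸.refl i * w⁻¹) p ∈ 𝔸.affineWeyl :=
  Subgroup.subset_closure ⟨w, hw, i, p, h, affineAt_linear _ _, by simp [affineAt_apply]⟩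

theorem exists_lift {w : V ≃ₗ[ℝ] V} (hw : w ∈ 𝔸.weyl) :
    ∃ t ∈ 𝔸.affineWeyl, (t : P ≃ᵃ[ℝ] P).linear = w := by
  have h : 𝔸.weyl ≤ 𝔸.affineWeyl.map (AffineEquiv.linearHom (k := ℝ) (P₁ := P)) := by
    refine (Subgroup.closure_le _).2 ?_
    rintro _ ⟨i, rfl⟩
    obtain ⟨p, hp⟩ := exists_wall (𝔸 := 𝔸) (root_mem_realRoots i)
    refine ⟨_, affineAt_mem (one_mem _) (i := i) (p := p) (by rwa [act_one]), ?_⟩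
    exact (affineAt_linear _ _).trans (by simp)
  obtain ⟨t, ht, e⟩ := h hw
  exact ⟨t, ht, e⟩

/-- The reflection of the affine Weyl group in a wall. -/
theorem exists_reflection {β : Dual ℝ V} (hβ : β ∈ 𝔸.realRoots) {p : P}
    (hp : wall β p ∈ 𝔸.walls) : ∃ s ∈ 𝔸.affineWeyl,
      (∀ z, β ((s : P ≃ᵃ[ℝ] P) z -ᵥ p) = - β (z -ᵥ p)) ∧ (∀ z ∈ wall β p, s z = z) := by
  obtain ⟨w, hw, i, rfl⟩ := hβ
  refine ⟨_, affineAt_mem hw hp, fun z => ?_, fun z hz => ?_⟩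
  · simp [affineAt_apply, act_apply, root_refl_self]
  · have hz' : 𝔸.root i (w⁻¹ (z -ᵥ p)) = 0 := hz
    rw [affineAt_apply]
    simp only [LinearEquiv.mul_apply]
    rw [refl_apply, hz', zero_smul, sub_zero, ← LinearEquiv.mul_apply, mul_inv_cancel]
    simp

/-! ### Translations -/

variable (𝔸) in
/-- The vectors of the translations in the affine Weyl group. -/
def translations : AddSubgroup V where
  carrier := {v | AffineEquiv.constVAdd ℝ P v ∈ 𝔸.affineWeyl}
  zero_mem' := by
    change AffineEquiv.constVAdd ℝ P 0 ∈ 𝔸.affineWeyl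
    rw [AffineEquiv.constVAdd_zero]; exact one_mem _
  add_mem' := fun {a b} ha hb => by
    change AffineEquiv.constVAdd ℝ P (a + b) ∈ 𝔸.affineWeyl
    rw [AffineEquiv.constVAdd_add]; exact mul_mem ha hb
  neg_mem' := fun {a} ha => by
    change AffineEquiv.constVAdd ℝ P (-a) ∈ 𝔸.affineWeyl
    rw [← AffineEquiv.constVAdd_symm]; exact inv_mem (S := Subgroup (P ≃ᵃ[ℝ] P)) ha

theorem wall_vadd_mem {v : V} (hv : v ∈ 𝔸.translations) {γ : Dual ℝ V} {p : P}
    (h : wall γ p ∈ 𝔸.walls) : wall γ (v +ᵥ p) ∈ 𝔸.walls := by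
  have := wall_mem_image hv h
  have e : (AffineEquiv.constVAdd ℝ P v).linear = 1 := rfl
  rwa [e, act_one] at this

/-- The product of the reflections in two parallel walls is a translation along the coroot. -/
theorem smul_coroot_mem_translations {i : I} {p p' : P} (hp : wall (𝔸.root i) p ∈ 𝔸.walls)
    (hp' : wall (𝔸.root i) p' ∈ 𝔸.walls) :
    𝔸.root i (p' -ᵥ p) • 𝔸.coroot i ∈ 𝔸.translations := by
  have h1 := affineAt_mem (one_mem _) (i := i) (p := p) (by rwa [act_one])
  have h2 := affineAt_mem (one_mem _) (i := i) (p := p') (by rwa [act_one])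
  have h3 := mul_mem h2 h1
  change AffineEquiv.constVAdd ℝ P _ ∈ 𝔸.affineWeyl
  convert h3 using 1
  ext z
  simp only [one_mul, inv_one, mul_one, AffineEquiv.coe_mul, Function.comp_apply, affineAt_apply,
    AffineEquiv.constVAdd_apply, refl_apply]
  apply vsub_left_injective p
  have e1 : ∀ v : V, (v +ᵥ p) -ᵥ p' = v - (p' -ᵥ p) := fun v => by
    rw [vadd_vsub_assoc, sub_eq_add_neg, neg_vsub_eq_vsub_rev]
  simp only [e1, vadd_vsub_assoc, map_sub, map_smul, 𝔸.root_coroot_two, smul_eq_mul]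
  module

/-- The walls of a given direction have bounded gaps. -/
theorem exists_gap_root (i : I) : ∃ G : ℝ, 0 < G ∧ ∀ y : P, ∃ p, wall (𝔸.root i) p ∈ 𝔸.walls ∧
    0 < 𝔸.root i (p -ᵥ y) ∧ 𝔸.root i (p -ᵥ y) ≤ G := by
  obtain ⟨_, ⟨hM, p, rfl⟩, _, ⟨hM', p', rfl⟩, hne⟩ :=
    (𝔸.infinite_walls _ (root_mem_realRoots i)).nontrivial
  have hg : 𝔸.root i (p' -ᵥ p) ≠ 0 := fun h => hne (wall_eq_wall h).symm
  have key : ∀ p p' : P, wall (𝔸.root i) p ∈ 𝔸.walls → wall (𝔸.root i) p' ∈ 𝔸.walls →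
      0 < 𝔸.root i (p' -ᵥ p) → ∃ G : ℝ, 0 < G ∧ ∀ y : P, ∃ p, wall (𝔸.root i) p ∈ 𝔸.walls ∧
    0 < 𝔸.root i (p -ᵥ y) ∧ 𝔸.root i (p -ᵥ y) ≤ G := by
    intro p p' hp hp' hg
    set g := 𝔸.root i (p' -ᵥ p)
    -- Translation by `g` times the coroot raises `αᵢ` by `2g`, because `αᵢ(αᵢ^∨) = 2`.
    refine ⟨g * 2, by positivity, fun y => ?_⟩
    obtain ⟨n, hn, -⟩ := existsUnique_add_zsmul_mem_Ioc (show 0 < g * 2 by positivity)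
      (𝔸.root i (p -ᵥ y)) 0
    refine ⟨n • (g • 𝔸.coroot i) +ᵥ p,
      wall_vadd_mem (zsmul_mem (smul_coroot_mem_translations hp hp') n) hp, ?_⟩
    have e : 𝔸.root i ((n • (g • 𝔸.coroot i) +ᵥ p) -ᵥ y) =
        𝔸.root i (p -ᵥ y) + n • (g * 2) := by
      rw [vadd_vsub_assoc, map_add, map_zsmul, map_smul, 𝔸.root_coroot_two, smul_eq_mul, add_comm]
    rw [e]
    simpa using hn
  rcases lt_or_gt_of_ne hg with h | h
  · refine key p' p hM' hM ?_
    rw [← neg_vsub_eq_vsub_rev, map_neg]; linarith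
  · exact key p p' hM hM' h

/-- Every real root comes from a simple root by an element that lifts to the affine Weyl group, so
finitely many gaps bound all of them. The summand `1` matters only when `I` is empty. -/
theorem exists_gap : ∃ G : ℝ, 0 < G ∧ ∀ γ ∈ 𝔸.realRoots, ∀ y : P, ∃ p, wall γ p ∈ 𝔸.walls ∧
    0 < γ (p -ᵥ y) ∧ γ (p -ᵥ y) ≤ G := by
  choose G hG h using exists_gap_root (𝔸 := 𝔸)
  refine ⟨1 + ∑ i, G i, by
    have : 0 ≤ ∑ i, G i := Finset.sum_nonneg fun i _ => (hG i).le
    linarith, ?_⟩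
  rintro _ ⟨w, hw, i, rfl⟩ y
  obtain ⟨t, ht, rfl⟩ := exists_lift (𝔸 := 𝔸) hw
  obtain ⟨p, hp, h1, h2⟩ := h i (t.symm y)
  have e := act_linear_apply t (𝔸.root i) p (t.symm y)
  rw [AffineEquiv.apply_symm_apply] at e
  refine ⟨t p, wall_mem_image ht hp, by rwa [e], ?_⟩
  rw [e]
  have : G i ≤ ∑ i, G i := Finset.single_le_sum (fun i _ => (hG i).le) (Finset.mem_univ i)
  linarith

/-! ### Discrete directions -/

variable (𝔸) in
/-- Some open interval contains no wall of direction `ker αᵢ`. -/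
def IsDiscrete (i : I) : Prop := ∃ x y : P, 0 < 𝔸.root i (y -ᵥ x) ∧
  ∀ p, wall (𝔸.root i) p ∈ 𝔸.walls → ¬ (0 < 𝔸.root i (p -ᵥ x) ∧ 0 < 𝔸.root i (y -ᵥ p))

variable (𝔸) in
/-- The periods of the set of walls of direction `ker αᵢ`. -/
def periods (i : I) : AddSubgroup ℝ where
  carrier := {r | ∀ (p : P) (v : V), 𝔸.root i v = r →
    (wall (𝔸.root i) p ∈ 𝔸.walls ↔ wall (𝔸.root i) (v +ᵥ p) ∈ 𝔸.walls)}
  zero_mem' := fun p v hv => by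
    rw [wall_eq_wall (p := v +ᵥ p) (q := p) (by simpa using hv)]
  add_mem' := fun {a b} ha hb p v hv => by
    have h1 : 𝔸.root i ((b / 2) • 𝔸.coroot i) = b := by simp [𝔸.root_coroot_two]
    rw [hb p _ h1, ha _ (v - (b / 2) • 𝔸.coroot i) (by rw [map_sub, hv, h1]; ring), vadd_vadd,
      sub_add_cancel]
  neg_mem' := fun {a} ha p v hv => by
    rw [ha (v +ᵥ p) (-v) (by rw [map_neg, hv, neg_neg]), vadd_vadd, neg_add_cancel, zero_vadd]

theorem root_mem_periods {v : V} (hv : v ∈ 𝔸.translations) (i : I) :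
    𝔸.root i v ∈ 𝔸.periods i := by
  intro p u hu
  rw [wall_eq_wall (p := u +ᵥ p) (q := v +ᵥ p) (by simp [hu])]
  refine ⟨wall_vadd_mem hv, fun h => ?_⟩
  have := wall_vadd_mem (neg_mem hv) h
  rwa [vadd_vadd, neg_add_cancel, zero_vadd] at this

/-- A subgroup of `ℝ` is dense or cyclic. Dense periods would put a wall in the empty interval; the
zero group is excluded by the translations along the coroot. -/
theorem IsDiscrete.exists_period {i : I} (hi : 𝔸.IsDiscrete i) : ∃ c : ℝ, 0 < c ∧
    c ∈ 𝔸.periods i ∧ ∀ r ∈ 𝔸.periods i, ∃ n : ℤ, r = n * c := by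
  obtain ⟨x, y, hxy, hd⟩ := hi
  obtain ⟨p, hp⟩ := exists_wall (𝔸 := 𝔸) (root_mem_realRoots i)
  rcases (𝔸.periods i).dense_or_cyclic with h | ⟨c, hc⟩
  · exfalso
    obtain ⟨r, hr, hrm⟩ := h.exists_mem_open isOpen_Ioo
      (show (Ioo (𝔸.root i (x -ᵥ p)) (𝔸.root i (y -ᵥ p))).Nonempty from by
        refine nonempty_Ioo.2 ?_
        rw [← sub_pos, ← map_sub, vsub_sub_vsub_cancel_right]; exact hxy)
    have h1 : 𝔸.root i ((r / 2) • 𝔸.coroot i) = r := by simp [𝔸.root_coroot_two]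
    refine hd _ ((hr p _ h1).1 hp) ⟨?_, ?_⟩
    · rw [vadd_vsub_assoc, map_add, h1, ← neg_vsub_eq_vsub_rev, map_neg]
      linarith [hrm.1]
    · rw [vsub_vadd_eq_vsub_sub, map_sub, h1]
      linarith [hrm.2]
  · have hcyc : ∀ r ∈ 𝔸.periods i, ∃ n : ℤ, r = n * c := by
      intro r hr
      rw [hc, AddSubgroup.mem_closure_singleton] at hr
      obtain ⟨n, rfl⟩ := hr
      exact ⟨n, by simp⟩
    have hcm : c ∈ 𝔸.periods i := by rw [hc]; exact AddSubgroup.subset_closure rfl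
    have hc0 : c ≠ 0 := by
      rintro rfl
      obtain ⟨q, hq, h1, -⟩ := (exists_gap_root (𝔸 := 𝔸) i).choose_spec.2 p
      obtain ⟨n, hn⟩ := hcyc _ (root_mem_periods (smul_coroot_mem_translations hp hq) i)
      simp only [map_smul, 𝔸.root_coroot_two, smul_eq_mul, mul_zero] at hn
      linarith
    rcases lt_or_gt_of_ne hc0 with h | h
    · refine ⟨-c, by linarith, neg_mem hcm, fun r hr => ?_⟩
      obtain ⟨n, rfl⟩ := hcyc r hr
      exact ⟨-n, by push_cast; ring⟩
    · exact ⟨c, h, hcm, hcyc⟩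

/-- Walls in the direction `k` come arbitrarily close, so `ε αₖ^∨` is a translation for arbitrarily
small `ε > 0`. Its value `ε αᵢ(αₖ^∨)` is a period of `i`, hence a multiple of a fixed `c > 0`; the
choice of `δ` makes it smaller than `c`. -/
theorem root_coroot_eq_zero {i k : I} (hi : 𝔸.IsDiscrete i) (hk : ¬ 𝔸.IsDiscrete k) :
    𝔸.root i (𝔸.coroot k) = 0 := by
  by_contra hm
  obtain ⟨c, hc, -, hcyc⟩ := hi.exists_period
  set m := 𝔸.root i (𝔸.coroot k) with hmdef
  obtain ⟨p, hp⟩ := exists_wall (𝔸 := 𝔸) (root_mem_realRoots k)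
  have hm' : 0 < |m| := abs_pos.2 hm
  set δ : ℝ := c / |m| / 2 with hδ
  have hδ0 : 0 < δ := by positivity
  have h1 : 𝔸.root k ((δ / 2) • 𝔸.coroot k) = δ := by simp [𝔸.root_coroot_two]
  have h2 : ∃ q, wall (𝔸.root k) q ∈ 𝔸.walls ∧ 0 < 𝔸.root k (q -ᵥ p) ∧
      𝔸.root k (q -ᵥ p) < δ := by
    by_contra hcon
    push Not at hcon
    refine hk ⟨p, (δ / 2) • 𝔸.coroot k +ᵥ p, by simpa [h1] using hδ0, ?_⟩
    rintro q hq ⟨h3, h4⟩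
    have := hcon q hq h3
    rw [vadd_vsub_assoc, map_add, h1, ← neg_vsub_eq_vsub_rev, map_neg] at h4
    linarith
  obtain ⟨q, hq, hq0, hq1⟩ := h2
  obtain ⟨n, hn⟩ := hcyc _ (root_mem_periods (smul_coroot_mem_translations hp hq) i)
  rw [map_smul, smul_eq_mul, ← hmdef] at hn
  have h5 : |𝔸.root k (q -ᵥ p) * m| < c := by
    rw [abs_mul, abs_of_pos hq0]
    calc _ < δ * |m| := mul_lt_mul_of_pos_right hq1 hm'
      _ = c / 2 := by rw [hδ]; field_simp
      _ < c := by linarith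
  have h6 : n ≠ 0 := by
    rintro rfl
    simp only [Int.cast_zero, zero_mul, mul_eq_zero] at hn
    exact hn.elim (fun h => hq0.ne' h) hm
  have h7 : (1 : ℝ) ≤ |(n : ℝ)| := by exact_mod_cast Int.one_le_abs h6
  rw [hn, abs_mul, abs_of_pos hc] at h5
  nlinarith

theorem act_refl (k : I) (γ : Dual ℝ V) :
    act (𝔸.refl k) γ = γ - γ (𝔸.coroot k) • 𝔸.root k := by
  ext u
  simp only [act_apply, refl_inv, refl_apply, map_sub, map_smul, smul_eq_mul,
    LinearMap.sub_apply, LinearMap.smul_apply]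
  ring

/-- The lattice generated by suitable multiples of the simple roots of discrete type. -/
def rootLattice (𝔸 : Model I V P) (c : I → ℝ) : AddSubgroup (Dual ℝ V) :=
  AddSubgroup.closure {γ | ∃ j, 𝔸.IsDiscrete j ∧ γ = (c j)⁻¹ • 𝔸.root j}

/-- Take for `cⱼ` the generator of the periods of `j`. For discrete `j` and `k`, `cₖ αₖ^∨` is a
translation, so `αⱼ(αₖ^∨) cₖ` is an integer multiple of `cⱼ` and `rₖ` acts integrally on the scaled
roots. For `k` not discrete, `rₖ` fixes `αⱼ` by `root_coroot_eq_zero`. -/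
theorem exists_lattice_scale : ∃ c : I → ℝ, (∀ i, 0 < c i) ∧
    ∀ w ∈ 𝔸.weyl, ∀ γ ∈ 𝔸.rootLattice c, act w γ ∈ 𝔸.rootLattice c := by
  have hc : ∀ i, ∃ c : ℝ, 0 < c ∧ (𝔸.IsDiscrete i →
      c ∈ 𝔸.periods i ∧ ∀ r ∈ 𝔸.periods i, ∃ n : ℤ, r = n * c) := by
    intro i
    by_cases hi : 𝔸.IsDiscrete i
    · obtain ⟨c, h1, h2, h3⟩ := hi.exists_period
      exact ⟨c, h1, fun _ => ⟨h2, h3⟩⟩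
    · exact ⟨1, one_pos, fun h => absurd h hi⟩
  choose c hc0 hc using hc
  refine ⟨c, hc0, ?_⟩
  have hcoef : ∀ j k, 𝔸.IsDiscrete j → 𝔸.IsDiscrete k →
      ∃ m : ℤ, 𝔸.root j (𝔸.coroot k) * c k = m * c j := by
    intro j k hj hk
    obtain ⟨p, hp⟩ := exists_wall (𝔸 := 𝔸) (root_mem_realRoots k)
    have h1 : 𝔸.root k ((c k / 2) • 𝔸.coroot k) = c k := by simp [𝔸.root_coroot_two]
    have h2 := ((hc k hk).1 p _ h1).1 hp
    have h3 := root_mem_periods (smul_coroot_mem_translations hp h2) j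
    rw [vadd_vsub, h1, map_smul, smul_eq_mul] at h3
    obtain ⟨m, hm⟩ := (hc j hj).2 _ h3
    exact ⟨m, by rw [← hm, mul_comm]⟩
  have hstab : ∀ k, ∀ γ ∈ 𝔸.rootLattice c, act (𝔸.refl k) γ ∈ 𝔸.rootLattice c := by
    intro k γ hγ
    refine AddSubgroup.closure_induction (p := fun γ _ => act (𝔸.refl k) γ ∈ 𝔸.rootLattice c)
      ?_ ?_ ?_ ?_ hγ
    · rintro _ ⟨j, hj, rfl⟩
      have hjm : (c j)⁻¹ • 𝔸.root j ∈ 𝔸.rootLattice c :=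
        AddSubgroup.subset_closure ⟨j, hj, rfl⟩
      rw [act_refl]
      by_cases hk : 𝔸.IsDiscrete k
      · obtain ⟨m, hm⟩ := hcoef j k hj hk
        have e : ((c j)⁻¹ • 𝔸.root j) (𝔸.coroot k) • 𝔸.root k = m • ((c k)⁻¹ • 𝔸.root k) := by
          have h1 : ((c j)⁻¹ • 𝔸.root j) (𝔸.coroot k) = m * (c k)⁻¹ := by
            rw [LinearMap.smul_apply, smul_eq_mul, inv_mul_eq_iff_eq_mul₀ (hc0 j).ne',
              ← mul_assoc, mul_comm (c j), ← hm, mul_assoc, mul_inv_cancel₀ (hc0 k).ne', mul_one]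
          rw [h1, mul_smul, Int.cast_smul_eq_zsmul]
        have hkm : (c k)⁻¹ • 𝔸.root k ∈ 𝔸.rootLattice c :=
          AddSubgroup.subset_closure ⟨k, hk, rfl⟩
        rw [e]
        exact sub_mem hjm (zsmul_mem hkm m)
      · rw [LinearMap.smul_apply, root_coroot_eq_zero hj hk, smul_zero, zero_smul, sub_zero]
        exact hjm
    · have : act (𝔸.refl k) (0 : Dual ℝ V) = 0 := by ext; simp [act_apply]
      rw [this]; exact zero_mem _
    · intro a b _ _ ha hb
      exact add_mem ha hb
    · intro a _ ha
      exact neg_mem ha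
  intro w hw
  refine Subgroup.closure_induction
    (p := fun (w : V ≃ₗ[ℝ] V) _ => ∀ γ ∈ 𝔸.rootLattice c,
      act w γ ∈ 𝔸.rootLattice c ∧ act w⁻¹ γ ∈ 𝔸.rootLattice c)
    ?_ ?_ ?_ ?_ hw |> fun h γ hγ => (h γ hγ).1
  · rintro _ ⟨k, rfl⟩ γ hγ
    rw [refl_inv]
    exact ⟨hstab k γ hγ, hstab k γ hγ⟩
  · intro γ hγ; rw [inv_one, act_one]; exact ⟨hγ, hγ⟩
  · intro a b _ _ ha hb γ hγ
    rw [mul_inv_rev, act_mul, act_mul]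
    exact ⟨(ha _ (hb γ hγ).1).1, (hb _ (ha γ hγ).2).2⟩
  · intro a _ ha γ hγ
    rw [inv_inv]; exact (ha γ hγ).symm

theorem exists_coeff_of_mem_rootLattice {c : I → ℝ} {γ : Dual ℝ V} (hγ : γ ∈ 𝔸.rootLattice c) :
    ∃ n : I → ℤ, γ = ∑ j, (n j : ℝ) • ((c j)⁻¹ • 𝔸.root j) := by
  classical
  refine AddSubgroup.closure_induction
    (p := fun γ _ => ∃ n : I → ℤ, γ = ∑ j, (n j : ℝ) • ((c j)⁻¹ • 𝔸.root j)) ?_ ?_ ?_ ?_ hγ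
  · rintro _ ⟨i, -, rfl⟩
    refine ⟨Pi.single i 1, ?_⟩
    rw [Finset.sum_eq_single i]
    · rw [Pi.single_eq_same, Int.cast_one, one_smul]
    · intro j _ hj; rw [Pi.single_eq_of_ne hj, Int.cast_zero, zero_smul]
    · intro h; exact absurd (Finset.mem_univ i) h
  · exact ⟨0, by simp⟩
  · rintro a b _ _ ⟨n, rfl⟩ ⟨m, rfl⟩
    refine ⟨n + m, ?_⟩
    rw [← Finset.sum_add_distrib]
    refine Finset.sum_congr rfl fun j _ => ?_
    rw [Pi.add_apply, Int.cast_add, add_smul]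
  · rintro a _ ⟨n, rfl⟩
    refine ⟨-n, ?_⟩
    rw [← Finset.sum_neg_distrib]
    refine Finset.sum_congr rfl fun j _ => ?_
    ext u
    simp

/-- Only finitely many real roots of discrete type are bounded on a dual family of the simple
roots. -/
theorem finite_discrete_roots (K : ℝ) {v : I → V} (hv : ∀ i, 𝔸.root i (v i) = 1)
    (hv' : ∀ i j, i ≠ j → 𝔸.root i (v j) = 0) :
    {γ | ∃ w ∈ 𝔸.weyl, ∃ i, 𝔸.IsDiscrete i ∧ γ = act w (𝔸.root i) ∧ ∀ j, |γ (v j)| ≤ K}.Finite := by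
  obtain ⟨c, hc0, hc⟩ := exists_lattice_scale (𝔸 := 𝔸)
  have hLv : ∀ (n : I → ℤ) j, (∑ k, (n k : ℝ) • ((c k)⁻¹ • 𝔸.root k)) (v j) = n j * (c j)⁻¹ := by
    intro n j
    rw [LinearMap.sum_apply, Finset.sum_eq_single j]
    · simp [hv j]
    · intro k _ hk; simp [hv' k j hk]
    · simp
  -- The coefficients on the scaled simple roots are integers, and the values on the dual family
  -- bound them.
  have hfin : ∀ i, ({n : I → ℤ | ∀ j, n j ∈ Icc (-⌈K / c i * c j⌉) ⌈K / c i * c j⌉}).Finite :=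
    fun i => Set.Finite.pi' (fun j : I => Set.finite_Icc (-⌈K / c i * c j⌉) ⌈K / c i * c j⌉)
  refine (Set.finite_iUnion fun i => (hfin i).image
    fun n => c i • ∑ j, (n j : ℝ) • ((c j)⁻¹ • 𝔸.root j)).subset ?_
  rintro γ ⟨w, hw, i, hi, rfl, hK⟩
  obtain ⟨n, hn⟩ := exists_coeff_of_mem_rootLattice
    (hc w hw _ (AddSubgroup.subset_closure ⟨i, hi, rfl⟩))
  have e : act w (𝔸.root i) = c i • ∑ j, (n j : ℝ) • ((c j)⁻¹ • 𝔸.root j) := by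
    rw [← hn]
    ext u
    simp only [act_apply, LinearMap.smul_apply, smul_eq_mul]
    rw [mul_inv_cancel_left₀ (hc0 i).ne']
  refine mem_iUnion.2 ⟨i, n, fun j => ?_, e.symm⟩
  have h1 := hK j
  rw [e, LinearMap.smul_apply, hLv, smul_eq_mul, abs_mul, abs_of_pos (hc0 i), abs_mul, abs_inv,
    abs_of_pos (hc0 j), ← le_div_iff₀' (hc0 i), ← div_eq_mul_inv, div_le_iff₀ (hc0 j)] at h1
  have h3 : |n j| ≤ ⌈K / c i * c j⌉ := by
    have := Int.le_ceil (K / c i * c j)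
    exact_mod_cast h1.trans this
  exact abs_le.1 h3

end AffineWeyl

end Model

end AffineHovel

namespace AffineHovel

namespace Model

open SimpleRootData

/-! ### Enclosed sets and their equivariance. -/

section Parts

variable {I V P : Type*} [Fintype I] [NormedAddCommGroup V] [NormedSpace ℝ V]
  [MetricSpace P] [NormedAddTorsor V P] {𝔸 : Model I V P}

theorem IsPart.mem_of_nonneg {α : Dual ℝ V} {S : Set P} (hS : 𝔸.IsPart α S) {y z : P}
    (hz : z ∈ S) (h : 0 ≤ α (y -ᵥ z)) : y ∈ S := by
  have e : ∀ p : P, α (y -ᵥ p) = α (y -ᵥ z) + α (z -ᵥ p) := fun p => by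
    rw [← map_add, vsub_add_vsub_cancel]
  rcases hS with rfl | ⟨p, -, rfl | rfl⟩
  · trivial
  · simp only [half, mem_ofPred_eq] at hz ⊢; rw [e]; linarith
  · simp only [openHalf, mem_ofPred_eq] at hz ⊢; rw [e]; linarith

theorem IsClosedPart.isPart {α : Dual ℝ V} {S : Set P} (hS : 𝔸.IsClosedPart α S) :
    𝔸.IsPart α S := hS.imp_right fun ⟨p, hp, h⟩ => ⟨p, hp, Or.inl h⟩

theorem IsClosedPart.isEnclosed {α : Dual ℝ V} {S : Set P}
    (hα : α ∈ 𝔸.allRoots) (hS : 𝔸.IsClosedPart α S) : 𝔸.IsEnclosed S := by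
  classical
  refine ⟨fun γ => if γ = α then S else univ, fun γ _ => ?_, ?_⟩
  · by_cases h : γ = α
    · subst h; simpa using hS
    · exact Or.inl (if_neg h)
  · ext z
    simp only [mem_iInter]
    constructor
    · intro hz γ _
      split_ifs
      · exact hz
      · trivial
    · intro hz; simpa using hz α hα

theorem IsPart.isSemiEnclosed {α : Dual ℝ V} {S : Set P}
    (hα : α ∈ 𝔸.allRoots) (hS : 𝔸.IsPart α S) : 𝔸.IsSemiEnclosed S := by
  classical
  refine ⟨fun γ => if γ = α then S else univ, fun γ _ => ?_, ?_⟩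
  · by_cases h : γ = α
    · subst h; simpa using hS
    · exact Or.inl (if_neg h)
  · ext z
    simp only [mem_iInter]
    constructor
    · intro hz γ _
      split_ifs
      · exact hz
      · trivial
    · intro hz; simpa using hz α hα

theorem isEnclosed_half {β : Dual ℝ V} (hβ : β ∈ 𝔸.realRoots) {p : P}
    (hp : wall β p ∈ 𝔸.walls) : 𝔸.IsEnclosed (half β p) :=
  IsClosedPart.isEnclosed (α := β) (Or.inl hβ) (Or.inr ⟨p, fun _ => hp, rfl⟩)

theorem half_inter_half_neg (β : Dual ℝ V) (p : P) : half β p ∩ half (-β) p = wall β p := by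
  ext z
  simp only [half, wall, mem_inter_iff, mem_ofPred_eq, LinearMap.neg_apply]
  constructor
  · rintro ⟨h1, h2⟩; linarith
  · intro h; rw [h]; simp

theorem isEnclosed_wall {β : Dual ℝ V} (hβ : β ∈ 𝔸.realRoots) {p : P}
    (hp : wall β p ∈ 𝔸.walls) : 𝔸.IsEnclosed (wall β p) := by
  rw [← half_inter_half_neg]
  exact (isEnclosed_half hβ hp).inter
    (isEnclosed_half (neg_mem_realRoots hβ) (by rwa [wall_neg]))

theorem IsEnclosed.isSemiEnclosed {T : Set P} (hT : 𝔸.IsEnclosed T) : 𝔸.IsSemiEnclosed T := by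
  obtain ⟨D, hD, rfl⟩ := hT
  exact ⟨D, fun β hβ => (hD β hβ).isPart, rfl⟩

/-- A point belongs to an enclosed set as soon as every root is bounded at this point by its value
at some point of the set. -/
theorem IsEnclosed.mem {T : Set P} (hT : 𝔸.IsEnclosed T) {y : P}
    (h : ∀ α ∈ 𝔸.allRoots, ∃ t ∈ T, 0 ≤ α (y -ᵥ t)) : y ∈ T := by
  obtain ⟨D, hD, rfl⟩ := hT
  refine mem_iInter₂.2 fun α hα => ?_
  obtain ⟨t, ht, h1⟩ := h α hα
  exact (hD α hα).isPart.mem_of_nonneg (mem_iInter₂.1 ht α hα) h1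

/-- An enclosed set containing a cone is stable under the translations by vectors of the cone. -/
theorem IsEnclosed.vadd_mem {T : Set P} (hT : 𝔸.IsEnclosed T) {S : Set V} (hS : 𝔸.IsVFacet S)
    {a : P} (ha : ∀ s ∈ S, s +ᵥ a ∈ T) {s : V} (hs : s ∈ S) {t : P} (ht : t ∈ T) :
    s +ᵥ t ∈ T := by
  refine hT.mem fun α _ => ?_
  by_cases h0 : 0 ≤ α s
  · exact ⟨t, ht, by simpa using h0⟩
  · push Not at h0
    -- Here `α` tends to `-∞` along the multiples of `s` based at `a`, so some point of the cone
    -- lies below `s +ᵥ t`.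
    obtain ⟨n, hn⟩ := exists_nat_gt ((-α s - α (t -ᵥ a)) / (-α s))
    rw [div_lt_iff₀ (by linarith)] at hn
    refine ⟨((n : ℝ) + 1) • s +ᵥ a, ha _ (hS.smul_mem hs (by positivity)), ?_⟩
    rw [vsub_vadd_eq_vsub_sub, vadd_vsub_assoc, map_sub, map_add, map_smul, smul_eq_mul]
    nlinarith

/-! ### Equivariance -/

theorem IsTrueAt.image {t : P ≃ᵃ[ℝ] P} (ht : t ∈ 𝔸.affineWeyl) {α : Dual ℝ V} {p : P}
    (h : 𝔸.IsTrueAt α p) : 𝔸.IsTrueAt (act t.linear α) (t p) := fun hα => by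
  refine wall_mem_image ht (h ?_)
  have := act_mem_realRoots (inv_mem (linear_mem_weyl ht)) hα
  rwa [← act_mul, inv_mul_cancel, act_one] at this

theorem IsPart.image {t : P ≃ᵃ[ℝ] P} (ht : t ∈ 𝔸.affineWeyl) {α : Dual ℝ V} {S : Set P}
    (h : 𝔸.IsPart α S) : 𝔸.IsPart (act t.linear α) (t '' S) := by
  rcases h with rfl | ⟨p, hp, rfl | rfl⟩
  · exact Or.inl (image_univ_of_surjective t.surjective)
  · exact Or.inr ⟨t p, hp.image ht, Or.inl (image_half t α p)⟩
  · exact Or.inr ⟨t p, hp.image ht, Or.inr (image_openHalf t α p)⟩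

theorem IsSemiEnclosed.image {t : P ≃ᵃ[ℝ] P} (ht : t ∈ 𝔸.affineWeyl) {T : Set P}
    (h : 𝔸.IsSemiEnclosed T) : 𝔸.IsSemiEnclosed (t '' T) := by
  obtain ⟨D, hD, rfl⟩ := h
  have hw := linear_mem_weyl ht
  refine ⟨fun β => t '' D (act t.linear⁻¹ β), fun β hβ => ?_, ?_⟩
  · have := (hD _ (act_mem_allRoots (inv_mem hw) hβ)).image ht
    rwa [← act_mul, mul_inv_cancel, act_one] at this
  · refine image_eq_of_forall t fun z => ?_
    have key : ∀ B : Set P, t z ∈ t '' B ↔ z ∈ B := fun B => t.injective.mem_set_image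
    simp only [mem_iInter, key]
    constructor
    · intro h β hβ
      have := h _ (act_mem_allRoots hw hβ)
      rwa [← act_mul, inv_mul_cancel, act_one] at this
    · intro h β hβ
      exact h _ (act_mem_allRoots (inv_mem hw) hβ)

end Parts

/-! ### Facets and chimney germs as filters. -/

section Germs

variable {I V P : Type*} [Fintype I] [NormedAddCommGroup V] [NormedSpace ℝ V]
  [FiniteDimensional ℝ V] [MetricSpace P] [NormedAddTorsor V P] {𝔸 : Model I V P}

theorem continuous_level (α : Dual ℝ V) (p : P) : Continuous fun z : P => α (z -ᵥ p) :=
  (continuous_dual α).comp (continuous_id.vsub continuous_const)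

theorem isClosed_half (α : Dual ℝ V) (p : P) : IsClosed (half α p) :=
  isClosed_le continuous_const (continuous_level α p)

theorem IsEnclosed.isClosed {T : Set P} (hT : 𝔸.IsEnclosed T) : IsClosed T := by
  obtain ⟨D, hD, rfl⟩ := hT
  refine isClosed_biInter fun β hβ => ?_
  rcases hD β hβ with h | ⟨p, -, h⟩
  · rw [h]; exact isClosed_univ
  · rw [h]; exact isClosed_half β p

theorem mem_localFacet {x : P} {S : Set V} {T : Set P} :
    T ∈ localFacet x S ↔ ∀ᶠ v in 𝓝 (0 : V), v ∈ S → v +ᵥ x ∈ T := by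
  have h : map (fun v : V => v +ᵥ x) (𝓝[S] 0) = 𝓝[(fun v : V => v +ᵥ x) '' S] ((0 : V) +ᵥ x) :=
    (IsometryEquiv.vaddConst x).isometry.isEmbedding.map_nhdsWithin_eq S (0 : V)
  rw [zero_vadd] at h
  rw [localFacet, germ, ← h, mem_map, mem_nhdsWithin_iff_eventually]
  rfl

theorem exists_mem_of_mem_localFacet {x : P} {S : Set V} (hS : 𝔸.IsVFacet S) {T : Set P}
    (hT : T ∈ localFacet x S) {O : Set V} (hO : O ∈ 𝓝 (0 : V)) :
    ∃ s ∈ S, s ∈ O ∧ s +ᵥ x ∈ T := by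
  have h1 := mem_localFacet.1 hT
  have h2 : ∃ᶠ v in 𝓝 (0 : V), v ∈ S := mem_closure_iff_frequently.1 hS.zero_mem_closure
  obtain ⟨v, hv, h3, h4⟩ := (h2.and_eventually (h1.and hO)).exists
  exact ⟨v, hv, h4, h3 hv⟩

theorem facet_le_localFacet {x : P} {S : Set V} {T : Set P} (hT : T ∈ 𝔸.facet x S) :
    T ∈ localFacet x S := by
  obtain ⟨T', -, h, hsub⟩ := hT
  exact mem_of_superset h hsub

theorem exists_mem_of_mem_facet {x : P} {S : Set V} (hS : 𝔸.IsVFacet S) {T : Set P}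
    (hT : T ∈ 𝔸.facet x S) {O : Set V} (hO : O ∈ 𝓝 (0 : V)) : ∃ s ∈ S, s ∈ O ∧ s +ᵥ x ∈ T :=
  exists_mem_of_mem_localFacet hS (facet_le_localFacet hT) hO

theorem facet_neBot {x : P} {S : Set V} (hS : 𝔸.IsVFacet S) : (𝔸.facet x S).NeBot := by
  refine ⟨fun h => ?_⟩
  have h1 : (∅ : Set P) ∈ 𝔸.facet x S := by rw [h]; exact mem_bot
  obtain ⟨s, -, -, h2⟩ := exists_mem_of_mem_facet hS h1 univ_mem
  exact h2

theorem mem_closure_of_mem_facet {x : P} {S : Set V} (hS : 𝔸.IsVFacet S) {T : Set P}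
    (hT : T ∈ 𝔸.facet x S) : x ∈ closure T := by
  refine mem_closure_iff_nhds.2 fun O hO => ?_
  have hc : Continuous fun v : V => v +ᵥ x := by fun_prop
  have : (fun v : V => v +ᵥ x) ⁻¹' O ∈ 𝓝 (0 : V) :=
    hc.continuousAt.preimage_mem_nhds (by simpa using hO)
  obtain ⟨s, -, h1, h2⟩ := exists_mem_of_mem_facet hS hT this
  exact ⟨_, h1, h2⟩

theorem IsEnclosed.mem_of_mem_facet {x : P} {S : Set V} (hS : 𝔸.IsVFacet S) {T : Set P}
    (hTe : 𝔸.IsEnclosed T) (hT : T ∈ 𝔸.facet x S) : x ∈ T := by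
  have := mem_closure_of_mem_facet hS hT
  rwa [hTe.isClosed.closure_eq] at this

theorem IsEnclosed.mem_facet {x : P} {S : Set V} {T : Set P}
    (hTe : 𝔸.IsEnclosed T) (hT : ∀ᶠ v in 𝓝 (0 : V), v ∈ S → v +ᵥ x ∈ T) : T ∈ 𝔸.facet x S :=
  ⟨T, hTe.isSemiEnclosed, mem_localFacet.2 hT, Subset.rfl⟩

theorem isEmbedding_affineEquiv (t : P ≃ᵃ[ℝ] P) : IsEmbedding t :=
  Homeomorph.isEmbedding
    { toEquiv := t.toEquiv
      continuous_toFun := t.toAffineMap.continuous_of_finiteDimensional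
      continuous_invFun := t.symm.toAffineMap.continuous_of_finiteDimensional }

theorem map_facet {t : P ≃ᵃ[ℝ] P} (ht : t ∈ 𝔸.affineWeyl) (x : P) (S : Set V) :
    (𝔸.facet x S).map t = 𝔸.facet (t x) (t.linear '' S) := by
  have key : ∀ t ∈ 𝔸.affineWeyl, ∀ (x : P) (S : Set V),
      𝔸.facet ((t : P ≃ᵃ[ℝ] P) x) (t.linear '' S) ≤ (𝔸.facet x S).map t := by
    rintro t ht x S U ⟨T, hT, hTm, hTU⟩
    refine ⟨t '' T, hT.image ht, ?_, image_subset_iff.2 hTU⟩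
    have h := (isEmbedding_affineEquiv t).map_nhdsWithin_eq
      ((fun v => v +ᵥ x) '' S) x
    have e : t '' ((fun v => v +ᵥ x) '' S) = (fun v => v +ᵥ t x) '' (t.linear '' S) := by
      simp only [image_image, AffineEquiv.map_vadd]
    rw [e] at h
    rw [localFacet, germ, ← h]
    exact image_mem_map hTm
  refine le_antisymm ?_ (key t ht x S)
  have h := key t⁻¹ (inv_mem ht) (t x) (t.linear '' S)
  have e1 : (t⁻¹ : P ≃ᵃ[ℝ] P) (t x) = x := t.symm_apply_apply x
  have e2 : (t⁻¹ : P ≃ᵃ[ℝ] P).linear '' (t.linear '' S) = S := by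
    rw [image_image]
    have : ∀ v, (t⁻¹ : P ≃ᵃ[ℝ] P).linear (t.linear v) = v := fun v =>
      t.linear.symm_apply_apply v
    simp [this]
  rw [e1, e2] at h
  have h2 := map_mono (m := t) h
  rw [map_map] at h2
  have e3 : t ∘ (t⁻¹ : P ≃ᵃ[ℝ] P) = id := by ext z; exact t.apply_symm_apply z
  rwa [e3, map_id] at h2

theorem mem_adherence {F : Filter P} {U : Set P} :
    U ∈ adherence F ↔ ∃ T ∈ F, closure T ⊆ U := mem_lift'_sets (monotone_closure P)

theorem adherence_map_le {t : P ≃ᵃ[ℝ] P} {F C : Filter P} (h : F ≤ adherence C) :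
    F.map t ≤ adherence (C.map t) := by
  intro U hU
  obtain ⟨T, hT, hTU⟩ := mem_adherence.1 hU
  have hc : Continuous t := t.toAffineMap.continuous_of_finiteDimensional
  have h1 : closure (t ⁻¹' T) ∈ F := h (mem_adherence.2 ⟨_, hT, Subset.rfl⟩)
  refine mem_map.2 (mem_of_superset h1 fun z hz => hTU ?_)
  exact hc.closure_preimage_subset T hz

/-! ### Germs of chimneys -/

theorem mem_chimneyGerm_of_mem {a : P} {S' S : Set V} (hS : 𝔸.IsVFacet S) {T : Set P}
    (hTe : 𝔸.IsEnclosed T) (hT : T ∈ 𝔸.facet a S') (hadd : ∀ t ∈ T, ∀ s ∈ S, s +ᵥ t ∈ T) :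
    T ∈ 𝔸.chimneyGerm (𝔸.facet a S') S := by
  have h : 𝔸.chimneyGerm (𝔸.facet a S') S ≤
      𝔸.chimney ((𝔸.facet a S').map fun x => (0 : V) +ᵥ x) S :=
    iInf₂_le (0 : V) hS.zero_mem_closure
  refine h ⟨T, hTe, ?_, Subset.rfl⟩
  refine mem_map₂_iff.2 ⟨T, ?_, S, mem_principal_self S, ?_⟩
  · simpa using hT
  · rintro _ ⟨t, ht, s, hs, rfl⟩
    exact hadd t ht s hs

theorem mem_chimneyGerm_self {a : P} {S : Set V} (hS : 𝔸.IsVFacet S) {T : Set P}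
    (hTe : 𝔸.IsEnclosed T) (hT : ∀ s ∈ S, s +ᵥ a ∈ T) :
    T ∈ 𝔸.chimneyGerm (𝔸.facet a S) S :=
  mem_chimneyGerm_of_mem hS hTe (hTe.mem_facet (Eventually.of_forall hT))
    fun _ ht _ hs => hTe.vadd_mem hS hT hs ht

/-- Shortened chimneys decrease as `ξ` moves further into the closed cone. The infimum is therefore
directed, and one `ξ` suffices. -/
theorem exists_of_mem_chimneyGerm {F : Filter P} {S : Set V} (hS : 𝔸.IsVFacet S)
    {U : Set P} (hU : U ∈ 𝔸.chimneyGerm F S) : ∃ T, 𝔸.IsEnclosed T ∧ T ⊆ U ∧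
      T ∈ 𝔸.chimneyGerm F S ∧ ∃ ξ ∈ closure S, ∃ W ∈ F, ∀ u ∈ W, ∀ s ∈ S,
        s +ᵥ (ξ +ᵥ u) ∈ T := by
  have hanti : ∀ ξ ∈ closure S, ∀ η ∈ closure S,
      𝔸.chimney (F.map fun x => (ξ + η) +ᵥ x) S ≤ 𝔸.chimney (F.map fun x => ξ +ᵥ x) S := by
    rintro ξ - η hη U ⟨T, hTe, hT, hTU⟩
    refine ⟨T, hTe, ?_, hTU⟩
    obtain ⟨W, hW, S₁, hS₁, hsub⟩ := mem_map₂_iff.1 hT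
    rw [mem_principal] at hS₁
    refine mem_map₂_iff.2 ⟨(fun x => (ξ + η) +ᵥ x) '' ((fun x => ξ +ᵥ x) ⁻¹' W),
      image_mem_map hW, S, mem_principal_self S, ?_⟩
    rintro _ ⟨_, ⟨x, hx, rfl⟩, s, hs, rfl⟩
    have : s +ᵥ ((ξ + η) +ᵥ x) = (s + η) +ᵥ (ξ +ᵥ x) := by
      rw [vadd_vadd, vadd_vadd]; congr 1; abel
    change s +ᵥ ((ξ + η) +ᵥ x) ∈ T
    rw [this]
    exact hsub ⟨_, hx, _, hS₁ (hS.add_mem hs hη), rfl⟩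
  have hdir : DirectedOn ((fun ξ : V => 𝔸.chimney (F.map fun x => ξ +ᵥ x) S) ⁻¹'o (· ≥ ·))
      (closure S) := by
    intro ξ hξ η hη
    refine ⟨ξ + η, hS.closure_add_mem hξ hη, hanti ξ hξ η hη, ?_⟩
    have := hanti η hη ξ hξ
    rw [add_comm η ξ] at this
    exact this
  obtain ⟨ξ, hξ, T, hTe, hT, hTU⟩ := (mem_biInf_of_directed hdir ⟨0, hS.zero_mem_closure⟩).1 hU
  refine ⟨T, hTe, hTU, ?_, ξ, hξ, ?_⟩
  · exact (mem_biInf_of_directed hdir ⟨0, hS.zero_mem_closure⟩).2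
      ⟨ξ, hξ, T, hTe, hT, Subset.rfl⟩
  · obtain ⟨W, hW, S₁, hS₁, hsub⟩ := mem_map₂_iff.1 hT
    rw [mem_principal] at hS₁
    exact ⟨_, hW, fun u hu s hs => hsub ⟨_, hu, s, hS₁ hs, rfl⟩⟩

theorem exists_vadd_of_mem_chimneyGerm {a : P} {S : Set V} (hS : 𝔸.IsVFacet S)
    {U : Set P} (hU : U ∈ 𝔸.chimneyGerm (𝔸.facet a S) S) :
    ∃ s₀ ∈ S, ∀ s ∈ S, s +ᵥ (s₀ +ᵥ a) ∈ U := by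
  obtain ⟨T, -, hTU, -, ξ, hξ, W, hW, h⟩ := exists_of_mem_chimneyGerm hS hU
  obtain ⟨s₀, hs₀, -, hm⟩ := exists_mem_of_mem_facet hS hW univ_mem
  refine ⟨s₀ + ξ, hS.add_mem hs₀ hξ, fun s hs => hTU ?_⟩
  have := h _ hm s hs
  rwa [vadd_vadd ξ, add_comm] at this

end Germs

end Model

end AffineHovel

namespace AffineHovel

namespace Model

open SimpleRootData

/-! ### Inclusion between chambers implies equality. -/

section Chambers

variable {I V P : Type*} [Fintype I] [NormedAddCommGroup V] [NormedSpace ℝ V]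
  [FiniteDimensional ℝ V] [MetricSpace P] [NormedAddTorsor V P] {𝔸 : Model I V P}

theorem not_mem_realRoots_of_mem_imRoots {α : Dual ℝ V} (hα : α ∈ 𝔸.imRoots) :
    α ∉ 𝔸.realRoots := fun h => 𝔸.imRoots_ne_smul α hα α h 1 (one_smul ℝ α).symm

theorem IsTrueAt.neg {α : Dual ℝ V} {p : P} (h : 𝔸.IsTrueAt α p) : 𝔸.IsTrueAt (-α) p :=
  fun hα => by
    rw [wall_neg]
    exact h (by simpa using neg_mem_realRoots hα)

theorem openHalf_mem_facet {α : Dual ℝ V} (hα : α ∈ 𝔸.allRoots) {p : P} (hp : 𝔸.IsTrueAt α p)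
    {y : P} {S : Set V} (h : 0 < α (y -ᵥ p)) : openHalf α p ∈ 𝔸.facet y S := by
  refine ⟨_, IsPart.isSemiEnclosed hα (Or.inr ⟨p, hp, Or.inr rfl⟩), mem_localFacet.2 ?_,
    Subset.rfl⟩
  have hc : Continuous fun v : V => α ((v +ᵥ y) -ᵥ p) :=
    (continuous_level α p).comp (by fun_prop)
  have h1 : ∀ᶠ v in 𝓝 (0 : V), (0 : ℝ) < α ((v +ᵥ y) -ᵥ p) :=
    hc.continuousAt.eventually (lt_mem_nhds (by simpa using h))
  filter_upwards [h1] with v hv _ using hv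

theorem openHalf_mem_facet' {α : Dual ℝ V} (hα : α ∈ 𝔸.allRoots) {p : P} (hp : 𝔸.IsTrueAt α p)
    {y : P} {S : Set V} (h : 0 ≤ α (y -ᵥ p)) (hS : ∀ s ∈ S, 0 < α s) :
    openHalf α p ∈ 𝔸.facet y S := by
  refine ⟨_, IsPart.isSemiEnclosed hα (Or.inr ⟨p, hp, Or.inr rfl⟩), mem_localFacet.2 ?_,
    Subset.rfl⟩
  refine Eventually.of_forall fun v hv => ?_
  have := hS v hv
  simp only [openHalf, mem_ofPred_eq, vadd_vsub_assoc, map_add]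
  linarith

/-- A chamber lies on one side of every wall. -/
theorem openHalf_or_openHalf_mem_facet {Q : Set V} (hQ : 𝔸.IsVChamber Q) {α : Dual ℝ V}
    (hα : α ∈ 𝔸.allRoots) {p : P} (hp : 𝔸.IsTrueAt α p) (y : P) :
    openHalf α p ∈ 𝔸.facet y Q ∨ openHalf (-α) p ∈ 𝔸.facet y Q := by
  have hn := neg_mem_allRoots hα
  rcases lt_trichotomy (α (y -ᵥ p)) 0 with h | h | h
  · exact Or.inr (openHalf_mem_facet hn hp.neg (by simpa using h))
  · rcases hQ.sign hα with hs | hs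
    · exact Or.inl (openHalf_mem_facet' hα hp h.ge hs)
    · exact Or.inr (openHalf_mem_facet' hn hp.neg (by simp [h]) (by simpa using hs))
  · exact Or.inl (openHalf_mem_facet hα hp h)

theorem half_inter_openHalf_neg (α : Dual ℝ V) (p : P) : half α p ∩ openHalf (-α) p = ∅ := by
  ext z
  simp only [half, openHalf, mem_inter_iff, mem_ofPred_eq, LinearMap.neg_apply,
    mem_empty_iff_false, iff_false]
  rintro ⟨h1, h2⟩; linarith

/-- Each chamber lies strictly on one side of the wall; on opposite sides, the smaller filter would
contain the empty set. -/
theorem part_mem_of_le {Q Q' : Set V} (hQ : 𝔸.IsVChamber Q) (hQ' : 𝔸.IsVChamber Q') {x y : P}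
    (hle : 𝔸.facet x Q ≤ 𝔸.facet y Q') {α : Dual ℝ V} (hα : α ∈ 𝔸.allRoots) {D : Set P}
    (hD : 𝔸.IsPart α D) (hm : D ∈ 𝔸.facet x Q) : D ∈ 𝔸.facet y Q' := by
  have hne := facet_neBot (x := x) hQ.isVFacet
  rcases hD with rfl | ⟨p, hp, h⟩
  · exact univ_mem
  · rcases openHalf_or_openHalf_mem_facet hQ' hα hp y with h1 | h1
    · rcases h with rfl | rfl
      · exact mem_of_superset h1 (openHalf_subset_half α p)
      · exact h1
    · exfalso
      have h2 : half α p ∈ 𝔸.facet x Q := by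
        rcases h with rfl | rfl
        · exact hm
        · exact mem_of_superset hm (openHalf_subset_half α p)
      have h3 := inter_mem h2 (hle h1)
      rw [half_inter_openHalf_neg] at h3
      exact hne.ne (empty_mem_iff_bot.1 h3)

theorem no_wall_between {Q Q' : Set V} (hQ : 𝔸.IsVChamber Q) {x y : P}
    (hle : 𝔸.facet x Q ≤ 𝔸.facet y Q') {α : Dual ℝ V} (hα : α ∈ 𝔸.allRoots) {p : P}
    (hp : 𝔸.IsTrueAt α p) : ¬ (0 < α (p -ᵥ x) ∧ 0 < α (y -ᵥ p)) := by
  rintro ⟨h1, h2⟩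
  have h3 := hle (openHalf_mem_facet hα hp (S := Q') h2)
  have h4 : openHalf (-α) p ∈ 𝔸.facet x Q :=
    openHalf_mem_facet (neg_mem_allRoots hα) hp.neg
      (by rw [LinearMap.neg_apply, ← map_neg, neg_vsub_eq_vsub_rev]; exact h1)
  have h5 := inter_mem (mem_of_superset h3 (openHalf_subset_half α p)) h4
  rw [half_inter_openHalf_neg] at h5
  exact (facet_neBot hQ.isVFacet).ne (empty_mem_iff_bot.1 h5)

/-- Imaginary walls exist at every level, so one through the midpoint would separate `x` from `y`.
-/
theorem level_eq_of_mem_imRoots {Q Q' : Set V} (hQ : 𝔸.IsVChamber Q) {x y : P}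
    (hle : 𝔸.facet x Q ≤ 𝔸.facet y Q') {α : Dual ℝ V} (hα : α ∈ 𝔸.imRoots) :
    α (y -ᵥ x) = 0 := by
  have key : ∀ α ∈ 𝔸.imRoots, ¬ 0 < α (y -ᵥ x) := by
    intro α hα h
    refine no_wall_between (p := (1 / 2 : ℝ) • (y -ᵥ x) +ᵥ x) hQ hle (Or.inr hα)
      (fun hr => absurd hr (not_mem_realRoots_of_mem_imRoots hα)) ⟨?_, ?_⟩
    · rw [vadd_vsub, map_smul, smul_eq_mul]; linarith
    · rw [vsub_vadd_eq_vsub_sub, map_sub, map_smul, smul_eq_mul]; linarith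
  have h1 := key α hα
  have h2 := key (-α) (𝔸.imRoots_neg α hα)
  rw [LinearMap.neg_apply] at h2
  linarith

variable (𝔸) in
/-- The real roots whose walls do not form a dense family. -/
def IsDiscreteRoot (γ : Dual ℝ V) : Prop :=
  ∃ w ∈ 𝔸.weyl, ∃ i, 𝔸.IsDiscrete i ∧ γ = act w (𝔸.root i)

theorem IsDiscreteRoot.neg {γ : Dual ℝ V} (h : 𝔸.IsDiscreteRoot γ) : 𝔸.IsDiscreteRoot (-γ) := by
  obtain ⟨w, hw, i, hi, rfl⟩ := h
  refine ⟨w * 𝔸.refl i, mul_mem hw (refl_mem i), i, hi, ?_⟩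
  ext v
  rw [act_mul]
  simp [act_apply, refl_inv, root_refl_self]

theorem exists_wall_of_not_isDiscreteRoot {γ : Dual ℝ V} (hγ : γ ∈ 𝔸.realRoots)
    (h : ¬ 𝔸.IsDiscreteRoot γ) {x y : P} (hxy : 0 < γ (y -ᵥ x)) :
    ∃ p, wall γ p ∈ 𝔸.walls ∧ 0 < γ (p -ᵥ x) ∧ 0 < γ (y -ᵥ p) := by
  obtain ⟨w, hw, i, rfl⟩ := hγ
  obtain ⟨t, ht, rfl⟩ := exists_lift (𝔸 := 𝔸) hw
  by_contra hcon
  push Not at hcon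
  refine h ⟨_, hw, i, ⟨t.symm x, t.symm y, ?_, ?_⟩, rfl⟩
  · have := act_linear_apply t (𝔸.root i) (t.symm y) (t.symm x)
    rw [AffineEquiv.apply_symm_apply, AffineEquiv.apply_symm_apply] at this
    rwa [← this]
  · rintro p hp ⟨h1, h2⟩
    have e1 := act_linear_apply t (𝔸.root i) p (t.symm x)
    have e2 := act_linear_apply t (𝔸.root i) (t.symm y) p
    rw [AffineEquiv.apply_symm_apply] at e1 e2
    have := hcon (t p) (wall_mem_image ht hp) (by rwa [e1])
    rw [e2] at this
    linarith

/-- As `Q` is open, it contains `q ± t vⱼ` for a dual family `vⱼ` and some `t > 0`. Positivity there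
bounds `|γ(vⱼ)|` by `γ(q) / t`, and `finite_discrete_roots` applies. -/
theorem finite_isDiscreteRoot_le {Q : Set V} (hQ : 𝔸.IsVChamber Q) {q : V} (hq : q ∈ Q) (K : ℝ) :
    {γ | 𝔸.IsDiscreteRoot γ ∧ (∀ q ∈ Q, 0 < γ q) ∧ γ q ≤ K}.Finite := by
  classical
  choose v hv using fun j => exists_root_apply_eq (𝔸 := 𝔸) (Pi.single j (1 : ℝ))
  have h1 : ∀ j, ∀ᶠ t : ℝ in 𝓝 0, q - t • v j ∈ Q ∧ q + t • v j ∈ Q := by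
    intro j
    have c1 : Tendsto (fun t : ℝ => q - t • v j) (𝓝 0) (𝓝 q) := by
      have : Continuous fun t : ℝ => q - t • v j := by fun_prop
      simpa using this.tendsto 0
    have c2 : Tendsto (fun t : ℝ => q + t • v j) (𝓝 0) (𝓝 q) := by
      have : Continuous fun t : ℝ => q + t • v j := by fun_prop
      simpa using this.tendsto 0
    exact (c1.eventually (hQ.isOpen.mem_nhds hq)).and (c2.eventually (hQ.isOpen.mem_nhds hq))
  obtain ⟨t, ht, ht0⟩ := (((eventually_all.2 h1).filter_mono nhdsWithin_le_nhds).and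
    (self_mem_nhdsWithin : Ioi (0 : ℝ) ∈ 𝓝[>] 0)).exists
  have ht0 : 0 < t := ht0
  refine (finite_discrete_roots (𝔸 := 𝔸) (K / t) (v := v) (fun i => by simp [hv])
    (fun i j hij => by simp [hv, hij])).subset ?_
  rintro γ ⟨⟨w, hw, i, hi, rfl⟩, hpos, hK⟩
  refine ⟨w, hw, i, hi, rfl, fun j => ?_⟩
  have h2 := hpos _ (ht j).1
  have h3 := hpos _ (ht j).2
  rw [map_sub, map_smul, smul_eq_mul] at h2
  rw [map_add, map_smul, smul_eq_mul] at h3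
  have h4 : |act w (𝔸.root i) (v j)| * t = |act w (𝔸.root i) (v j) * t| := by
    rw [abs_mul, abs_of_pos ht0]
  rw [le_div_iff₀ ht0, h4, abs_le]
  constructor <;> linarith [mul_comm t (act w (𝔸.root i) (v j))]

/-- One element of a chamber may impose a half-space for every root simultaneously. With a wall
chosen below `y` for each real root positive on `Q'`, the inclusion of chambers produces the same
`t` for all these roots. -/
theorem exists_smul_mem_of_le {Q Q' : Set V} (hQ : 𝔸.IsVChamber Q) {x y : P}
    (hle : 𝔸.facet x Q ≤ 𝔸.facet y Q') {p : Dual ℝ V → P}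
    (hp : ∀ γ ∈ 𝔸.realRoots, (∀ q ∈ Q', 0 < γ q) → wall γ (p γ) ∈ 𝔸.walls ∧ 0 < γ (y -ᵥ p γ))
    {q : V} (hq : q ∈ Q) :
    ∃ t : ℝ, 0 < t ∧ ∀ γ ∈ 𝔸.realRoots, (∀ q ∈ Q', 0 < γ q) →
      0 < t * γ q + γ (x -ᵥ y) + γ (y -ᵥ p γ) := by
  classical
  let D : Dual ℝ V → Set P := fun γ =>
    if γ ∈ 𝔸.realRoots ∧ ∀ q ∈ Q', 0 < γ q then openHalf γ (p γ) else univ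
  have hD : ∀ γ ∈ 𝔸.allRoots, 𝔸.IsPart γ (D γ) := by
    intro γ _
    by_cases h : γ ∈ 𝔸.realRoots ∧ ∀ q ∈ Q', 0 < γ q
    · exact Or.inr ⟨p γ, fun _ => (hp γ h.1 h.2).1, Or.inr (if_pos h)⟩
    · exact Or.inl (if_neg h)
  have h1 : (⋂ γ ∈ 𝔸.allRoots, D γ) ∈ 𝔸.facet y Q' := by
    refine ⟨_, ⟨D, hD, rfl⟩, mem_localFacet.2 (Eventually.of_forall fun v hv => ?_), Subset.rfl⟩
    refine mem_iInter₂.2 fun γ _ => ?_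
    by_cases h : γ ∈ 𝔸.realRoots ∧ ∀ q ∈ Q', 0 < γ q
    · change v +ᵥ y ∈ if _ then _ else _
      rw [if_pos h]
      have h3 := (hp γ h.1 h.2).2
      have h4 := h.2 v hv
      simp only [openHalf, mem_ofPred_eq, vadd_vsub_assoc, map_add]
      linarith
    · change v +ᵥ y ∈ if _ then _ else _
      rw [if_neg h]; trivial
  have h2 := mem_localFacet.1 (facet_le_localFacet (hle h1))
  have hc : Tendsto (fun t : ℝ => t • q) (𝓝[>] 0) (𝓝 0) := by
    have : Continuous fun t : ℝ => t • q := by fun_prop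
    simpa using (this.tendsto 0).mono_left nhdsWithin_le_nhds
  obtain ⟨t, ht, ht0⟩ := ((hc.eventually h2).and
    (self_mem_nhdsWithin : Ioi (0 : ℝ) ∈ 𝓝[>] 0)).exists
  refine ⟨t, ht0, fun γ hγ hpos => ?_⟩
  have h3 := mem_iInter₂.1 (ht (hQ.isVFacet.smul_mem hq ht0)) γ (Or.inl hγ)
  change _ ∈ if _ then _ else _ at h3
  rw [if_pos ⟨hγ, hpos⟩] at h3
  have e : γ ((t • q +ᵥ x) -ᵥ p γ) = t * γ q + γ (x -ᵥ y) + γ (y -ᵥ p γ) := by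
    rw [vadd_vsub_assoc, map_add, map_smul, smul_eq_mul, ← vsub_add_vsub_cancel x y (p γ), map_add,
      add_assoc]
  simpa only [openHalf, mem_ofPred_eq, e] using h3

/-- The uniform `t` of `exists_smul_mem_of_le` bounds `-γ(q₀)` for discrete roots, when the walls
are chosen within `G` of `y`. For infinitely many roots with dense walls, one takes walls within
`-γ(q₀)/(n+1)` of `y` for the `n`-th root; since `x` and `y` have the same level, `t < 1/(n+1)`
would follow for all `n`. -/
theorem finite_separating {Q Q' : Set V} (hQ : 𝔸.IsVChamber Q) {x y : P}
    (hle : 𝔸.facet x Q ≤ 𝔸.facet y Q') :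
    {γ | γ ∈ 𝔸.realRoots ∧ (∀ q ∈ Q, γ q < 0) ∧ ∀ q ∈ Q', 0 < γ q}.Finite := by
  classical
  obtain ⟨q₀, hq₀⟩ := hQ.isVFacet.nonempty
  obtain ⟨G, hG0, hG⟩ := exists_gap (𝔸 := 𝔸)
  have hbelow : ∀ γ ∈ 𝔸.realRoots, ∃ p, wall γ p ∈ 𝔸.walls ∧ 0 < γ (y -ᵥ p) ∧
      γ (y -ᵥ p) ≤ G := by
    intro γ hγ
    obtain ⟨p, hp, h1, h2⟩ := hG (-γ) (neg_mem_realRoots hγ) y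
    rw [LinearMap.neg_apply, ← map_neg, neg_vsub_eq_vsub_rev] at h1 h2
    exact ⟨p, by rwa [wall_neg] at hp, h1, h2⟩
  have hdisc : {γ | 𝔸.IsDiscreteRoot γ ∧ γ ∈ 𝔸.realRoots ∧ (∀ q ∈ Q, γ q < 0) ∧
      ∀ q ∈ Q', 0 < γ q}.Finite := by
    choose! p hp using hbelow
    obtain ⟨t, ht0, ht⟩ := exists_smul_mem_of_le hQ hle (p := p)
      (fun γ hγ _ => ⟨(hp γ hγ).1, (hp γ hγ).2.1⟩) hq₀
    refine ((finite_isDiscreteRoot_le hQ hq₀ ((G + G) / t)).image Neg.neg).subset ?_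
    rintro γ ⟨hd, hγ, hneg, hpos⟩
    refine ⟨-γ, ⟨hd.neg, fun q hq => by simpa using hneg q hq, ?_⟩, neg_neg γ⟩
    have h1 := ht γ hγ hpos
    have h2 := (hp γ hγ).2.2
    have h3 : γ (x -ᵥ y) ≤ G := by
      by_contra hcon
      obtain ⟨r, hr, h4, h5⟩ := hG (-γ) (neg_mem_realRoots hγ) x
      refine no_wall_between hQ hle (α := -γ) (Or.inl (neg_mem_realRoots hγ)) (fun _ => hr)
        ⟨h4, ?_⟩
      have e : (-γ) (y -ᵥ r) = γ (x -ᵥ y) - (-γ) (r -ᵥ x) := by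
        rw [LinearMap.neg_apply, LinearMap.neg_apply, ← vsub_sub_vsub_cancel_right y r x, map_sub,
          ← neg_vsub_eq_vsub_rev x y, map_neg]
        ring
      rw [e]; linarith
    rw [LinearMap.neg_apply, le_div_iff₀ ht0]
    nlinarith
  have hdense : {γ | ¬ 𝔸.IsDiscreteRoot γ ∧ γ ∈ 𝔸.realRoots ∧ (∀ q ∈ Q, γ q < 0) ∧
      ∀ q ∈ Q', 0 < γ q}.Finite := by
    by_contra hinf
    have hinf : Set.Infinite _ := hinf
    let f := hinf.natEmbedding
    have hp : ∀ γ ∈ 𝔸.realRoots, ∃ p, wall γ p ∈ 𝔸.walls ∧ 0 < γ (y -ᵥ p) ∧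
        ∀ n, (f n : Dual ℝ V) = γ → γ (y -ᵥ p) * (n + 1) < - γ q₀ := by
      intro γ hγ
      by_cases h : ∃ n, (f n : Dual ℝ V) = γ
      · obtain ⟨n, hn⟩ := h
        obtain ⟨h1, h2, h3, h4⟩ := (f n).2
        rw [hn] at h1 h3
        have hg : 0 < - γ q₀ := by linarith [h3 q₀ hq₀]
        have hε : 0 < -γ q₀ / (n + 1) := by positivity
        obtain ⟨z, hz⟩ : ∃ z : P, γ (y -ᵥ z) = -γ q₀ / (n + 1) := by
          refine ⟨(1 / ((n : ℝ) + 1)) • q₀ +ᵥ y, ?_⟩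
          rw [vsub_vadd_eq_vsub_sub, vsub_self, zero_sub, map_neg, map_smul, smul_eq_mul]
          ring
        obtain ⟨p, hp, h5, h6⟩ := exists_wall_of_not_isDiscreteRoot hγ h1 (hz ▸ hε)
        refine ⟨p, hp, h6, fun m hm => ?_⟩
        have : m = n := f.injective (Subtype.ext (hm.trans hn.symm))
        subst this
        have e : γ (y -ᵥ z) = γ (y -ᵥ p) + γ (p -ᵥ z) := by
          rw [← map_add, vsub_add_vsub_cancel]
        have h7 : γ (y -ᵥ p) < -γ q₀ / (m + 1) := by linarith
        rwa [lt_div_iff₀ (by positivity)] at h7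
      · obtain ⟨p, h1, h2, -⟩ := hbelow γ hγ
        exact ⟨p, h1, h2, fun n hn => absurd ⟨n, hn⟩ h⟩
    choose! p hp using hp
    obtain ⟨t, ht0, ht⟩ := exists_smul_mem_of_le hQ hle (p := p)
      (fun γ hγ _ => ⟨(hp γ hγ).1, (hp γ hγ).2.1⟩) hq₀
    obtain ⟨n, hn⟩ := exists_nat_gt (1 / t)
    obtain ⟨h1, hγ, h3, h4⟩ := (f n).2
    set γ := (f n : Dual ℝ V) with hγdef
    have hxy : γ (x -ᵥ y) = 0 := by
      by_contra hne
      have e : γ (y -ᵥ x) = - γ (x -ᵥ y) := by rw [← map_neg, neg_vsub_eq_vsub_rev]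
      rcases lt_or_gt_of_ne hne with h | h
      · obtain ⟨r, hr, h5, h6⟩ := exists_wall_of_not_isDiscreteRoot hγ h1
          (show 0 < γ (y -ᵥ x) by linarith)
        exact no_wall_between hQ hle (Or.inl hγ) (fun _ => hr) ⟨h5, h6⟩
      · obtain ⟨r, hr, h5, h6⟩ := exists_wall_of_not_isDiscreteRoot hγ h1 h
        refine no_wall_between hQ hle (α := -γ) (Or.inl (neg_mem_realRoots hγ))
          (fun _ => by rwa [wall_neg]) ⟨?_, ?_⟩
        · rw [LinearMap.neg_apply, ← map_neg, neg_vsub_eq_vsub_rev]; exact h6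
        · rw [LinearMap.neg_apply, ← map_neg, neg_vsub_eq_vsub_rev]; exact h5
    have h5 := ht γ hγ h4
    have h6 := (hp γ hγ).2.2 n rfl
    have h7 := h3 q₀ hq₀
    rw [hxy] at h5
    rw [div_lt_iff₀ ht0] at hn
    have h8 := (hp γ hγ).2.1
    nlinarith
  refine (hdisc.union hdense).subset fun γ hγ => ?_
  by_cases h : 𝔸.IsDiscreteRoot γ
  · exact Or.inl ⟨h, hγ⟩
  · exact Or.inr ⟨h, hγ⟩

/-- Two chambers are equal if one of them contains the other. -/
theorem facet_eq_of_le {Q Q' : Set V} (hQ : 𝔸.IsVChamber Q) (hQ' : 𝔸.IsVChamber Q') {x y : P}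
    (hle : 𝔸.facet x Q ≤ 𝔸.facet y Q') : 𝔸.facet x Q = 𝔸.facet y Q' := by
  refine le_antisymm hle ?_
  rintro U ⟨T, hT, hTm, hTU⟩
  refine ⟨T, hT, ?_, hTU⟩
  obtain ⟨D, hD, rfl⟩ := hT
  have hTx : (⋂ β ∈ 𝔸.allRoots, D β) ∈ 𝔸.facet x Q := ⟨_, ⟨D, hD, rfl⟩, hTm, Subset.rfl⟩
  have hDy : ∀ α ∈ 𝔸.allRoots, D α ∈ 𝔸.facet y Q' := fun α hα =>
    part_mem_of_le hQ hQ' hle hα (hD α hα) (mem_of_superset hTx (biInter_subset_of_mem hα))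
  obtain ⟨G, hG0, hG⟩ := exists_gap (𝔸 := 𝔸)
  obtain ⟨q₁, hq₁, -, hq₁T⟩ := exists_mem_of_mem_facet hQ.isVFacet hTx univ_mem
  have hlevel : ∀ α ∈ 𝔸.realRoots, - G ≤ α (y -ᵥ x) := by
    intro α hα
    by_contra hcon
    obtain ⟨r, hr, h4, h5⟩ := hG (-α) (neg_mem_realRoots hα) x
    refine no_wall_between hQ hle (α := -α) (Or.inl (neg_mem_realRoots hα)) (fun _ => hr)
      ⟨h4, ?_⟩
    have e : (-α) (y -ᵥ r) = - α (y -ᵥ x) - (-α) (r -ᵥ x) := by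
      rw [LinearMap.neg_apply, LinearMap.neg_apply, ← vsub_sub_vsub_cancel_right y r x, map_sub]
      ring
    rw [e]; linarith
  -- The roots that need an individual neighbourhood: those positive on `Q` and negative on `Q'`,
  -- and the discrete ones negative on `Q` and small at `q₁`. Both families are finite. Every other
  -- root is handled by comparison with one point of its half-space.
  let E : Set (Dual ℝ V) :=
    (Neg.neg '' {γ | γ ∈ 𝔸.realRoots ∧ (∀ q ∈ Q, γ q < 0) ∧ ∀ q ∈ Q', 0 < γ q}) ∪
    (Neg.neg '' {γ | 𝔸.IsDiscreteRoot γ ∧ (∀ q ∈ Q, 0 < γ q) ∧ γ q₁ ≤ G + G})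
  have hE : E.Finite := ((finite_separating hQ hle).image _).union
    ((finite_isDiscreteRoot_le hQ hq₁ (G + G)).image _)
  have h1 : ∀ᶠ v in 𝓝 (0 : V), ∀ α ∈ E, α ∈ 𝔸.allRoots → v ∈ Q' → v +ᵥ y ∈ D α := by
    refine (eventually_all_finite hE).2 fun α _ => ?_
    by_cases hα : α ∈ 𝔸.allRoots
    · filter_upwards [mem_localFacet.1 (facet_le_localFacet (hDy α hα))] with v hv _ using hv
    · exact Eventually.of_forall fun v h => absurd h hα
  -- With `q₁/2 - v` in `Q`, every root negative on `Q` satisfies `α(v) > α(q₁)/2`, so `v +ᵥ y`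
  -- exceeds `q₁ +ᵥ x` by more than `-α(q₁)/2`, up to the level difference `α(y - x) ≥ -G`.
  have h2 := hQ.eventually_sub_mem (hQ.isVFacet.smul_mem hq₁ (one_half_pos (α := ℝ)))
  refine mem_localFacet.2 ?_
  filter_upwards [h1, h2] with v hv1 hv2 hvQ
  refine mem_iInter₂.2 fun α hα => ?_
  have hxD : q₁ +ᵥ x ∈ D α := mem_iInter₂.1 hq₁T α hα
  have e : α ((v +ᵥ y) -ᵥ (q₁ +ᵥ x)) = α v - α q₁ + α (y -ᵥ x) := by
    rw [vadd_vsub_vadd_comm, map_add, map_sub]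
  rcases hQ'.sign hα with hs' | hs'
  · obtain ⟨s, hs, hs1, hs2⟩ := exists_mem_of_mem_facet hQ'.isVFacet (hDy α hα)
      (hQ'.eventually_sub_mem hvQ)
    refine (hD α hα).mem_of_nonneg hs2 ?_
    rw [vadd_vsub_vadd_cancel_right]
    exact (hs' _ hs1).le
  · rcases hQ.sign hα with hs | hs
    · rcases hα with hα | hα
      · refine hv1 α (Or.inl ⟨-α, ⟨neg_mem_realRoots hα, ?_, ?_⟩, neg_neg α⟩) (Or.inl hα) hvQ
        · intro q hq; simpa using hs q hq
        · intro q hq; simpa using hs' q hq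
      · exfalso
        have htrue : 𝔸.IsTrueAt α x := fun hr => absurd hr (not_mem_realRoots_of_mem_imRoots hα)
        have h3 := part_mem_of_le hQ hQ' hle (Or.inr hα) (Or.inr ⟨x, htrue, Or.inr rfl⟩)
          (openHalf_mem_facet' (Or.inr hα) htrue (y := x) (by simp) hs)
        obtain ⟨s, h4, -, h5⟩ := exists_mem_of_mem_facet hQ'.isVFacet h3 univ_mem
        simp only [openHalf, mem_ofPred_eq, vadd_vsub_assoc, map_add,
          level_eq_of_mem_imRoots hQ hle hα] at h5
        linarith [hs' s h4]
    · have h3 := hs _ hv2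
      rw [map_sub, map_smul, smul_eq_mul] at h3
      have h4 := hs q₁ hq₁
      by_cases h0 : α (y -ᵥ x) = 0
      · refine (hD α hα).mem_of_nonneg hxD ?_
        rw [e, h0]; linarith
      · have hr : α ∈ 𝔸.realRoots := hα.resolve_right fun h =>
          h0 (level_eq_of_mem_imRoots hQ hle h)
        -- Otherwise a wall would lie strictly between the levels of `x` and `y`.
        have hd : 𝔸.IsDiscreteRoot α := by
          by_contra hnd
          have hnd' : ¬ 𝔸.IsDiscreteRoot (-α) := fun h => hnd (by simpa using h.neg)
          rcases lt_or_gt_of_ne h0 with h | h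
          · obtain ⟨p, hp, h5, h6⟩ := exists_wall_of_not_isDiscreteRoot (neg_mem_realRoots hr)
              hnd' (x := x) (y := y) (by simpa using h)
            exact no_wall_between hQ hle (Or.inl (neg_mem_realRoots hr)) (fun _ => hp) ⟨h5, h6⟩
          · obtain ⟨p, hp, h5, h6⟩ := exists_wall_of_not_isDiscreteRoot hr hnd h
            exact no_wall_between hQ hle (Or.inl hr) (fun _ => hp) ⟨h5, h6⟩
        by_cases hsmall : - α q₁ ≤ G + G
        · refine hv1 α (Or.inr ⟨-α, ⟨hd.neg, ?_, by simpa using hsmall⟩, neg_neg α⟩) hα hvQ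
          intro q hq; simpa using hs q hq
        · refine (hD α hα).mem_of_nonneg hxD ?_
          rw [e]
          linarith [hlevel α hr]

end Chambers

end Model

end AffineHovel

namespace AffineHovel

namespace Model

open SimpleRootData

/-! ### Chambers along a panel, solid chimneys, and sets enclosed by cones. -/

section Panels

variable {I V P : Type*} [Fintype I] [NormedAddCommGroup V] [NormedSpace ℝ V]
  [FiniteDimensional ℝ V] [MetricSpace P] [NormedAddTorsor V P] {𝔸 : Model I V P}
  {S : Set V} {β : Dual ℝ V}

theorem IsPart.mem_of_mem_closure {α : Dual ℝ V} {D : Set P} (hD : 𝔸.IsPart α D) {z y : P}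
    (hz : z ∈ closure D) (h : 0 < α (y -ᵥ z)) : y ∈ D := by
  have hc : Continuous fun u : P => α (y -ᵥ u) :=
    (continuous_dual α).comp (continuous_const.vsub continuous_id)
  have h1 : {u | 0 < α (y -ᵥ u)} ∈ 𝓝 z := hc.continuousAt.eventually (lt_mem_nhds h)
  obtain ⟨u, hu, huD⟩ := mem_closure_iff_nhds.1 hz _ h1
  have hu : 0 < α (y -ᵥ u) := hu
  exact hD.mem_of_nonneg huD hu.le

/-- A chamber on the positive side of `β` dominating a panel in a wall of direction `ker β`. -/
theorem facet_eq_of_dominates (h : 𝔸.IsPanelDir S β) {Q : Set V} (hQ : 𝔸.IsSide S β Q)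
    {x y : P} {Q' : Set V} (hQ' : 𝔸.IsVChamber Q')
    (hdom : 𝔸.facet x S ≤ adherence (𝔸.facet y Q')) (hside : openHalf β x ∈ 𝔸.facet y Q') :
    𝔸.facet y Q' = 𝔸.facet x Q := by
  refine (facet_eq_of_le hQ.chamber hQ' ?_).symm
  rintro U ⟨T, hT, hTm, hTU⟩
  refine ⟨T, hT, ?_, hTU⟩
  have hTy : T ∈ 𝔸.facet y Q' := ⟨T, hT, hTm, Subset.rfl⟩
  have hcl : closure T ∈ 𝔸.facet x S := hdom (mem_adherence.2 ⟨T, hTy, Subset.rfl⟩)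
  obtain ⟨s, hs, -, hsT⟩ := exists_mem_of_mem_facet h.isVFacet hcl univ_mem
  have hxT : x ∈ closure T := by
    simpa using mem_closure_of_mem_facet h.isVFacet hcl
  obtain ⟨z, hzT, hz⟩ := (facet_neBot (x := y) hQ'.isVFacet).nonempty_of_mem
    (inter_mem hTy hside)
  have hz : 0 < β (z -ᵥ x) := hz
  obtain ⟨D, hD, rfl⟩ := hT
  have hsub : ∀ α ∈ 𝔸.allRoots, closure (⋂ γ ∈ 𝔸.allRoots, D γ) ⊆ closure (D α) :=
    fun α hα => closure_mono (biInter_subset_of_mem hα)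
  have h1 : ∀ᶠ v in 𝓝 (0 : V), ∀ α ∈ 𝔸.allRoots, (∀ s ∈ S, 0 < α s) → 0 < α (s - v) := by
    have hc : Tendsto (fun v : V => s - v) (𝓝 0) (𝓝 s) := by
      have : Continuous fun v : V => s - v := by fun_prop
      simpa using this.tendsto 0
    exact hc.eventually (h.eventually_pos hs)
  have h2 : ∀ᶠ v in 𝓝 (0 : V), β v < β (z -ᵥ x) :=
    (continuous_dual β).continuousAt.eventually (gt_mem_nhds (by simpa using hz))
  refine mem_localFacet.2 ?_
  filter_upwards [h1, h2] with v hv1 hv2 hvQ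
  refine mem_iInter₂.2 fun α hα => ?_
  -- Each half-space is tested at one point: `x` for `β` and the roots positive on `S`, `z` for
  -- `-β`, and `s +ᵥ x` for the roots negative on `S`.
  rcases h.trichotomy hα with rfl | rfl | hp | hn
  · exact (hD _ hα).mem_of_mem_closure (hsub _ hα hxT) (by simpa using hQ.pos v hvQ)
  · refine (hD _ hα).mem_of_nonneg (mem_iInter₂.1 hzT _ hα) ?_
    rw [LinearMap.neg_apply, vadd_vsub_assoc, map_add, ← neg_vsub_eq_vsub_rev, map_neg]
    linarith
  · exact (hD _ hα).mem_of_mem_closure (hsub _ hα hxT)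
      (by simpa using hQ.pos_of_pos α hα hp v hvQ)
  · refine (hD _ hα).mem_of_mem_closure (hsub _ hα hsT) ?_
    have := hv1 (-α) (neg_mem_allRoots hα) (by simpa using hn)
    rw [vadd_vsub_vadd_cancel_right, map_sub]
    simp only [LinearMap.neg_apply, map_sub] at this
    linarith

/-- There are at most two chambers dominating a panel in the model apartment. -/
theorem facet_eq_or_of_dominates (h : 𝔸.IsPanelDir S β) {Q₁ Q₂ : Set V} (hQ₁ : 𝔸.IsSide S β Q₁)
    (hQ₂ : 𝔸.IsSide S (-β) Q₂) {x y : P} (hx : wall β x ∈ 𝔸.walls) {Q' : Set V}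
    (hQ' : 𝔸.IsVChamber Q') (hdom : 𝔸.facet x S ≤ adherence (𝔸.facet y Q')) :
    𝔸.facet y Q' = 𝔸.facet x Q₁ ∨ 𝔸.facet y Q' = 𝔸.facet x Q₂ :=
  (openHalf_or_openHalf_mem_facet hQ' (Or.inl h.real) (fun _ => hx) y).imp
    (facet_eq_of_dominates h hQ₁ hQ' hdom) (facet_eq_of_dominates h.neg_root hQ₂ hQ' hdom)

/-- Used to find an enclosed set inside the closure of an intersection of infinitely many
half-spaces: its points are limits along segments ending at a common point of these half-spaces. -/
theorem IsPart.exists_closed {α : Dual ℝ V} {D : Set P} (hD : 𝔸.IsPart α D) :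
    ∃ D', 𝔸.IsClosedPart α D' ∧ D ⊆ D' ∧
      ∀ z ∈ D', ∀ y ∈ D, ∀ t : ℝ, 0 < t → t ≤ 1 → t • (y -ᵥ z) +ᵥ z ∈ D := by
  have e : ∀ (p z y : P) (t : ℝ), α ((t • (y -ᵥ z) +ᵥ z) -ᵥ p) =
      t * α (y -ᵥ p) + (1 - t) * α (z -ᵥ p) := by
    intro p z y t
    rw [vadd_vsub_assoc, map_add, map_smul, smul_eq_mul, ← vsub_sub_vsub_cancel_right y z p,
      map_sub]
    ring
  rcases hD with rfl | ⟨p, hp, rfl | rfl⟩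
  · exact ⟨univ, Or.inl rfl, Subset.rfl, fun _ _ _ _ _ _ _ => trivial⟩
  · refine ⟨half α p, Or.inr ⟨p, hp, rfl⟩, Subset.rfl, fun z hz y hy t h0 h1 => ?_⟩
    simp only [half, mem_ofPred_eq] at *
    rw [e]
    exact add_nonneg (mul_nonneg h0.le hy) (mul_nonneg (by linarith) hz)
  · refine ⟨half α p, Or.inr ⟨p, hp, rfl⟩, openHalf_subset_half α p,
      fun z hz y hy t h0 h1 => ?_⟩
    simp only [half, openHalf, mem_ofPred_eq] at *
    rw [e]
    exact add_pos_of_pos_of_nonneg (mul_pos h0 hy) (mul_nonneg (by linarith) hz)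

/-- The chamber `F(a, Q)` dominates the panel `F(a, S)`. -/
theorem facet_le_adherence {Q : Set V} (hQ : 𝔸.IsSide S β Q) (a : P) :
    𝔸.facet a S ≤ adherence (𝔸.facet a Q) := by
  intro U hU
  obtain ⟨T', ⟨T, hT, hTm, hTT'⟩, hU⟩ := mem_adherence.1 hU
  refine mem_of_superset ?_ ((closure_mono hTT').trans hU)
  have hTa : T ∈ 𝔸.facet a Q := ⟨T, hT, hTm, Subset.rfl⟩
  obtain ⟨D, hD, rfl⟩ := hT
  obtain ⟨q, hq, -, hqT⟩ := exists_mem_of_mem_facet hQ.chamber.isVFacet hTa univ_mem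
  choose! D' hD' hsub hseg using fun α (hα : α ∈ 𝔸.allRoots) => (hD α hα).exists_closed
  have hE : 𝔸.IsEnclosed (⋂ γ ∈ 𝔸.allRoots, D' γ) := ⟨D', hD', rfl⟩
  have hcl : (⋂ γ ∈ 𝔸.allRoots, D' γ) ⊆ closure (⋂ γ ∈ 𝔸.allRoots, D γ) := by
    intro z hz
    have hc : Tendsto (fun t : ℝ => t • ((q +ᵥ a) -ᵥ z) +ᵥ z) (𝓝[>] 0) (𝓝 z) := by
      have : Continuous fun t : ℝ => t • ((q +ᵥ a) -ᵥ z) +ᵥ z := by fun_prop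
      simpa using (this.tendsto 0).mono_left nhdsWithin_le_nhds
    refine mem_closure_of_tendsto hc ?_
    filter_upwards [Ioc_mem_nhdsGT (one_pos : (0 : ℝ) < 1)] with t ht
    exact mem_iInter₂.2 fun α hα => hseg α hα z (mem_iInter₂.1 hz α hα) _
      (mem_iInter₂.1 hqT α hα) t ht.1 ht.2
  refine mem_of_superset (hE.mem_facet ?_) hcl
  filter_upwards [eventually_eventually_nhds.2 (mem_localFacet.1 hTm)] with v hv hvS
  have hc : Tendsto (fun t : ℝ => v + t • q) (𝓝[>] 0) (𝓝 v) := by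
    have : Continuous fun t : ℝ => v + t • q := by fun_prop
    simpa using (this.tendsto 0).mono_left nhdsWithin_le_nhds
  have hc2 : Tendsto (fun t : ℝ => (v + t • q) +ᵥ a) (𝓝[>] 0) (𝓝 (v +ᵥ a)) :=
    hc.vadd tendsto_const_nhds
  have h1 : v +ᵥ a ∈ closure (⋂ γ ∈ 𝔸.allRoots, D' γ) := by
    refine mem_closure_of_tendsto hc2 ?_
    filter_upwards [hc.eventually hv, self_mem_nhdsWithin] with t ht ht0
    exact iInter₂_mono hsub
      (ht (hQ.add_mem v hvS _ (hQ.chamber.isVFacet.smul_mem hq ht0)))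
  rwa [hE.isClosed.closure_eq] at h1

/-! ### Solid chimneys -/

/-- Elements of the chimney contain translates of a set adherent to `x`, and enclosed sets are
closed; so the support contains `s +ᵥ x` and `(s + s) +ᵥ x`, and its direction contains `s`. -/
theorem isSolid_chimney {S' : Set V} (hS : 𝔸.IsVFacet S) (hS' : 𝔸.IsVFacet S') (x : P)
    (hfin : {u : V ≃ₗ[ℝ] V | u ∈ 𝔸.weyl ∧ ∀ s ∈ S, u s = s}.Finite) :
    𝔸.IsSolid (𝔸.chimney (𝔸.facet x S') S) := by
  refine hfin.subset fun u ⟨hu, hfix⟩ => ⟨hu, fun s hs => hfix s ?_⟩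
  have key : ∀ s ∈ S, s +ᵥ x ∈ support (𝔸.chimney (𝔸.facet x S') S) := by
    intro s hs
    rw [support, ← SetLike.mem_coe, AffineSubspace.coe_sInf]
    refine mem_iInter₂.2 fun E hE => ?_
    obtain ⟨T, hTe, hT, hTE⟩ := hE
    obtain ⟨W, hW, S₁, hS₁, hsub⟩ := mem_map₂_iff.1 hT
    rw [mem_principal] at hS₁
    apply hTE
    have hc : Continuous fun z : P => s +ᵥ z := by fun_prop
    have hmaps : MapsTo (fun z : P => s +ᵥ z) W T := fun z hz => hsub ⟨z, hz, s, hS₁ hs, rfl⟩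
    have := hmaps.closure hc (mem_closure_of_mem_facet hS' hW)
    rwa [hTe.isClosed.closure_eq] at this
  have h1 := AffineSubspace.vsub_mem_direction (key _ (hS.add_mem' hs hs)) (key s hs)
  simpa [vadd_vsub_vadd_cancel_right] using h1

theorem IsPanelDir.isSolid (h : 𝔸.IsPanelDir S β) (x : P) :
    𝔸.IsSolid (𝔸.chimney (𝔸.facet x S) S) := by
  obtain ⟨r, -, hr⟩ := h.exists_stabilizer
  exact isSolid_chimney h.isVFacet h.isVFacet x
    ((Set.toFinite {1, r}).subset fun u hu => hr u hu.1 hu.2)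

theorem _root_.AffineHovel.SimpleRootData.IsVChamber.eq_of_fix {Q : Set V}
    (hQ : 𝔸.IsVChamber Q) {u : V ≃ₗ[ℝ] V} (hu : ∀ q ∈ Q, u q = q) (v : V) : u v = v := by
  obtain ⟨q, hq⟩ := hQ.isVFacet.nonempty
  have hc : Tendsto (fun t : ℝ => q + t • v) (𝓝[>] 0) (𝓝 q) := by
    have : Continuous fun t : ℝ => q + t • v := by fun_prop
    simpa using (this.tendsto 0).mono_left nhdsWithin_le_nhds
  obtain ⟨t, h1, ht⟩ := ((hc.eventually (hQ.isOpen.mem_nhds hq)).and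
    (self_mem_nhdsWithin : Ioi (0 : ℝ) ∈ 𝓝[>] 0)).exists
  have ht : (0 : ℝ) < t := ht
  have h2 := hu _ h1
  rw [map_add, hu q hq, map_smul, add_right_inj] at h2
  exact smul_right_injective V ht.ne' h2

theorem _root_.AffineHovel.SimpleRootData.IsVChamber.isSolid {Q : Set V}
    (hQ : 𝔸.IsVChamber Q) (x : P) : 𝔸.IsSolid (𝔸.chimney (𝔸.facet x Q) Q) :=
  isSolid_chimney hQ.isVFacet hQ.isVFacet x
    ((Set.finite_singleton 1).subset fun u hu => by ext v; exact hQ.eq_of_fix hu.2 v)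

/-! ### Enclosed sets containing cones -/

theorem exists_nonneg_of_neg {T : Set P} {C : Set V} (hC : 𝔸.IsVFacet C) {t : P}
    (ht : ∀ s ∈ C, s +ᵥ t ∈ T) {α : Dual ℝ V} (hα : ∀ s ∈ C, α s < 0) (z : P) :
    ∃ u ∈ T, 0 ≤ α (z -ᵥ u) := by
  obtain ⟨s, hs⟩ := hC.nonempty
  have h0 := hα s hs
  obtain ⟨n, hn⟩ := exists_nat_gt (-α (z -ᵥ t) / (-α s))
  rw [div_lt_iff₀ (by linarith)] at hn
  refine ⟨((n : ℝ) + 1) • s +ᵥ t, ht _ (hC.smul_mem hs (by positivity)), ?_⟩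
  rw [vsub_vadd_eq_vsub_sub, map_sub, map_smul, smul_eq_mul]
  nlinarith

/-- A panel cone and an opposite chamber cone enclose a half-space. -/
theorem IsPanelDir.half_subset (h : 𝔸.IsPanelDir S β) {Q : Set V} (hQ : 𝔸.IsSide S (-β) Q)
    {T : Set P} (hT : 𝔸.IsEnclosed T) {t₁ t₂ : P} (h₁ : ∀ s ∈ S, s +ᵥ t₁ ∈ T)
    (h₂ : ∀ q ∈ (Neg.neg ⁻¹' Q : Set V), q +ᵥ t₂ ∈ T) : half β t₁ ⊆ T := by
  intro z hz
  have hQf := hQ.chamber.isVFacet.neg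
  refine hT.mem fun α hα => ?_
  -- `β` is constant along `S`; every other root tends to `-∞` along `S` or along `-Q`, and so
  -- imposes no condition.
  rcases h.trichotomy hα with rfl | rfl | hp | hn
  · obtain ⟨s, hs⟩ := h.isVFacet.nonempty
    refine ⟨_, h₁ s hs, ?_⟩
    rw [vsub_vadd_eq_vsub_sub, map_sub, h.vanish s hs, sub_zero]
    exact hz
  · refine exists_nonneg_of_neg hQf h₂ (fun q hq => ?_) z
    have := hQ.pos _ hq
    simp only [map_neg, LinearMap.neg_apply] at this ⊢
    linarith
  · refine exists_nonneg_of_neg hQf h₂ (fun q hq => ?_) z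
    have := hQ.pos_of_pos α hα hp _ hq
    simp only [map_neg] at this
    linarith
  · exact exists_nonneg_of_neg h.isVFacet h₁ hn z

/-- Two opposite panel cones enclose a strip. -/
theorem IsPanelDir.strip_subset (h : 𝔸.IsPanelDir S β) {T : Set P} (hT : 𝔸.IsEnclosed T)
    {t₁ t₂ : P} (h₁ : ∀ s ∈ S, s +ᵥ t₁ ∈ T) (h₂ : ∀ s ∈ (Neg.neg ⁻¹' S : Set V), s +ᵥ t₂ ∈ T)
    {z : P} (hz₁ : β (z -ᵥ t₁) ≤ 0) (hz₂ : 0 ≤ β (z -ᵥ t₂)) : z ∈ T := by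
  refine hT.mem fun α hα => ?_
  obtain ⟨s, hs⟩ := h.isVFacet.nonempty
  rcases h.trichotomy hα with rfl | rfl | hp | hn
  · refine ⟨-s +ᵥ t₂, h₂ (-s) (by simpa using hs), ?_⟩
    rw [vsub_vadd_eq_vsub_sub, map_sub, map_neg, h.vanish s hs, neg_zero, sub_zero]
    exact hz₂
  · refine ⟨_, h₁ s hs, ?_⟩
    rw [vsub_vadd_eq_vsub_sub, map_sub, LinearMap.neg_apply, LinearMap.neg_apply, h.vanish s hs,
      neg_zero, sub_zero]
    linarith
  · refine exists_nonneg_of_neg h.isVFacet.neg h₂ (fun q hq => ?_) z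
    have := hp _ hq
    rw [map_neg] at this
    linarith
  · exact exists_nonneg_of_neg h.isVFacet h₁ hn z

/-- In an enclosed set containing a panel cone one can go up, in the direction of `β`, to a wall
that bounds the set or is as high as one likes. -/
theorem IsPanelDir.exists_wall_level (h : 𝔸.IsPanelDir S β) {T : Set P} (hT : 𝔸.IsEnclosed T)
    {t : P} (ht : ∀ s ∈ S, s +ᵥ t ∈ T) (K : ℝ) : ∃ z : P, wall β z ∈ 𝔸.walls ∧
      (∀ s ∈ S, s +ᵥ z ∈ T) ∧ (K ≤ β (z -ᵥ t) ∨ ∀ u ∈ T, β (u -ᵥ z) ≤ 0) := by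
  obtain ⟨Q, hQ⟩ := h.exists_side
  obtain ⟨q, hq⟩ := hQ.chamber.isVFacet.nonempty
  have hβq := hQ.pos q hq
  obtain ⟨D, hD, rfl⟩ := hT
  have hnr := neg_mem_allRoots (𝔸 := 𝔸) (Or.inl h.real)
  -- Only the half-space attached to `-β` limits the ascent along `q`: it is either the whole space,
  -- and any wall beyond `K` serves, or bounded by the wall to be reached. The roots positive on `S`
  -- increase along `q`; those negative on `S` impose nothing on a set containing a cone on `S`.
  have key : ∃ p : P, wall β p ∈ 𝔸.walls ∧ 0 ≤ β (p -ᵥ t) ∧ (∀ u, β (u -ᵥ p) = 0 → u ∈ D (-β)) ∧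
      (K ≤ β (p -ᵥ t) ∨ ∀ u ∈ ⋂ γ ∈ 𝔸.allRoots, D γ, β (u -ᵥ p) ≤ 0) := by
    rcases hD (-β) hnr with hu | ⟨p, hp, hu⟩
    · obtain ⟨G, hG0, hG⟩ := exists_gap (𝔸 := 𝔸)
      obtain ⟨p, hp, h1, -⟩ := hG β h.real ((max K 0 / β q) • q +ᵥ t)
      rw [vsub_vadd_eq_vsub_sub, map_sub, map_smul, smul_eq_mul, div_mul_cancel₀ _ hβq.ne'] at h1
      refine ⟨p, hp, ?_, fun u _ => by rw [hu]; trivial, Or.inl ?_⟩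
      · linarith [le_max_right K 0]
      · linarith [le_max_left K 0]
    · have hw : wall β p ∈ 𝔸.walls := by
        rw [← wall_neg]; exact hp (neg_mem_realRoots h.real)
      have hle : ∀ u ∈ ⋂ γ ∈ 𝔸.allRoots, D γ, β (u -ᵥ p) ≤ 0 := by
        intro u huT
        have := mem_iInter₂.1 huT _ hnr
        rw [hu] at this
        simpa [half] using this
      refine ⟨p, hw, ?_, fun u hu0 => ?_, Or.inr hle⟩
      · obtain ⟨s, hs⟩ := h.isVFacet.nonempty
        have := hle _ (ht s hs)
        rw [vadd_vsub_assoc, map_add, h.vanish s hs, ← neg_vsub_eq_vsub_rev, map_neg] at this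
        linarith
      · rw [hu]; simp [half, hu0]
  obtain ⟨p, hp, hp0, hpD, hpK⟩ := key
  set c := β (p -ᵥ t) / β q with hc
  have hc0 : 0 ≤ c := div_nonneg hp0 hβq.le
  have hcq : c * β q = β (p -ᵥ t) := div_mul_cancel₀ _ hβq.ne'
  have hzp : β ((c • q +ᵥ t) -ᵥ p) = 0 := by
    rw [vadd_vsub_assoc, map_add, map_smul, smul_eq_mul, hcq, ← map_add, vsub_add_vsub_cancel,
      vsub_self, map_zero]
  refine ⟨c • q +ᵥ t, by rwa [wall_eq_wall hzp], fun s hs => ?_, ?_⟩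
  · refine mem_iInter₂.2 fun α hα => ?_
    have e : α ((s +ᵥ (c • q +ᵥ t)) -ᵥ (s +ᵥ t)) = c * α q := by
      rw [vadd_vsub_vadd_cancel_left, vadd_vsub, map_smul, smul_eq_mul]
    have hst := mem_iInter₂.1 (ht s hs) α hα
    rcases h.trichotomy hα with rfl | rfl | hpos | hn
    · exact (hD _ hα).isPart.mem_of_nonneg hst (by rw [e]; positivity)
    · exact hpD _ (by rw [vadd_vsub_assoc, map_add, h.vanish s hs, hzp, add_zero])
    · refine (hD _ hα).isPart.mem_of_nonneg hst ?_
      rw [e]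
      exact mul_nonneg hc0 (hQ.pos_of_pos α hα hpos q hq).le
    · obtain ⟨u, hu, hu'⟩ := exists_nonneg_of_neg h.isVFacet ht hn (s +ᵥ (c • q +ᵥ t))
      exact (hD _ hα).isPart.mem_of_nonneg (mem_iInter₂.1 hu α hα) hu'
  · refine hpK.imp (fun hK => ?_) (fun hle u hu => ?_)
    · rw [vadd_vsub, map_smul, smul_eq_mul, hcq]; exact hK
    · have := hle u hu
      rw [← vsub_sub_vsub_cancel_right u _ p, map_sub, hzp, sub_zero]
      exact this

theorem IsPanelDir.vanish_closure (h : 𝔸.IsPanelDir S β) {ξ : V} (hξ : ξ ∈ closure S) :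
    β ξ = 0 :=
  closure_minimal (t := {v | β v = 0}) h.vanish
    (isClosed_eq (continuous_dual β) continuous_const) hξ

/-- A chamber is enclosed by one of its panels and the germ of the chimney it generates in the
direction of that panel. -/
theorem IsPanelDir.mem_facet_of_mem_chimneyGerm (h : 𝔸.IsPanelDir S β) {Q : Set V}
    (hQ : 𝔸.IsSide S β Q) {x : P} {T : Set P} (hTe : 𝔸.IsEnclosed T)
    (hT : T ∈ 𝔸.chimneyGerm (𝔸.facet x Q) S) (hTx : T ∈ 𝔸.facet x S) : T ∈ 𝔸.facet x Q := by
  obtain ⟨T', -, hT'T, -, ξ, hξ, W, hW, hWT⟩ := exists_of_mem_chimneyGerm h.isVFacet hT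
  obtain ⟨q, hq, -, hqW⟩ := exists_mem_of_mem_facet hQ.chamber.isVFacet hW univ_mem
  have hcone : ∀ s ∈ S, s +ᵥ (ξ +ᵥ (q +ᵥ x)) ∈ T := fun s hs => hT'T (hWT _ hqW s hs)
  have hxT := hTe.mem_of_mem_facet h.isVFacet hTx
  obtain ⟨s, hs⟩ := h.isVFacet.nonempty
  have h2 : ∀ᶠ v in 𝓝 (0 : V), β v < β q :=
    (continuous_dual β).continuousAt.eventually (gt_mem_nhds (by simpa using hQ.pos q hq))
  refine hTe.mem_facet ?_
  filter_upwards [h2] with v hv hvQ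
  refine hTe.mem fun α hα => ?_
  rcases h.trichotomy hα with rfl | rfl | hp | hn
  · exact ⟨x, hxT, by simpa using (hQ.pos v hvQ).le⟩
  · refine ⟨_, hcone s hs, ?_⟩
    rw [vadd_vadd, vadd_vadd, vadd_vsub_vadd_cancel_right]
    simp only [map_sub, map_add, LinearMap.neg_apply, h.vanish s hs, h.vanish_closure hξ]
    linarith
  · exact ⟨x, hxT, by simpa using (hQ.pos_of_pos α hα hp v hvQ).le⟩
  · exact exists_nonneg_of_neg h.isVFacet hcone hn _

end Panels

end Model

end AffineHovel

namespace AffineHovel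

namespace Model

open SimpleRootData

section Levels

variable {I V P : Type*} [Fintype I] [NormedAddCommGroup V] [NormedSpace ℝ V]
  [MetricSpace P] [NormedAddTorsor V P] {𝔸 : Model I V P}

theorem exists_level (β : Dual ℝ V) (h : β ≠ 0) (x : P) (c : ℝ) : ∃ a : P, β (a -ᵥ x) = c := by
  obtain ⟨v, hv⟩ := LinearMap.surjective h c
  exact ⟨v +ᵥ x, by simpa using hv⟩

theorem isSplayedChimneyGerm {S S' : Set V} (hS' : 𝔸.IsVFacet S') (hS : 𝔸.IsSphericalVFacet S)
    (a : P) : 𝔸.IsSplayedChimneyGerm (𝔸.chimneyGerm (𝔸.facet a S') S) :=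
  ⟨_, S, ⟨a, S', hS', rfl⟩, hS, rfl⟩

theorem IsPanelDir.isSplayedChimneyGerm {S : Set V} {β : Dual ℝ V} (h : 𝔸.IsPanelDir S β)
    (a : P) : 𝔸.IsSplayedChimneyGerm (𝔸.chimneyGerm (𝔸.facet a S) S) :=
  Model.isSplayedChimneyGerm h.isVFacet (IsVPanel.isSpherical h.panel) a

end Levels

/-! ### Chimney germs to which the axioms apply. -/

section Germs

variable {I V P : Type*} [Fintype I] [NormedAddCommGroup V] [NormedSpace ℝ V]
  [FiniteDimensional ℝ V] [MetricSpace P] [NormedAddTorsor V P] {𝔸 : Model I V P}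

/-- Enclosed sets are closed, so they contain the cones based at adherent points. -/
theorem chimneyGerm_le_of_le_adherence {F G : Filter P} {S : Set V} (hS : 𝔸.IsVFacet S)
    (h : F ≤ adherence G) : 𝔸.chimneyGerm F S ≤ 𝔸.chimneyGerm G S := by
  intro U hU
  obtain ⟨T, hTe, hTU, -, ξ, hξ, W, hW, hadd⟩ := exists_of_mem_chimneyGerm hS hU
  have hcl : closure W ∈ F := h (mem_adherence.2 ⟨W, hW, subset_rfl⟩)
  have hle : 𝔸.chimneyGerm F S ≤ 𝔸.chimney (F.map fun x => ξ +ᵥ x) S := iInf₂_le ξ hξ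
  refine hle ⟨T, hTe, ?_, hTU⟩
  refine mem_map₂_iff.2 ⟨_, image_mem_map hcl, S, mem_principal_self S, ?_⟩
  rintro _ ⟨_, ⟨u, hu, rfl⟩, s, hs, rfl⟩
  have hc : Continuous fun u : P => s +ᵥ (ξ +ᵥ u) := by fun_prop
  have hm : s +ᵥ (ξ +ᵥ u) ∈ closure T :=
    map_mem_closure (f := fun u : P => s +ᵥ (ξ +ᵥ u)) hc hu fun u hu => hadd u hu s hs
  rwa [hTe.isClosed.closure_eq] at hm

theorem IsPanelDir.isSolidChimneyGerm {S : Set V} {β : Dual ℝ V} (h : 𝔸.IsPanelDir S β)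
    (a : P) : 𝔸.IsSolidChimneyGerm (𝔸.chimneyGerm (𝔸.facet a S) S) :=
  ⟨_, S, ⟨a, S, h.isVFacet, rfl⟩, h.isVFacet, h.isSolid a, rfl⟩

theorem _root_.AffineHovel.SimpleRootData.IsVChamber.isSolidChimneyGerm {Q : Set V}
    (hQ : 𝔸.IsVChamber Q) (a : P) : 𝔸.IsSolidChimneyGerm (𝔸.chimneyGerm (𝔸.facet a Q) Q) :=
  ⟨_, Q, ⟨a, Q, hQ.isVFacet, rfl⟩, hQ.isVFacet, hQ.isSolid a, rfl⟩

end Germs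

end Model

namespace ApartmentSystem

/-! ### Charts of apartments and their rigidity. -/

section Charts

variable {I V P X : Type*} [Fintype I] [NormedAddCommGroup V] [NormedSpace ℝ V]
  [MetricSpace P] [NormedAddTorsor V P] {𝔸 : Model I V P} {𝓘 : ApartmentSystem 𝔸 X}
  {A A' : Set X} {f f' : P → X}

theorem IsChart.injective (hf : 𝓘.IsChart A f) : Function.Injective f :=
  injOn_univ.1 (𝓘.isom_bijOn A hf.1 f hf.2).injOn

theorem IsChart.mem (hf : 𝓘.IsChart A f) (z : P) : f z ∈ A :=
  (𝓘.isom_bijOn A hf.1 f hf.2).mapsTo (mem_univ z)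

theorem IsChart.exists_eq (hf : 𝓘.IsChart A f) {y : X} (hy : y ∈ A) : ∃ z, f z = y := by
  obtain ⟨z, -, hz⟩ := (𝓘.isom_bijOn A hf.1 f hf.2).surjOn hy
  exact ⟨z, hz⟩

theorem IsChart.comp (hf : 𝓘.IsChart A f) {w : P ≃ᵃ[ℝ] P} (hw : w ∈ 𝔸.affineWeyl) :
    𝓘.IsChart A (f ∘ w) :=
  ⟨hf.1, (𝓘.isom_iff A hf.1 f hf.2 _).2 ⟨w, hw, rfl⟩⟩

theorem IsChart.exists_comp (hf : 𝓘.IsChart A f) (hf' : 𝓘.IsChart A f') :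
    ∃ w ∈ 𝔸.affineWeyl, f' = f ∘ w :=
  (𝓘.isom_iff A hf.1 f hf.2 f').1 hf'.2

theorem IsIso.comp {φ : X → X} (h : 𝓘.IsIso A A' φ) (hf : 𝓘.IsChart A f)
    (hA' : A' ∈ 𝓘.apartments) : 𝓘.IsChart A' (φ ∘ f) := by
  obtain ⟨-, f₀, hf₀, h₀⟩ := h
  obtain ⟨w, hw, rfl⟩ := (𝓘.isom_iff A hf.1 f₀ hf₀ f).1 hf.2
  exact IsChart.comp ⟨hA', h₀⟩ hw

/-- The form in which MA2 and MA4 are used: composing `f` with the isomorphism gives the chart of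
`A'`. -/
theorem IsoFixing.exists_chart {F : Filter P} (hf : 𝓘.IsChart A f) (hA' : A' ∈ 𝓘.apartments)
    (h : 𝓘.IsoFixing A A' (clIn 𝔸 f (F.map f))) :
    ∃ f', 𝓘.IsChart A' f' ∧ ∃ T, 𝔸.IsEnclosed T ∧ T ∈ F ∧ EqOn f f' T := by
  obtain ⟨-, φ, hφ, U, hU, hfix⟩ := h
  rw [clIn, comap_map hf.injective] at hU
  obtain ⟨T, hT, hTF, hTU⟩ := hU
  exact ⟨φ ∘ f, hφ.comp hf hA', T, hT, hTF, fun z hz => (hfix _ (hTU hz)).symm⟩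

end Charts

section Rigidity

variable {I V P X : Type*} [Fintype I] [NormedAddCommGroup V] [NormedSpace ℝ V]
  [MetricSpace P] [NormedAddTorsor V P] {𝔸 : Model I V P}
  {𝓘 : ApartmentSystem 𝔸 X} {A : Set X} {f f' : P → X}

theorem IsChart.eq_of_eqOn_isOpen (hf : 𝓘.IsChart A f) (hf' : 𝓘.IsChart A f') {U : Set P}
    (hU : IsOpen U) (hne : U.Nonempty) (h : EqOn f f' U) : f = f' := by
  obtain ⟨w, -, rfl⟩ := hf.exists_comp hf'
  have hfix : ∀ z ∈ U, w z = z := fun z hz => (hf.injective (h hz)).symm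
  obtain ⟨z₀, hz₀⟩ := hne
  have hlin : ∀ v, w.linear v = v := by
    intro v
    have hc : Tendsto (fun t : ℝ => t • v +ᵥ z₀) (𝓝 0) (𝓝 z₀) := by
      have : Continuous fun t : ℝ => t • v +ᵥ z₀ := by fun_prop
      simpa using this.tendsto 0
    have hev : ∀ᶠ t : ℝ in 𝓝[>] 0, t • v +ᵥ z₀ ∈ U :=
      (hc.eventually (hU.mem_nhds hz₀)).filter_mono nhdsWithin_le_nhds
    obtain ⟨t, ht, ht0⟩ := (hev.and self_mem_nhdsWithin).exists
    have h1 := hfix _ ht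
    rw [AffineEquiv.map_vadd, hfix _ hz₀, vadd_right_cancel_iff, map_smul] at h1
    exact smul_right_injective V (ne_of_gt (mem_Ioi.1 ht0)) h1
  funext z
  have h2 : w z = z := by
    have := affineEquiv_vsub w z z₀
    rw [hlin, hfix _ hz₀] at this
    exact vsub_left_injective z₀ this
  simp [h2]

/-- The charts differ by an element of the affine Weyl group that fixes the wall; its linear part
fixes `S`, which leaves the identity and a reflection. -/
theorem IsChart.eq_or_reflect_of_eqOn_wall (hf : 𝓘.IsChart A f) (hf' : 𝓘.IsChart A f')
    {S : Set V} {β : Dual ℝ V} (hS : 𝔸.IsPanelDir S β) {a : P} (h : EqOn f f' (wall β a)) :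
    f' = f ∨ ∃ t : P → P, f' = f ∘ t ∧ ∀ z, β (t z -ᵥ a) = - β (z -ᵥ a) := by
  obtain ⟨w, hw, rfl⟩ := hf.exists_comp hf'
  have hfix : ∀ z ∈ wall β a, w z = z := fun z hz => (hf.injective (h hz)).symm
  have ha : w a = a := hfix a (by simp [wall])
  have hz : ∀ z, w z -ᵥ a = w.linear (z -ᵥ a) := fun z => by
    rw [← affineEquiv_vsub, ha]
  obtain ⟨r, hr, huniq⟩ := hS.exists_stabilizer
  rcases huniq w.linear (Model.linear_mem_weyl hw) (fun s hs => by
    have h1 := hz (s +ᵥ a)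
    rw [hfix _ (by simp [wall, hS.vanish s hs])] at h1
    simpa using h1.symm) with h1 | h1
  · left
    funext z
    have h2 := hz z
    rw [h1] at h2
    have h3 : w z = z := vsub_left_injective a h2
    simp [h3]
  · right
    exact ⟨w, rfl, fun z => by rw [hz, h1, hr]⟩

end Rigidity

end ApartmentSystem

end AffineHovel

namespace AffineHovel

namespace Hovel

open Model SimpleRootData ApartmentSystem

theorem map_eq_of_eqOn {P X : Type*} {F : Filter P} {T : Set P} {f f' : P → X} (hT : T ∈ F)
    (he : EqOn f f' T) : F.map f = F.map f' :=
  map_congr (eventually_of_mem hT he)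

/-! ### The axioms in terms of charts. -/

section Charts

variable {I V P X : Type*} [Fintype I] [NormedAddCommGroup V] [NormedSpace ℝ V]
  [MetricSpace P] [NormedAddTorsor V P] {𝔸 : Model I V P}
  {𝓘 : Hovel 𝔸 X} {A A' : Set X} {f : P → X} {S : Set V}

theorem exists_chart_of_germs (hf : 𝓘.IsChart A f) (hA' : A' ∈ 𝓘.apartments) {R F : Filter P}
    (hR : 𝔸.IsSplayedChimneyGerm R) (hF : 𝔸.IsFacet F ∨ 𝔸.IsSolidChimneyGerm F)
    (mR : f ⁻¹' A' ∈ R) (mF : f ⁻¹' A' ∈ F) :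
    ∃ f', 𝓘.IsChart A' f' ∧ ∃ T, 𝔸.IsEnclosed T ∧ T ∈ R ∧ T ∈ F ∧ EqOn f f' T := by
  have hA : ∀ G : Filter P, A ∈ G.map f := fun G =>
    mem_map.2 (mem_of_superset univ_mem fun z _ => hf.mem z)
  have key := 𝓘.ma4 (R.map f) (F.map f) ⟨A, f, hf, R, hR, rfl⟩
    (hF.imp (fun h => ⟨A, f, hf, F, h, rfl⟩) fun h => ⟨A, f, hf, F, h, rfl⟩)
    A f hf A' hA' (hA R) (hA F) mR mF
  rw [← map_sup] at key
  obtain ⟨f', hf', T, hT, hm, he⟩ := IsoFixing.exists_chart hf hA' key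
  exact ⟨f', hf', T, hT, hm.1, hm.2, he⟩

theorem exists_chart_of_mem (hf : 𝓘.IsChart A f) (hA' : A' ∈ 𝓘.apartments) {x : P}
    (hx : f x ∈ A') : ∃ f', 𝓘.IsChart A' f' ∧ ∃ T, 𝔸.IsEnclosed T ∧ x ∈ T ∧ EqOn f f' T :=
  IsoFixing.exists_chart (F := pure x) hf hA'
    (𝓘.ma2 A f hf A' hA' (pure x) (Or.inl ⟨x, rfl⟩) hx)

theorem mem_titsCone_or_neg (hS : 𝔸.IsVFacet S) {v : V} (hv : v ∈ S) :
    v ∈ 𝔸.titsCone ∨ -v ∈ 𝔸.titsCone := by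
  obtain ⟨J, w, hw, rfl | rfl⟩ := hS
  · exact Or.inl ⟨w, hw, J, hv⟩
  · obtain ⟨u, hu, rfl⟩ := hv
    exact Or.inr ⟨w, hw, J, u, hu, by simp⟩

end Charts

section Germs

variable {I V P X : Type*} [Fintype I] [NormedAddCommGroup V] [NormedSpace ℝ V]
  [FiniteDimensional ℝ V] [MetricSpace P] [NormedAddTorsor V P] {𝔸 : Model I V P}
  {𝓘 : Hovel 𝔸 X} {A A' : Set X} {f : P → X} {S : Set V} {β : Dual ℝ V}

/-- An apartment containing a facet contains an enclosed neighbourhood of it. -/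
theorem exists_chart_of_facet (hf : 𝓘.IsChart A f) (hA' : A' ∈ 𝓘.apartments) {x : P}
    (hS : 𝔸.IsVFacet S) (hm : f ⁻¹' A' ∈ 𝔸.facet x S) :
    ∃ f', 𝓘.IsChart A' f' ∧ ∃ T, 𝔸.IsEnclosed T ∧ T ∈ 𝔸.facet x S ∧ EqOn f f' T := by
  obtain ⟨v, hv⟩ := hS.nonempty
  -- MA2 covers points and germs of intervals but not facets. Two points suffice: near `x`, a root
  -- nonnegative on `S` is compared with `x` and a root nonpositive on `S` with `u +ᵥ x`.
  suffices H : ∃ f', 𝓘.IsChart A' f' ∧ ∃ T, 𝔸.IsEnclosed T ∧ EqOn f f' T ∧ x ∈ T ∧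
      ∃ u ∈ S, u +ᵥ x ∈ T by
    obtain ⟨f', hf', T, hT, he, hx, u, hu, hux⟩ := H
    refine ⟨f', hf', T, hT, hT.mem_facet ?_, he⟩
    filter_upwards [hS.eventually_sub_mem hu] with v hv hvS
    refine hT.mem fun α hα => ?_
    rcases hS.sign hα with hs | hs
    · exact ⟨x, hx, by simpa using hs v hvS⟩
    · refine ⟨_, hux, ?_⟩
      have h1 := hs _ (hv hvS)
      rw [vadd_vsub_vadd_cancel_right, ← neg_sub, map_neg]
      linarith
  -- For `v = 0` there is no interval, and MA2 is applied to the point `x`.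
  by_cases hv0 : v = 0
  · subst hv0
    have hx : f x ∈ A' := by
      have h1 := (mem_localFacet.1 (facet_le_localFacet hm)).self_of_nhds hv
      simpa using h1
    obtain ⟨f', hf', T, hT, hxT, he⟩ := exists_chart_of_mem hf hA' hx
    exact ⟨f', hf', T, hT, he, hxT, 0, hv, by simpa using hxT⟩
  · have hline : ∀ t : ℝ, AffineMap.lineMap x (v +ᵥ x) t = t • v +ᵥ x := fun t => by
      simp [AffineMap.lineMap_apply]
    have hsub : AffineMap.lineMap x (v +ᵥ x) '' Ioc (0 : ℝ) 1 ⊆ (fun v => v +ᵥ x) '' S := by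
      rintro _ ⟨t, ht, rfl⟩
      exact ⟨t • v, hS.smul_mem hv ht.1, (hline t).symm⟩
    have hmem : f ⁻¹' A' ∈ germ x (AffineMap.lineMap x (v +ᵥ x) '' Ioc (0 : ℝ) 1) :=
      nhdsWithin_mono x hsub (facet_le_localFacet hm)
    have hpre : 𝔸.IsPreorderedIntervalGerm
        (germ x (AffineMap.lineMap x (v +ᵥ x) '' Ioc (0 : ℝ) 1)) := by
      refine ⟨x, v +ᵥ x, fun h => ?_, ?_, rfl⟩
      · exact hv0 (by simpa using congrArg (· -ᵥ x) h.symm)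
      · simpa [vsub_vadd_eq_vsub_sub] using mem_titsCone_or_neg hS hv
    obtain ⟨f', hf', T, hT, hTm, he⟩ := IsoFixing.exists_chart hf hA'
      (𝓘.ma2 A f hf A' hA' _ (Or.inr (Or.inl hpre)) hmem)
    have hc : Continuous fun t : ℝ => t • v +ᵥ x := by fun_prop
    have ht : Tendsto (fun t : ℝ => t • v +ᵥ x) (𝓝[>] 0)
        (𝓝[AffineMap.lineMap x (v +ᵥ x) '' Ioc (0 : ℝ) 1] x) := by
      refine tendsto_nhdsWithin_iff.2 ⟨?_, ?_⟩
      · have := (hc.tendsto 0).mono_left (nhdsWithin_le_nhds (s := Ioi (0 : ℝ)))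
        simpa using this
      · filter_upwards [Ioc_mem_nhdsGT (zero_lt_one' ℝ)] with t ht
        exact ⟨t, ht, hline t⟩
    have hev : ∀ᶠ t : ℝ in 𝓝[>] 0, t • v +ᵥ x ∈ T := ht hTm
    obtain ⟨t, htT, ht0⟩ := (hev.and self_mem_nhdsWithin).exists
    refine ⟨f', hf', T, hT, he, ?_, t • v, hS.smul_mem hv ht0, htT⟩
    exact hT.isClosed.mem_of_tendsto (ht.mono_right nhdsWithin_le_nhds) hev

theorem exists_chamber_chart {C : Filter X} (hC : 𝓘.IsChamber C) (hA' : A' ∈ 𝓘.apartments)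
    (hm : A' ∈ C) (hf : 𝓘.IsChart A' f) :
    ∃ y Q, 𝔸.IsVChamber Q ∧ C = (𝔸.facet y Q).map f := by
  obtain ⟨A₁, f₁, hf₁, _, ⟨y, Q, hQ, rfl⟩, rfl⟩ := hC
  obtain ⟨f', hf', T, -, hT, he⟩ := exists_chart_of_facet hf₁ hA' hQ.isVFacet hm
  obtain ⟨w, hw, rfl⟩ := hf.exists_comp hf'
  refine ⟨w y, w.linear '' Q, IsVFacetOfType.image hQ (linear_mem_weyl hw), ?_⟩
  rw [map_eq_of_eqOn hT he, ← map_facet hw, map_map]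

/-- Domination is witnessed in one apartment; this moves it to any apartment containing `C`. The
dominated facet follows because the enclosed set of agreement is closed. -/
theorem Dominates.exists_chart {C F : Filter X} (h : 𝓘.Dominates C F)
    (hA' : A' ∈ 𝓘.apartments) (hm : A' ∈ C) : ∃ f, 𝓘.IsChart A' f ∧ ∃ C₀ F₀,
      C = C₀.map f ∧ F = F₀.map f ∧ F₀ ≤ adherence C₀ := by
  obtain ⟨A₀, f₀, hf₀, _, F₀, ⟨y, Q, hQ, rfl⟩, -, rfl, rfl, hle⟩ := h
  obtain ⟨f', hf', T, hTe, hT, he⟩ := exists_chart_of_facet hf₀ hA' hQ hm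
  refine ⟨f', hf', 𝔸.facet y Q, F₀, map_eq_of_eqOn hT he, map_eq_of_eqOn (hle ?_) he, hle⟩
  exact mem_adherence.2 ⟨T, hT, hTe.isClosed.closure_eq.subset⟩

theorem Dominates.mem {C F : Filter X} (h : 𝓘.Dominates C F) (hA' : A' ∈ 𝓘.apartments)
    (hm : A' ∈ C) : A' ∈ F := by
  obtain ⟨f, hf, C₀, F₀, -, rfl, -⟩ := h.exists_chart hA' hm
  exact mem_map.2 (mem_of_superset univ_mem fun z _ => hf.mem z)

theorem Dominates.eq_or {C : Filter X} (hC : 𝓘.IsChamber C) (hf : 𝓘.IsChart A f)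
    (hm : A ∈ C) (hS : 𝔸.IsPanelDir S β) {Q₁ Q₂ : Set V} (hQ₁ : 𝔸.IsSide S β Q₁)
    (hQ₂ : 𝔸.IsSide S (-β) Q₂) {x : P} (hx : wall β x ∈ 𝔸.walls)
    (hdom : 𝓘.Dominates C ((𝔸.facet x S).map f)) :
    C = (𝔸.facet x Q₁).map f ∨ C = (𝔸.facet x Q₂).map f := by
  obtain ⟨y, Q, hQ, rfl⟩ := exists_chamber_chart hC hf.1 hm hf
  obtain ⟨f', hf', C₀, F₀, h1, h2, hle⟩ := hdom.exists_chart hf.1 hm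
  obtain ⟨w, hw, rfl⟩ := hf.exists_comp hf'
  rw [← map_map] at h1 h2
  have h1' := map_injective hf.injective h1
  have h2' := map_injective hf.injective h2
  have h3 := adherence_map_le (t := w) hle
  rw [← h1', ← h2'] at h3
  exact (facet_eq_or_of_dominates hS hQ₁ hQ₂ hx hQ h3).imp (congrArg _) (congrArg _)

/-- A half-space determined by a splayed and a solid chimney germ on which `A'` meets `A`. -/
theorem exists_chart_half (hf : 𝓘.IsChart A f) (hA' : A' ∈ 𝓘.apartments)
    (hS : 𝔸.IsPanelDir S β) {Q : Set V} (hQ : 𝔸.IsSide S (-β) Q) {a b : P}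
    (h₁ : f ⁻¹' A' ∈ 𝔸.chimneyGerm (𝔸.facet a S) S)
    (h₂ : f ⁻¹' A' ∈ 𝔸.chimneyGerm (𝔸.facet b (Neg.neg ⁻¹' Q)) (Neg.neg ⁻¹' Q)) :
    ∃ f', 𝓘.IsChart A' f' ∧ EqOn f f' (half β a) := by
  have hnQ : 𝔸.IsVChamber (Neg.neg ⁻¹' Q) := IsVFacetOfType.neg hQ.chamber
  obtain ⟨f', hf', T, hT, hT₁, hT₂, he⟩ := exists_chart_of_germs hf hA'
    (hS.isSplayedChimneyGerm a) (Or.inr (hnQ.isSolidChimneyGerm b)) h₁ h₂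
  obtain ⟨s₀, hs₀, h₁'⟩ := exists_vadd_of_mem_chimneyGerm hS.isVFacet hT₁
  obtain ⟨q₀, hq₀, h₂'⟩ := exists_vadd_of_mem_chimneyGerm hnQ.isVFacet hT₂
  refine ⟨f', hf', he.mono fun z hz => hS.half_subset hQ hT h₁' h₂' ?_⟩
  simp only [half, mem_ofPred_eq, vsub_vadd_eq_vsub_sub, map_sub, hS.vanish s₀ hs₀] at hz ⊢
  linarith

/-- A strip determined by two opposite germs on which `A'` meets `A`. -/
theorem exists_chart_strip (hf : 𝓘.IsChart A f) (hA' : A' ∈ 𝓘.apartments)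
    (hS : 𝔸.IsPanelDir S β) {a b : P}
    (h₁ : f ⁻¹' A' ∈ 𝔸.chimneyGerm (𝔸.facet a S) S)
    (h₂ : f ⁻¹' A' ∈ 𝔸.chimneyGerm (𝔸.facet b (Neg.neg ⁻¹' S)) (Neg.neg ⁻¹' S)) :
    ∃ f', 𝓘.IsChart A' f' ∧ ∃ T, 𝔸.IsEnclosed T ∧ EqOn f f' T ∧
      ∀ z, β (z -ᵥ a) ≤ 0 → 0 ≤ β (z -ᵥ b) → z ∈ T := by
  obtain ⟨f', hf', T, hT, hT₁, hT₂, he⟩ := exists_chart_of_germs hf hA'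
    (hS.isSplayedChimneyGerm a) (Or.inr (hS.neg_dir.isSolidChimneyGerm b)) h₁ h₂
  obtain ⟨s₀, hs₀, h₁'⟩ := exists_vadd_of_mem_chimneyGerm hS.isVFacet hT₁
  obtain ⟨q₀, hq₀, h₂'⟩ := exists_vadd_of_mem_chimneyGerm hS.neg_dir.isVFacet hT₂
  refine ⟨f', hf', T, hT, he, fun z hz₁ hz₂ => hS.strip_subset hT h₁' h₂' ?_ ?_⟩
  · rw [vsub_vadd_eq_vsub_sub, map_sub, hS.vanish s₀ hs₀]; linarith
  · rw [vsub_vadd_eq_vsub_sub, map_sub, hS.neg_dir.vanish q₀ hq₀]; linarith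

end Germs

end Hovel

end AffineHovel

namespace AffineHovel

section Levels

variable {V P : Type*} [NormedAddCommGroup V] [NormedSpace ℝ V] [MetricSpace P]
  [NormedAddTorsor V P]

theorem wall_subset_half (β : Dual ℝ V) (p : P) : wall β p ⊆ half β p := fun z hz => by
  simp only [wall, half, mem_ofPred_eq] at *
  exact hz.ge

theorem half_eq_half {β : Dual ℝ V} {p q : P} (h : β (p -ᵥ q) = 0) : half β p = half β q := by
  ext z
  have e : β (z -ᵥ q) = β (z -ᵥ p) + β (p -ᵥ q) := by rw [← map_add, vsub_add_vsub_cancel]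
  simp only [half, mem_ofPred_eq, e, h, add_zero]

end Levels

namespace Model

section WallGerms

variable {I V P : Type*} [Fintype I] [NormedAddCommGroup V] [NormedSpace ℝ V]
  [FiniteDimensional ℝ V] [MetricSpace P] [NormedAddTorsor V P] {𝔸 : Model I V P}
  {S : Set V} {β : Dual ℝ V} {a : P}

theorem IsPanelDir.wall_mem_facet (h : 𝔸.IsPanelDir S β) (ha : wall β a ∈ 𝔸.walls) :
    wall β a ∈ 𝔸.facet a S :=
  (isEnclosed_wall h.real ha).mem_facet
    (Eventually.of_forall fun s hs => by simp [wall, h.vanish s hs])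

theorem IsPanelDir.wall_mem_chimneyGerm (h : 𝔸.IsPanelDir S β) (ha : wall β a ∈ 𝔸.walls) :
    wall β a ∈ 𝔸.chimneyGerm (𝔸.facet a S) S :=
  mem_chimneyGerm_self h.isVFacet (isEnclosed_wall h.real ha)
    fun s hs => by simp [wall, h.vanish s hs]

theorem half_mem_facet (hβ : β ∈ 𝔸.realRoots) (ha : wall β a ∈ 𝔸.walls) {Q : Set V}
    (hQ : ∀ q ∈ Q, 0 ≤ β q) : half β a ∈ 𝔸.facet a Q :=
  (isEnclosed_half hβ ha).mem_facet (Eventually.of_forall fun q hq => by simpa [half] using hQ q hq)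

theorem half_mem_chimneyGerm (hβ : β ∈ 𝔸.realRoots) (ha : wall β a ∈ 𝔸.walls) {Q : Set V}
    (hQv : 𝔸.IsVFacet Q) (hQ : ∀ q ∈ Q, 0 ≤ β q) :
    half β a ∈ 𝔸.chimneyGerm (𝔸.facet a Q) Q :=
  mem_chimneyGerm_self hQv (isEnclosed_half hβ ha) fun q hq => by simpa [half] using hQ q hq

end WallGerms

end Model

namespace Hovel

open Model SimpleRootData ApartmentSystem

/-! ### A half-apartment and a chamber on its wall; the thick case. -/

section HalfApartments

variable {I V P X : Type*} [Fintype I] [NormedAddCommGroup V] [NormedSpace ℝ V]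
  [FiniteDimensional ℝ V] [MetricSpace P] [NormedAddTorsor V P] {𝔸 : Model I V P}
  {𝓘 : Hovel 𝔸 X} {A A' : Set X} {f : P → X} {S : Set V} {β : Dual ℝ V}

/-- The apartment joins the chimney germ that the chamber `F(x, Q)` of `A'` generates in the
direction `S` to the germ of `-Q₂` in the half-apartment of `A`. The first germ has the panel germ
in its adherence, and with the second this encloses the half-apartment. The panel is then in the new
apartment, and with the first germ it encloses the chamber. The root `β'` leaves the side of the
chamber free. -/
theorem exists_chart_of_dominates_side (hf : 𝓘.IsChart A f) {f' : P → X} (hf' : 𝓘.IsChart A' f')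
    (hS : 𝔸.IsPanelDir S β) {x : P} (hx : wall β x ∈ 𝔸.walls) {Q : Set V} {β' : Dual ℝ V}
    (hS' : 𝔸.IsPanelDir S β') (hQ : 𝔸.IsSide S β' Q) {T : Set P} (he : EqOn f f' T)
    (hTR : T ∈ 𝔸.chimneyGerm (𝔸.facet x S) S) (hTF : T ∈ 𝔸.facet x S) :
    ∃ A'' f'', 𝓘.IsChart A'' f'' ∧ EqOn f f'' (half β x) ∧ A'' ∈ (𝔸.facet x Q).map f' := by
  obtain ⟨Q₂, hQ₂⟩ := hS.neg_root.exists_side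
  have hnQ : 𝔸.IsVChamber (Neg.neg ⁻¹' Q₂) := IsVFacetOfType.neg hQ₂.chamber
  have hsplay := Model.isSplayedChimneyGerm (𝔸 := 𝔸) hQ.chamber.isVFacet
    (IsVPanel.isSpherical hS.panel) x
  obtain ⟨A₃, hA₃, hR, hR₂⟩ := 𝓘.ma3 ((𝔸.chimneyGerm (𝔸.facet x Q) S).map f')
    ((𝔸.chimneyGerm (𝔸.facet x (Neg.neg ⁻¹' Q₂)) (Neg.neg ⁻¹' Q₂)).map f)
    ⟨A', f', hf', _, hsplay, rfl⟩ (Or.inr ⟨A, f, hf, _, hnQ.isSolidChimneyGerm x, rfl⟩)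
  have hR₁ : A₃ ∈ (𝔸.chimneyGerm (𝔸.facet x S) S).map f := by
    rw [map_eq_of_eqOn hTR he]
    exact map_mono (chimneyGerm_le_of_le_adherence hS.isVFacet (facet_le_adherence hQ x)) hR
  obtain ⟨f₃, hf₃, he₃⟩ := exists_chart_half hf hA₃ hS hQ₂ hR₁ hR₂
  refine ⟨A₃, f₃, hf₃, he₃, ?_⟩
  have hF : A₃ ∈ (𝔸.facet x S).map f' := by
    rw [← map_eq_of_eqOn hTF he, mem_map]
    refine mem_of_superset (half_mem_facet hS.real hx fun s hs => (hS.vanish s hs).ge) ?_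
    intro z hz
    rw [mem_preimage, he₃ hz]
    exact hf₃.mem z
  obtain ⟨g, hg, U, hU, hU₁, hU₂, heU⟩ := exists_chart_of_germs hf' hA₃ hsplay
    (Or.inl ⟨x, S, hS.isVFacet, rfl⟩) hR hF
  refine mem_map.2 (mem_of_superset (hS'.mem_facet_of_mem_chimneyGerm hQ hU hU₁ hU₂) fun z hz => ?_)
  rw [mem_preimage, heU hz]
  exact hg.mem z

/-- A half-apartment and a chamber dominating a panel of its wall lie in an apartment. -/
theorem exists_chart_of_dominates (hf : 𝓘.IsChart A f) (hS : 𝔸.IsPanelDir S β) {x : P}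
    (hx : wall β x ∈ 𝔸.walls) {C : Filter X} (hC : 𝓘.IsChamber C)
    (hdom : 𝓘.Dominates C ((𝔸.facet x S).map f)) :
    ∃ A' f', 𝓘.IsChart A' f' ∧ EqOn f f' (half β x) ∧ A' ∈ C := by
  obtain ⟨Q₁, hQ₁⟩ := hS.exists_side
  obtain ⟨Q₂, hQ₂⟩ := hS.neg_root.exists_side
  have hC' : 𝓘.Has 𝔸.IsFacet C := by
    obtain ⟨A₀, f₀, hf₀, F, ⟨y, Q, hQ, rfl⟩, rfl⟩ := hC
    exact ⟨A₀, f₀, hf₀, _, ⟨y, Q, hQ.isVFacet, rfl⟩, rfl⟩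
  -- This auxiliary apartment need not contain the half-apartment; it serves to identify `C` with
  -- one of the two model chambers on the panel.
  obtain ⟨A', hA', hR, hAC⟩ := 𝓘.ma3 ((𝔸.chimneyGerm (𝔸.facet x S) S).map f) C
    ⟨A, f, hf, _, hS.isSplayedChimneyGerm x, rfl⟩ (Or.inl hC')
  have hF := hdom.mem hA' hAC
  obtain ⟨f', hf', T, -, hTR, hTF, he⟩ := exists_chart_of_germs hf hA'
    (hS.isSplayedChimneyGerm x) (Or.inl ⟨x, S, hS.isVFacet, rfl⟩) hR hF
  rw [map_eq_of_eqOn hTF he] at hdom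
  rcases Dominates.eq_or hC hf' hAC hS hQ₁ hQ₂ hx hdom with rfl | rfl
  · exact exists_chart_of_dominates_side hf hf' hS hx hS hQ₁ he hTR hTF
  · exact exists_chart_of_dominates_side hf hf' hS hx hS.neg_root hQ₂ he hTR hTF

/-- Once the panel is read in the chart of `D`, lying in the wall forces its base point onto the
wall and its direction into `ker β`. -/
theorem exists_apartment_of_dominates {D M : Set X} {F C : Filter X}
    (hD : 𝓘.IsHalfApartment D M) (hF : 𝓘.IsPanel F) (hM : M ∈ F) (hC : 𝓘.IsChamber C)
    (hdom : 𝓘.Dominates C F) : ∃ A ∈ 𝓘.apartments, D ⊆ A ∧ A ∈ C := by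
  obtain ⟨A, f, hf, β, hβ, p, hp, rfl, rfl⟩ := hD
  obtain ⟨A₀, f₀, hf₀, _, ⟨x₀, S₀, hS₀, -, rfl⟩, rfl⟩ := hF
  have hA : A ∈ (𝔸.facet x₀ S₀).map f₀ := mem_of_superset hM <| by
    rintro _ ⟨z, -, rfl⟩
    exact hf.mem z
  obtain ⟨f₁, hf₁, T, -, hT, he⟩ := exists_chart_of_facet hf₀ hf.1 (IsVPanel.isVFacet hS₀) hA
  obtain ⟨w, hw, rfl⟩ := hf.exists_comp hf₁
  rw [map_eq_of_eqOn hT he, ← map_map, map_facet hw] at hM hdom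
  have hpanel : 𝔸.IsVPanel (w.linear '' S₀) :=
    hS₀.imp fun i hi => IsVFacetOfType.image hi (linear_mem_weyl hw)
  generalize w x₀ = x at hM hdom
  generalize w.linear '' S₀ = S at hM hdom hpanel
  rw [mem_map, preimage_image_eq _ hf.injective] at hM
  have hSv : 𝔸.IsVFacet S := IsVPanel.isVFacet hpanel
  have hx : β (x -ᵥ p) = 0 := (isEnclosed_wall hβ hp).mem_of_mem_facet hSv hM
  have hS : 𝔸.IsPanelDir S β := by
    refine ⟨hpanel, hβ, fun s hs => ?_⟩
    have hev := mem_localFacet.1 (facet_le_localFacet hM)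
    have hc : Tendsto (fun t : ℝ => t • s) (𝓝[>] 0) (𝓝 0) := by
      have : Continuous fun t : ℝ => t • s := by fun_prop
      simpa using (this.tendsto 0).mono_left (nhdsWithin_le_nhds (s := Ioi (0 : ℝ)))
    obtain ⟨t, ht, ht0⟩ := ((hc.eventually hev).and self_mem_nhdsWithin).exists
    have h1 : β ((t • s +ᵥ x) -ᵥ p) = 0 := ht (hSv.smul_mem hs ht0)
    rw [vadd_vsub_assoc, map_add, hx, add_zero, map_smul, smul_eq_mul] at h1
    exact (mul_eq_zero.1 h1).resolve_left (ne_of_gt ht0)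
  obtain ⟨A', f', hf', he', hA'⟩ :=
    exists_chart_of_dominates hf hS (wall_eq_wall hx ▸ hp) hC hdom
  refine ⟨A', hf'.1, ?_, hA'⟩
  rintro _ ⟨z, hz, rfl⟩
  rw [he' (half_eq_half hx ▸ hz)]
  exact hf'.mem z

/-- If `A'` contains the half-apartment `β ≥ β(x)` of `A` and a point `z` of its complement, then
it agrees with `A` near the chamber opposite to that half-apartment at `x`. -/
theorem exists_mem_facet_of_mem_compl (hf : 𝓘.IsChart A f) {f' : P → X}
    (hf' : 𝓘.IsChart A' f') (hS : 𝔸.IsPanelDir S β) {x : P} (hx : wall β x ∈ 𝔸.walls)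
    (he : EqOn f f' (half β x)) {z : P} (hz : f z ∈ A') (hneg : β (z -ᵥ x) < 0)
    {Q : Set V} (hQ : 𝔸.IsSide S (-β) Q) : ∃ T ∈ 𝔸.facet x Q, EqOn f f' T := by
  obtain ⟨Q₁, hQ₁⟩ := hS.exists_side
  have hhalf : half β x ⊆ f ⁻¹' A' := fun u hu => by
    rw [mem_preimage, he hu]; exact hf'.mem u
  -- MA4 requires a facet in place of the point `z`: all roots vanish on the minimal vectorial
  -- facet, so an enclosed set containing `z` contains this facet at `z`.
  have hzf : f ⁻¹' A' ∈ 𝔸.facet z (𝔸.stdFacet univ) := by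
    obtain ⟨g, hg, T, hT, hzT, heT⟩ := exists_chart_of_mem hf hf'.1 hz
    refine mem_of_superset (hT.mem_facet (Eventually.of_forall fun v hv => ?_)) fun u hu => by
      rw [mem_preimage, heT hu]; exact hg.mem u
    exact hT.mem fun α hα => ⟨z, hzT, by simp [root_eq_zero_of_mem_stdFacet_univ hα hv]⟩
  obtain ⟨g, hg, T, hT, hT₁, hT₂, heT⟩ := exists_chart_of_germs hf hf'.1
    (Model.isSplayedChimneyGerm hQ₁.chamber.isVFacet hQ₁.chamber.isSpherical x)
    (Or.inl ⟨z, _, isVFacet_stdFacet univ, rfl⟩)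
    (mem_of_superset (half_mem_chimneyGerm hS.real hx hQ₁.chamber.isVFacet
      fun q hq => (hQ₁.pos q hq).le) hhalf) hzf
  have hzT : z ∈ T := hT.mem_of_mem_facet (isVFacet_stdFacet univ) hT₂
  obtain ⟨q₀, -, hq₀⟩ := exists_vadd_of_mem_chimneyGerm hQ₁.chamber.isVFacet hT₁
  -- Roots negative on `S` are negative on `Q₁` and tend to `-∞` along the cone on `Q₁` in `T`; the
  -- others are compared with `z`.
  have hzS : ∀ s ∈ S, s +ᵥ z ∈ T := by
    refine fun s hs => hT.mem fun α hα => ?_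
    rcases hS.trichotomy hα with rfl | rfl | hpos | hneg
    · exact ⟨z, hzT, by simp [hS.vanish s hs]⟩
    · exact ⟨z, hzT, by simp [hS.vanish s hs]⟩
    · exact ⟨z, hzT, by simpa using (hpos s hs).le⟩
    · refine exists_nonneg_of_neg hQ₁.chamber.isVFacet hq₀ (fun q hq => ?_) _
      have := hQ₁.pos_of_pos (-α) (neg_mem_allRoots hα) (fun s hs => by simpa using hneg s hs) q hq
      simpa using this
  have hTA : T ⊆ f ⁻¹' A' := fun u hu => by
    rw [mem_preimage, heT hu]; exact hg.mem u
  obtain ⟨f₁, hf₁, U, hU, heU, hUm⟩ := exists_chart_strip hf hf'.1 hS.neg_root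
    (mem_of_superset (mem_chimneyGerm_self hS.isVFacet hT hzS) hTA)
    (mem_of_superset (hS.neg_dir.wall_mem_chimneyGerm hx)
      ((wall_subset_half β x).trans hhalf))
  have hUm' : ∀ u, β (z -ᵥ x) ≤ β (u -ᵥ x) → β (u -ᵥ x) ≤ 0 → u ∈ U := fun u h₁ h₂ => by
    refine hUm u ?_ (by simpa using h₂)
    rw [← vsub_sub_vsub_cancel_right u z x, LinearMap.neg_apply, map_sub]
    linarith
  have hwall : EqOn f' f₁ (wall β x) := fun u hu => by
    rw [← he (wall_subset_half β x hu)]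
    have hu' : β (u -ᵥ x) = 0 := hu
    exact heU (hUm' u (by linarith) hu'.le)
  refine ⟨U, hU.mem_facet ?_, ?_⟩
  · have hc : ∀ᶠ v in 𝓝 (0 : V), β (z -ᵥ x) < β v :=
      (continuous_dual β).continuousAt.eventually (lt_mem_nhds (by simpa using hneg))
    filter_upwards [hc] with v hv hvQ
    have h1 := hQ.pos v hvQ
    rw [LinearMap.neg_apply] at h1
    exact hUm' _ (by simpa using hv.le) (by simp; linarith)
  · rcases hf'.eq_or_reflect_of_eqOn_wall hf₁ hS hwall with rfl | ⟨t, rfl, ht⟩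
    · exact heU
    -- In the reflected case `f z` would be the value of `f` at the mirror image of `z`, which lies
    -- in the half-space where `f` and `f'` agree.
    · exfalso
      have h1 : f z = f' (t z) := heU (hUm' z le_rfl hneg.le)
      have h2 : f (t z) = f' (t z) := he (by
        simp only [half, mem_ofPred_eq, ht]; linarith)
      have h3 := hf.injective (h1.trans h2.symm)
      have h4 := ht z
      rw [← h3] at h4
      linarith

/-- In a thick hovel, every half-apartment is an intersection of two apartments. -/
theorem IsThick.eq_inter (hthick : 𝓘.IsThick) {D M : Set X} (hD : 𝓘.IsHalfApartment D M) :
    ∃ A₁ ∈ 𝓘.apartments, ∃ A₂ ∈ 𝓘.apartments, D = A₁ ∩ A₂ := by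
  obtain ⟨A, f, hf, β, hβ, x, hx, rfl, rfl⟩ := hD
  obtain ⟨S, hS⟩ := exists_isPanelDir hβ
  obtain ⟨Q₁, hQ₁⟩ := hS.exists_side
  obtain ⟨Q₂, hQ₂⟩ := hS.neg_root.exists_side
  have h3 := hthick ((𝔸.facet x S).map f)
    ⟨A, f, hf, _, ⟨x, S, hS.panel, ⟨β, hβ, hx, hS.span_eq⟩, rfl⟩, rfl⟩
  obtain ⟨C, ⟨hC, hdom⟩, hne⟩ : ∃ C ∈ {C | 𝓘.IsChamber C ∧ 𝓘.Dominates C ((𝔸.facet x S).map f)},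
      C ∉ ({(𝔸.facet x Q₁).map f, (𝔸.facet x Q₂).map f} : Set (Filter X)) := by
    by_contra! hsub
    have h2 := h3.trans ((encard_le_encard hsub).trans (encard_insert_le _ _))
    rw [encard_singleton] at h2
    exact absurd h2 (by norm_num)
  obtain ⟨A', f', hf', he, hA'⟩ := exists_chart_of_dominates hf hS hx hC hdom
  refine ⟨A, hf.1, A', hf'.1, Subset.antisymm ?_ ?_⟩
  · rintro _ ⟨z, hz, rfl⟩
    exact ⟨hf.mem z, he hz ▸ hf'.mem z⟩
  · rintro y ⟨hy, hy'⟩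
    obtain ⟨z, rfl⟩ := hf.exists_eq hy
    by_contra hz
    have hneg : β (z -ᵥ x) < 0 := by
      by_contra! h
      exact hz ⟨z, h, rfl⟩
    -- Now `A` and `A'` share both model chambers on the panel, so `C`, being in `A'`, would be one
    -- of them.
    obtain ⟨T, hT, heT⟩ := exists_mem_facet_of_mem_compl hf hf' hS hx he hy' hneg hQ₂
    rw [map_eq_of_eqOn (half_mem_facet hβ hx fun s hs => (hS.vanish s hs).ge) he] at hdom
    refine hne ?_
    rw [map_eq_of_eqOn hT heT, map_eq_of_eqOn
      (half_mem_facet hβ hx fun q hq => (hQ₁.pos q hq).le) he]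
    exact Dominates.eq_or hC hf' hA' hS hQ₁ hQ₂ hx hdom

end HalfApartments

end Hovel

end AffineHovel

namespace AffineHovel

namespace Hovel

open Model SimpleRootData ApartmentSystem

/-! ### Gluing two half-apartments up to a wall. -/

section Gluing

variable {V P X : Type*} [NormedAddCommGroup V] [NormedSpace ℝ V] [MetricSpace P]
  [NormedAddTorsor V P] {f f₁ h : P → X} {β : Dual ℝ V} {x : P} {c : ℝ}

/-- `h` agrees with `f₁` where `β ≤ β(x)`, and with `f` where `β(x) ≤ β ≤ β(x) + c`. -/
def IsGluing (β : Dual ℝ V) (x : P) (f f₁ h : P → X) (c : ℝ) : Prop :=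
  (∀ z, β (z -ᵥ x) ≤ 0 → h z = f₁ z) ∧ ∀ z, 0 ≤ β (z -ᵥ x) → β (z -ᵥ x) ≤ c → h z = f z

theorem IsGluing.wall_eqOn (hg : IsGluing β x f f₁ h c) (hc : 0 ≤ c) {a : P}
    (ha : β (a -ᵥ x) = c) : EqOn f h (wall β a) := fun z hz => by
  have h0 : β (z -ᵥ a) = 0 := hz
  have h1 : β (z -ᵥ x) = c := by
    rw [← vsub_add_vsub_cancel z a x, map_add, h0, ha, zero_add]
  exact (hg.2 z (h1 ▸ hc) h1.le).symm

theorem mem_half_neg_iff {a z : P} (ha : β (a -ᵥ x) = c) :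
    z ∈ half (-β) a ↔ β (z -ᵥ x) ≤ c := by
  rw [← vsub_add_vsub_cancel z a x, map_add, ha]
  simp [half]

theorem IsGluing.of_eqOn_half (hg : IsGluing β x f f₁ h c) (hc : 0 ≤ c) {a : P}
    (ha : β (a -ᵥ x) = c) {h' : P → X} (he : EqOn h h' (half (-β) a)) :
    IsGluing β x f f₁ h' c :=
  ⟨fun z hz => by rw [← he ((mem_half_neg_iff ha).2 (hz.trans hc)), hg.1 z hz],
    fun z hz hz' => by rw [← he ((mem_half_neg_iff ha).2 hz'), hg.2 z hz hz']⟩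

end Gluing

section HalfApartments

variable {I V P X : Type*} [Fintype I] [NormedAddCommGroup V] [NormedSpace ℝ V]
  [FiniteDimensional ℝ V] [MetricSpace P] [NormedAddTorsor V P] {𝔸 : Model I V P}
  {𝓘 : Hovel 𝔸 X} {A A₁ A' : Set X} {f f₁ h : P → X} {S : Set V} {β : Dual ℝ V} {x : P} {c : ℝ}

/-- Two half-apartments with the same wall can be described by charts agreeing on that wall, as
opposite half-spaces. -/
theorem IsHalfApartment.exists_chart {D : Set X} (hf : 𝓘.IsChart A f) (hβ : β ∈ 𝔸.realRoots)
    (hx : wall β x ∈ 𝔸.walls) (hD : 𝓘.IsHalfApartment D (f '' wall β x)) :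
    ∃ A₁ f₁, 𝓘.IsChart A₁ f₁ ∧ EqOn f f₁ (wall β x) ∧ D = f₁ '' half (-β) x := by
  obtain ⟨A₁, f₀, hf₀, γ, hγ, y, hy, rfl, hM⟩ := hD
  obtain ⟨S, hS⟩ := exists_isPanelDir hβ
  have hsub : wall β x ⊆ f ⁻¹' A₁ := by
    rw [← image_subset_iff, hM]
    rintro _ ⟨z, -, rfl⟩
    exact hf₀.mem z
  -- A strip of width zero: the germs of `S` and `-S` in the wall enclose the wall itself.
  obtain ⟨f₁, hf₁, T, -, he, hT⟩ := exists_chart_strip hf hf₀.1 hS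
    (mem_of_superset (hS.wall_mem_chimneyGerm hx) hsub)
    (mem_of_superset (hS.neg_dir.wall_mem_chimneyGerm hx) hsub)
  have he₁ : EqOn f f₁ (wall β x) := fun z hz =>
    he (hT z (le_of_eq hz) (le_of_eq (Eq.symm hz)))
  obtain ⟨w, hw, rfl⟩ := hf₁.exists_comp hf₀
  rw [he₁.image_eq, image_comp, image_eq_image hf₁.injective, image_wall] at hM
  rw [image_comp, image_half]
  have hγ' : act w.linear γ ∈ 𝔸.realRoots := act_mem_realRoots (linear_mem_weyl hw) hγ
  generalize act w.linear γ = γ at hM hγ'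
  generalize w y = y at hM
  have hxy : γ (x -ᵥ y) = 0 := by
    have : x ∈ wall β x := by simp [wall]
    rwa [hM] at this
  have hγS : ∀ s ∈ S, γ s = 0 := by
    intro s hs
    have h1 : s +ᵥ x ∈ wall β x := by simp [wall, hS.vanish s hs]
    rw [hM] at h1
    have h2 : γ ((s +ᵥ x) -ᵥ y) = 0 := h1
    rwa [vadd_vsub_assoc, map_add, hxy, add_zero] at h2
  rw [← half_eq_half hxy]
  obtain ⟨s₀, hs₀⟩ := hS.isVFacet.nonempty
  rcases hS.trichotomy (Or.inl hγ') with rfl | rfl | hpos | hneg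
  -- The chart sees `D` on the wrong side; the reflection in the wall corrects this without changing
  -- the wall.
  · obtain ⟨t, ht, ht', hfix⟩ := exists_reflection hβ hx
    refine ⟨A₁, f₁ ∘ t, hf₁.comp ht, fun z hz => ?_, ?_⟩
    · rw [Function.comp_apply, hfix z hz]
      exact he₁ hz
    · rw [image_comp, image_eq_of_forall t (B := half γ x)]
      intro z
      simp [half, ht']
  · exact ⟨A₁, f₁, hf₁, he₁, rfl⟩
  · exact absurd (hpos s₀ hs₀) (by simp [hγS s₀ hs₀])
  · exact absurd (hneg s₀ hs₀) (by simp [hγS s₀ hs₀])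

/-- Moves a gluing into a prescribed apartment `A'`. Seen through `h`, the cone on `S` at level `c`
and the germ of `-Q` enclose the half-space below level `c`, so `A'` contains its image. -/
theorem IsGluing.exists_isGluing_of_germs (hh : 𝓘.IsChart A h) (hg : IsGluing β x f f₁ h c)
    (hc : 0 ≤ c) (hS : 𝔸.IsPanelDir S β) (hx : wall β x ∈ 𝔸.walls) {Q : Set V}
    (hQ : 𝔸.IsSide S β Q) {a : P} (ha : β (a -ᵥ x) = c) (haw : wall β a ∈ 𝔸.walls)
    (hA' : A' ∈ 𝓘.apartments) {T : Set P} (hT : 𝔸.IsEnclosed T) (hTA : T ⊆ f ⁻¹' A')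
    (haT : ∀ s ∈ S, s +ᵥ a ∈ T)
    (hm : f₁ ⁻¹' A' ∈ 𝔸.chimneyGerm (𝔸.facet x (Neg.neg ⁻¹' Q)) (Neg.neg ⁻¹' Q)) :
    ∃ h', 𝓘.IsChart A' h' ∧ IsGluing β x f f₁ h' c := by
  have hQ' : 𝔸.IsSide S (- -β) Q := by rwa [neg_neg]
  have hnQ : 𝔸.IsVChamber (Neg.neg ⁻¹' Q) := IsVFacetOfType.neg hQ.chamber
  have hm₁ : h ⁻¹' A' ∈ 𝔸.chimneyGerm (𝔸.facet a S) S := by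
    refine mem_of_superset (mem_chimneyGerm_self hS.isVFacet
      (hT.inter (isEnclosed_wall hS.real haw)) fun s hs => ⟨haT s hs, ?_⟩) ?_
    · simp [wall, hS.vanish s hs]
    · rintro z ⟨hz, hz'⟩
      rw [mem_preimage, ← hg.wall_eqOn hc ha hz']
      exact hTA hz
  have hm₂ : h ⁻¹' A' ∈ 𝔸.chimneyGerm (𝔸.facet x (Neg.neg ⁻¹' Q)) (Neg.neg ⁻¹' Q) := by
    have hhalf := half_mem_chimneyGerm (𝔸 := 𝔸) (β := -β) (a := x) (neg_mem_realRoots hS.real)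
      (by rwa [wall_neg]) hnQ.isVFacet fun q hq => by
        have := hQ.pos (-q) hq
        rw [map_neg] at this
        exact this.le
    filter_upwards [hm, hhalf] with z hz hz'
    rw [mem_preimage, hg.1 z ((mem_half_neg_iff (c := 0) (by simp)).1 hz')]
    exact hz
  obtain ⟨h', hh', he⟩ := exists_chart_half hh hA' hS.neg_root hQ' hm₁ hm₂
  exact ⟨h', hh', hg.of_eqOn_half hc ha he⟩

/-- A chart on which the gluing succeeds up to a wall can be replaced by one on which it succeeds
up to a further wall. -/
theorem IsGluing.exists_gt (hf : 𝓘.IsChart A f) (hh : 𝓘.IsChart A' h)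
    (hinj : ∀ z z', 0 < β (z -ᵥ x) → β (z' -ᵥ x) ≤ 0 → f z ≠ f₁ z')
    (hg : IsGluing β x f f₁ h c) (hc : 0 ≤ c) (hS : 𝔸.IsPanelDir S β) {a : P}
    (ha : β (a -ᵥ x) = c) (haw : wall β a ∈ 𝔸.walls) :
    ∃ b : P, wall β b ∈ 𝔸.walls ∧ c < β (b -ᵥ x) ∧ ∃ A'' h', 𝓘.IsChart A'' h' ∧
      IsGluing β x f f₁ h' (β (b -ᵥ x)) := by
  obtain ⟨Q, hQ⟩ := hS.exists_side
  have hF : (𝔸.facet a S).map f = (𝔸.facet a S).map h :=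
    map_eq_of_eqOn (hS.wall_mem_facet haw) (hg.wall_eqOn hc ha)
  have hdom : 𝓘.Dominates ((𝔸.facet a Q).map f) ((𝔸.facet a S).map h) :=
    ⟨A, f, hf, _, _, ⟨a, Q, hQ.chamber.isVFacet, rfl⟩, ⟨a, S, hS.isVFacet, rfl⟩, rfl, hF.symm,
      facet_le_adherence hQ a⟩
  -- Statement 1 for the half-apartment below level `c` in the chart `h` and the chamber of `f` just
  -- above the wall at level `c`.
  obtain ⟨A'', h', hh', he, hA''⟩ := exists_chart_of_dominates hh hS.neg_root
    (by rwa [wall_neg]) ⟨A, f, hf, _, ⟨a, Q, hQ.chamber, rfl⟩, rfl⟩ hdom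
  have hg' := hg.of_eqOn_half hc ha he
  have hwall : wall β a ⊆ f ⁻¹' A'' := fun z hz => by
    rw [mem_preimage, hg'.wall_eqOn hc ha hz]
    exact hh'.mem z
  obtain ⟨g, hgc, T, hT, hT₁, hT₂, heT⟩ := exists_chart_of_germs hf hh'.1
    (hS.isSplayedChimneyGerm a) (Or.inl ⟨a, Q, hQ.chamber.isVFacet, rfl⟩)
    (mem_of_superset (hS.wall_mem_chimneyGerm haw) hwall) hA''
  obtain ⟨s₀, hs₀, hsT⟩ := exists_vadd_of_mem_chimneyGerm hS.isVFacet hT₁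
  obtain ⟨b, hbw, hbT, hb⟩ := hS.exists_wall_level hT hsT 1
  have hlev : ∀ z, β (z -ᵥ x) = β (z -ᵥ a) + c := fun z => by
    rw [← vsub_add_vsub_cancel z a x, map_add, ha]
  have hba : 0 < β (b -ᵥ a) := by
    rcases hb with hb | hb
    · rw [vsub_vadd_eq_vsub_sub, map_sub, hS.vanish s₀ hs₀] at hb
      linarith
    -- The set `T` contains a point of the chamber above `a`, so a wall bounding `T` is strictly
    -- above `a`.
    · obtain ⟨q, hq, -, hqT⟩ := exists_mem_of_mem_facet hQ.chamber.isVFacet hT₂ univ_mem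
      have h1 := hb _ hqT
      rw [vadd_vsub_assoc, map_add, ← neg_vsub_eq_vsub_rev, map_neg] at h1
      have := hQ.pos q hq
      linarith
  refine ⟨b, hbw, by rw [hlev]; linarith, A'', h', hh', hg'.1, fun z hz hz' => ?_⟩
  obtain ⟨f', hf', U, -, heU, hU⟩ := exists_chart_strip hf hh'.1 hS
    (mem_of_superset (mem_chimneyGerm_self hS.isVFacet hT hbT) fun z hz => by
      rw [mem_preimage, heT hz]; exact hgc.mem z)
    (mem_of_superset (hS.neg_dir.wall_mem_chimneyGerm haw) hwall)
  have hU' : ∀ z, 0 ≤ β (z -ᵥ a) → β (z -ᵥ a) ≤ β (b -ᵥ a) → f z = f' z := fun z h1 h2 => by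
    refine heU (hU z ?_ h1)
    rw [← vsub_sub_vsub_cancel_right z b a, map_sub]
    linarith
  have heq : f' = h' := by
    rcases hh'.eq_or_reflect_of_eqOn_wall hf' hS (a := a) (fun z hz => by
      rw [← hg'.wall_eqOn hc ha hz]
      have h0 : β (z -ᵥ a) = 0 := hz
      exact hU' z h0.ge (by linarith)) with h1 | ⟨t, rfl, ht⟩
    · exact h1
    -- If the charts differed by the reflection, `f b` would be the value of `h'` at a point below
    -- level `c`: either a value of `f₁` on the other half, against `hinj`, or a value of `f` at
    -- another point.
    · exfalso
      have h1 : f b = h' (t b) := hU' b hba.le le_rfl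
      have h2 := ht b
      rcases le_total (β (t b -ᵥ x)) 0 with h3 | h3
      · rw [hg'.1 _ h3] at h1
        exact hinj b (t b) (by rw [hlev]; linarith) h3 h1
      · rw [hg'.2 _ h3 (by rw [hlev]; linarith)] at h1
        rw [← hf.injective h1] at h2
        linarith
  rcases le_total (β (z -ᵥ x)) c with h1 | h1
  · exact hg'.2 z hz h1
  · rw [← heq]
    rw [hlev] at h1 hz'
    rw [hlev] at hz'
    exact (hU' z (by linarith) (by linarith)).symm

end HalfApartments

end Hovel

end AffineHovel

namespace AffineHovel

namespace Hovel

open Model SimpleRootData ApartmentSystem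

/-! ### Unboundedness of the gluing levels and the union of half-apartments. -/

section Union

variable {I V P X : Type*} [Fintype I] [NormedAddCommGroup V] [NormedSpace ℝ V]
  [FiniteDimensional ℝ V] [MetricSpace P] [NormedAddTorsor V P] {𝔸 : Model I V P}
  {𝓘 : Hovel 𝔸 X} {A A₁ A' : Set X} {f f₁ h : P → X} {S : Set V} {β : Dual ℝ V} {x : P} {c : ℝ}

variable (𝓘) in
/-- The levels of the walls up to which `f` and `f₁` can be glued. -/
def gluingLevels (β : Dual ℝ V) (x : P) (f f₁ : P → X) : Set ℝ :=
  {c | 0 ≤ c ∧ (∃ a, wall β a ∈ 𝔸.walls ∧ β (a -ᵥ x) = c) ∧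
    ∃ A h, 𝓘.IsChart A h ∧ IsGluing β x f f₁ h c}

/-- The levels of gluing contain a bound of any of their subsets that is approached from below. -/
theorem exists_ge_mem_gluingLevels (hf : 𝓘.IsChart A f) (hf₁ : 𝓘.IsChart A₁ f₁)
    (hS : 𝔸.IsPanelDir S β) (hx : wall β x ∈ 𝔸.walls) {m : ℝ} (hm : 0 < m)
    (happrox : ∀ u < m, ∃ c ∈ 𝓘.gluingLevels β x f f₁, u < c ∧ c < m) :
    ∃ k ∈ 𝓘.gluingLevels β x f f₁, m ≤ k := by
  obtain ⟨Q₁, hQ₁⟩ := hS.exists_side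
  obtain ⟨Q₂, hQ₂⟩ := hS.neg_root.exists_side
  have hnQ : 𝔸.IsVChamber (Neg.neg ⁻¹' Q₁) := IsVFacetOfType.neg hQ₁.chamber
  have hβ0 : β ≠ 0 := ne_zero_of_mem_realRoots hS.real
  obtain ⟨a, ha⟩ := exists_level β hβ0 x m
  -- Level `m` need not carry a wall. The chamber at `a` below level `m` generates a germ containing
  -- cones on `S` at all levels slightly below `m`, so one apartment `A'` serves every gluing level
  -- close to `m`.
  obtain ⟨A', hA', hR, hR₁⟩ := 𝓘.ma3 ((𝔸.chimneyGerm (𝔸.facet a Q₂) S).map f)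
    ((𝔸.chimneyGerm (𝔸.facet x (Neg.neg ⁻¹' Q₁)) (Neg.neg ⁻¹' Q₁)).map f₁)
    ⟨A, f, hf, _, Model.isSplayedChimneyGerm hQ₂.chamber.isVFacet
      (IsVPanel.isSpherical hS.panel) a, rfl⟩
    (Or.inr ⟨A₁, f₁, hf₁, _, hnQ.isSolidChimneyGerm x, rfl⟩)
  obtain ⟨T, hT, hTA, -, ξ, hξ, W, hW, hadd⟩ := exists_of_mem_chimneyGerm hS.isVFacet hR
  obtain ⟨q, hq⟩ := hQ₂.chamber.isVFacet.nonempty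
  have hq0 : 0 < - β q := hQ₂.pos q hq
  obtain ⟨δ, hδ, hδW⟩ : ∃ δ > (0 : ℝ), ∀ t, 0 < t → t < δ → t • q +ᵥ a ∈ W := by
    have hc : Tendsto (fun t : ℝ => t • q) (𝓝[>] 0) (𝓝 0) := by
      have : Continuous fun t : ℝ => t • q := by fun_prop
      simpa using (this.tendsto 0).mono_left (nhdsWithin_le_nhds (s := Ioi (0 : ℝ)))
    obtain ⟨δ, hδ, hsub⟩ := mem_nhdsGT_iff_exists_Ioo_subset.1
      (hc.eventually (mem_localFacet.1 (facet_le_localFacet hW)))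
    exact ⟨δ, hδ, fun t h1 h2 => hsub ⟨h1, h2⟩ (hQ₂.chamber.isVFacet.smul_mem hq h1)⟩
  have hlev : ∀ t : ℝ, β ((ξ +ᵥ (t • q +ᵥ a)) -ᵥ x) = m - t * (- β q) := fun t => by
    rw [vadd_vsub_assoc, vadd_vsub_assoc, map_add, map_add, hS.vanish_closure hξ, ha, map_smul,
      smul_eq_mul]
    ring
  obtain ⟨c, ⟨hc0, ⟨a₀, ha₀, ha₀c⟩, A₀, h, hh, hg⟩, hcu, hcm⟩ :=
    happrox (max 0 (m - δ * (- β q))) (max_lt hm (by nlinarith))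
  obtain ⟨hc, hcδ⟩ := max_lt_iff.1 hcu
  set t := (m - c) / (- β q) with ht
  have ht0 : 0 < t := div_pos (by linarith) hq0
  have htδ : t < δ := by rw [ht, div_lt_iff₀ hq0]; linarith
  have htq : t * (- β q) = m - c := div_mul_cancel₀ _ hq0.ne'
  set b := ξ +ᵥ (t • q +ᵥ a) with hb
  have hbc : β (b -ᵥ x) = c := by rw [hlev, htq]; ring
  have hbw : wall β b ∈ 𝔸.walls := by
    rwa [wall_eq_wall (q := a₀)]
    rw [← vsub_sub_vsub_cancel_right b a₀ x, map_sub, hbc, ha₀c, sub_self]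
  have hbT : ∀ s ∈ S, s +ᵥ b ∈ T := hadd _ (hδW t ht0 htδ)
  obtain ⟨h', hh', hg'⟩ := hg.exists_isGluing_of_germs hh hc0 hS hx hQ₁ hbc hbw hA' hT hTA hbT hR₁
  -- The ascent in `T` from level `c` stops at level `m` or above: a wall bounding `T` cannot be
  -- lower, since `T` has points at levels arbitrarily close to `m`.
  obtain ⟨z, hzw, hzT, hz⟩ := hS.exists_wall_level hT hbT (m - c)
  have hzm : m ≤ β (z -ᵥ x) := by
    rcases hz with hz | hz
    · rw [← vsub_sub_vsub_cancel_right z b x, map_sub, hbc] at hz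
      linarith
    · by_contra! hlt
      obtain ⟨s, hs⟩ := hS.isVFacet.nonempty
      -- Keeps `τ < δ` and makes the level `m - τ(-β(q))` at least halfway from that of `z` to `m`.
      set τ := min (δ / 2) ((m - β (z -ᵥ x)) / (2 * (- β q))) with hτ
      have hτ0 : 0 < τ := lt_min (by linarith) (div_pos (by linarith) (by linarith))
      have hτδ : τ < δ := (min_le_left _ _).trans_lt (by linarith)
      have hτq : τ * (2 * (- β q)) ≤ m - β (z -ᵥ x) :=
        (le_div_iff₀ (by linarith)).1 (min_le_right _ _)
      have h1 := hz _ (hadd _ (hδW τ hτ0 hτδ) s hs)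
      rw [← vsub_sub_vsub_cancel_right _ z x, map_sub, vadd_vsub_assoc, map_add, hlev,
        hS.vanish s hs] at h1
      linarith
  refine ⟨β (z -ᵥ x), ⟨by linarith, ⟨z, hzw, rfl⟩, A', h', hh', hg'.1, ?_⟩, hzm⟩
  have hwall : wall β x ⊆ f ⁻¹' A' := fun u hu => by
    have h0 : β (u -ᵥ x) = 0 := hu
    rw [mem_preimage, ← hg'.2 u h0.ge (by linarith)]
    exact hh'.mem u
  obtain ⟨f', hf', U, -, heU, hU⟩ := exists_chart_strip hf hA' hS
    (mem_of_superset (mem_chimneyGerm_self hS.isVFacet hT hzT) hTA)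
    (mem_of_superset (hS.neg_dir.wall_mem_chimneyGerm hx) hwall)
  have hU' : ∀ u, 0 ≤ β (u -ᵥ x) → β (u -ᵥ x) ≤ β (z -ᵥ x) → f u = f' u := fun u h1 h2 => by
    refine heU (hU u ?_ h1)
    rw [← vsub_sub_vsub_cancel_right u z x, map_sub]
    linarith
  have heq : h' = f' := by
    -- The open band is nonempty because `c` was chosen positive; both charts of `A'` equal `f` on
    -- it.
    refine hh'.eq_of_eqOn_isOpen hf' (U := (fun u : P => β (u -ᵥ x)) ⁻¹' Ioo 0 c)
      (isOpen_Ioo.preimage (continuous_level β x)) ?_ fun u hu => ?_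
    · obtain ⟨u, hu⟩ := exists_level β hβ0 x (c / 2)
      exact ⟨u, by rw [mem_preimage, hu]; constructor <;> linarith⟩
    · rw [hg'.2 u hu.1.le hu.2.le]
      exact hU' u hu.1.le (by linarith [hu.2])
  intro u h1 h2
  rw [heq]
  exact (hU' u h1 h2).symm

/-- A finite supremum of the levels could not be attained, by `IsGluing.exists_gt`, and would have
to be, by `exists_ge_mem_gluingLevels`. Level `0` is given by `f₁` itself. -/
theorem exists_gt_mem_gluingLevels (hf : 𝓘.IsChart A f) (hf₁ : 𝓘.IsChart A₁ f₁)
    (hS : 𝔸.IsPanelDir S β) (hx : wall β x ∈ 𝔸.walls) (he : EqOn f f₁ (wall β x))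
    (hinj : ∀ z z', 0 < β (z -ᵥ x) → β (z' -ᵥ x) ≤ 0 → f z ≠ f₁ z') (K : ℝ) :
    ∃ c ∈ 𝓘.gluingLevels β x f f₁, K < c := by
  by_contra! hK
  have h0 : (0 : ℝ) ∈ 𝓘.gluingLevels β x f f₁ :=
    ⟨le_rfl, ⟨x, hx, by simp⟩, A₁, f₁, hf₁, fun _ _ => rfl, fun z h1 h2 =>
      (he (le_antisymm h2 h1)).symm⟩
  have hlub := isLUB_csSup ⟨0, h0⟩ ⟨K, hK⟩
  set m := sSup (𝓘.gluingLevels β x f f₁)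
  have hm : m ∉ 𝓘.gluingLevels β x f f₁ := by
    rintro ⟨hm0, ⟨a, haw, ham⟩, A', h, hh, hg⟩
    obtain ⟨b, hbw, hlt, A'', h', hh', hg'⟩ := hg.exists_gt hf hh hinj hm0 hS ham haw
    exact hlt.not_ge (hlub.1 ⟨by linarith, ⟨b, hbw, rfl⟩, A'', h', hh', hg'⟩)
  have hm0 : 0 < m := lt_of_le_of_ne (hlub.1 h0) fun h => hm (h ▸ h0)
  obtain ⟨k, hk, hmk⟩ := exists_ge_mem_gluingLevels hf hf₁ hS hx hm0 fun u hu => by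
    obtain ⟨c, hc, huc, hcm⟩ := hlub.exists_between hu
    exact ⟨c, hc, huc, lt_of_le_of_ne hcm fun h => hm (h ▸ hc)⟩
  exact hm (le_antisymm (hlub.1 hk) hmk ▸ hk)

/-- The union of two half-apartments meeting in their common wall is an apartment. -/
theorem union_mem_apartments {D D₁ M : Set X} (hD : 𝓘.IsHalfApartment D M)
    (hD₁ : 𝓘.IsHalfApartment D₁ M) (hM : D ∩ D₁ = M) : D ∪ D₁ ∈ 𝓘.apartments := by
  obtain ⟨A, f, hf, β, hβ, x, hx, rfl, rfl⟩ := hD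
  obtain ⟨A₁, f₁, hf₁, he, rfl⟩ := hD₁.exists_chart hf hβ hx
  obtain ⟨S, hS⟩ := exists_isPanelDir hβ
  obtain ⟨Q, hQ⟩ := hS.exists_side
  have hβ0 : β ≠ 0 := ne_zero_of_mem_realRoots hβ
  have hnQ : 𝔸.IsVChamber (Neg.neg ⁻¹' Q) := IsVFacetOfType.neg hQ.chamber
  have hinj : ∀ z z', 0 < β (z -ᵥ x) → β (z' -ᵥ x) ≤ 0 → f z ≠ f₁ z' := fun z z' h1 h2 h3 => by
    have hz : f z ∈ f '' wall β x :=
      hM.subset ⟨⟨z, h1.le, rfl⟩, z', by simpa [half] using h2, h3.symm⟩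
    obtain ⟨u, hu, huz⟩ := hz
    rw [hf.injective huz] at hu
    exact h1.ne' hu
  -- The apartment that will be the union: it joins opposite chamber germs of the two
  -- half-apartments.
  obtain ⟨A', hA', hR, hR₁⟩ := 𝓘.ma3 ((𝔸.chimneyGerm (𝔸.facet x Q) Q).map f)
    ((𝔸.chimneyGerm (𝔸.facet x (Neg.neg ⁻¹' Q)) (Neg.neg ⁻¹' Q)).map f₁)
    ⟨A, f, hf, _, Model.isSplayedChimneyGerm hQ.chamber.isVFacet hQ.chamber.isSpherical x, rfl⟩
    (Or.inr ⟨A₁, f₁, hf₁, _, hnQ.isSolidChimneyGerm x, rfl⟩)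
  obtain ⟨T, hT, hTA, hTR, -⟩ := exists_of_mem_chimneyGerm hQ.chamber.isVFacet hR
  obtain ⟨q₀, hq₀, hqT⟩ := exists_vadd_of_mem_chimneyGerm hQ.chamber.isVFacet hTR
  have hβq : 0 < β q₀ := hQ.pos q₀ hq₀
  have key : ∀ K : ℝ, ∃ c, K ≤ c ∧ 0 ≤ c ∧ ∃ h, 𝓘.IsChart A' h ∧ IsGluing β x f f₁ h c := by
    intro K
    obtain ⟨c, ⟨hc0, ⟨a₀, ha₀, ha₀c⟩, A₀, h, hh, hg⟩, hc⟩ :=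
      exists_gt_mem_gluingLevels hf hf₁ hS hx he hinj (max K (β q₀))
    obtain ⟨hKc, hqc⟩ := max_lt_iff.1 hc
    -- Places `a` at level `c` on the ray of direction `q₀`, inside the cone contained in `T`; this
    -- needs `c > β(q₀)`.
    set t := (c - β q₀) / β q₀ with ht
    have ht0 : 0 < t := div_pos (by linarith) hβq
    set a := t • q₀ +ᵥ (q₀ +ᵥ x) with ha
    have hac : β (a -ᵥ x) = c := by
      rw [ha, vadd_vsub_assoc, vadd_vsub, map_add, map_smul, smul_eq_mul, ht,
        div_mul_cancel₀ _ hβq.ne']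
      ring
    have haw : wall β a ∈ 𝔸.walls := by
      rwa [wall_eq_wall (q := a₀)]
      rw [← vsub_sub_vsub_cancel_right a a₀ x, map_sub, hac, ha₀c, sub_self]
    obtain ⟨h', hh', hg'⟩ := hg.exists_isGluing_of_germs hh hc0 hS hx hQ hac haw hA' hT hTA
      (fun s hs => by
        rw [ha, vadd_vadd]
        exact hqT _ (hQ.add_mem s hs _ (hQ.chamber.isVFacet.smul_mem hq₀ ht0))) hR₁
    exact ⟨c, hKc.le, hc0, h', hh', hg'⟩
  obtain ⟨c₀, -, -, h, hh, hg⟩ := key 0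
  have hval : ∀ z, 0 ≤ β (z -ᵥ x) → h z = f z := fun z hz => by
    obtain ⟨c, hc, -, h', hh', hg'⟩ := key (β (z -ᵥ x))
    -- All the gluing charts of `A'` equal `f₁` on the open half-space `β < β(x)`, so they coincide.
    have heq : h = h' := by
      refine hh.eq_of_eqOn_isOpen hh' (U := (fun u : P => β (u -ᵥ x)) ⁻¹' Iio 0)
        (isOpen_Iio.preimage (continuous_level β x)) ?_ fun u hu => ?_
      · obtain ⟨u, hu⟩ := exists_level β hβ0 x (-1)
        exact ⟨u, by rw [mem_preimage, hu]; simp⟩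
      · rw [hg.1 u (le_of_lt hu), hg'.1 u (le_of_lt hu)]
    rw [heq]
    exact hg'.2 z hz hc
  suffices h : f '' half β x ∪ f₁ '' half (-β) x = A' by rwa [h]
  refine Subset.antisymm ?_ fun y hy => ?_
  · rintro _ (⟨z, hz, rfl⟩ | ⟨z, hz, rfl⟩)
    · rw [← hval z hz]
      exact hh.mem z
    · rw [← hg.1 z ((mem_half_neg_iff (c := 0) (by simp)).1 hz)]
      exact hh.mem z
  · obtain ⟨z, rfl⟩ := hh.exists_eq hy
    rcases le_total 0 (β (z -ᵥ x)) with hz | hz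
    · exact Or.inl ⟨z, hz, (hval z hz).symm⟩
    · exact Or.inr ⟨z, (mem_half_neg_iff (c := 0) (by simp)).2 hz, (hg.1 z hz).symm⟩

end Union

end Hovel

end AffineHovel

theorem proposition2p9 {I V P X : Type*} [Fintype I] [NormedAddCommGroup V] [NormedSpace ℝ V]
    [FiniteDimensional ℝ V] [MetricSpace P] [NormedAddTorsor V P]
    (𝔸 : AffineHovel.Model I V P) (𝓘 : AffineHovel.Hovel 𝔸 X) :
    (∀ (D M : Set X) (F C : Filter X), 𝓘.IsHalfApartment D M →
      𝓘.IsPanel F → M ∈ F → 𝓘.IsChamber C → 𝓘.Dominates C F →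
      ∃ A ∈ 𝓘.apartments, D ⊆ A ∧ A ∈ C) ∧
    (∀ D D₁ M : Set X, 𝓘.IsHalfApartment D M → 𝓘.IsHalfApartment D₁ M →
      D ∩ D₁ = M → D ∪ D₁ ∈ 𝓘.apartments) ∧
    (𝓘.IsThick → ∀ D M : Set X, 𝓘.IsHalfApartment D M →
      ∃ A₁ ∈ 𝓘.apartments, ∃ A₂ ∈ 𝓘.apartments, D = A₁ ∩ A₂) :=
  ⟨fun _ _ _ _ hD hF hM hC hdom =>
      AffineHovel.Hovel.exists_apartment_of_dominates hD hF hM hC hdom,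
    fun _ _ _ hD hD₁ hM => AffineHovel.Hovel.union_mem_apartments hD hD₁ hM,
    fun hthick _ _ hD => hthick.eq_inter hD⟩
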